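/- Fix an integer $d\ge 0$ and a sense of optimization (maximization or minimization). An instance of *nonlinear matroid intersection* consists of two integer matrices $M_1,M_2\in\mathbb{Z}^{r\times n}$, whose vectorial matroids (linear independence of columns over $\mathbb{Q}$) on the ground set $\{1,\dots,n\}$ both have rank $r$ and have at least one common base, an integer weight matrix $W\in\mathbb{Z}^{d\times n}$, and an arbitrary function $f:\mathbb{R}^d\to\mathbb{R}$ that is presented only by a comparison oracle (a query consists of $u,v\in\mathbb{Z}^d$, and the answer tells whether $f(u)\le f(v)$). Let $\mathcal{F}\subseteq\{0,1\}^n$ be the set of characteristic vectors of the common bases of the two matroids. Then there is a randomized algorithm, i.e. a single program (depending only on $d$ and the sense of optimization) for a random access machine that operates on integers, with a generator of independent fair random bits and access to the comparison oracle, and there are polynomials $p,q$, such that on every instance: (i) with probability at least $1/2$ the output is an optimal solution, i.e. a vector $x\in\mathcal{F}$ that maximizes (respectively minimizes) $f(Wx)$ over $\mathcal{F}$; (ii) for every outcome of the random bits the program halts after at most $p(n+\max_{i,j}|W_{i,j}|)$ elementary steps, where arithmetic operations on integers, comparisons, memory accesses, oracle queries and random bits are all counted; and its running time in the logarithmic cost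 measure, where handling an integer costs its bit length, is at most $q(n+\max_{i,j}|W_{i,j}|+L)$, where $L$ is the total binary encoding length of $M_1$ and $M_2$. -/

import Mathlib

namespace MatroidIntersection

/-! ### Vectorial matroids and the optimization problem -/

/-- Column `j` of an integer matrix, as a vector over `ℚ`. -/
def column {r n : ℕ} (M : Matrix (Fin r) (Fin n) ℤ) (j : Fin n) : Fin r → ℚ :=
  fun i => (M i j : ℚ)

/-- The vectorial matroid on the ground set of column indices of `M`: a set of columns is
independent iff the corresponding family of columns is linearly independent over `ℚ`. -/
def vectorialMatroid {r n : ℕ} (M : Matrix (Fin r) (Fin n) ℤ) : Matroid (Fin n) :=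
  (IndepMatroid.ofFinite (E := Set.univ) Set.finite_univ
    (fun I => LinearIndepOn ℚ (column M) I)
    (linearIndepOn_empty ℚ (column M))
    (fun _ _ hJ hIJ => hJ.mono hIJ)
    (by
      intro I J hI hJ hlt
      by_contra! hcon
      have hsub : column M '' J ⊆ Submodule.span ℚ (column M '' I) := by
        rintro _ ⟨e, he, rfl⟩
        by_contra hnot
        by_cases heI : e ∈ I
        · exact hnot (Submodule.subset_span ⟨e, heI, rfl⟩)
        · exact hcon e he heI (hI.insert hnot)
      have hle := Submodule.finrank_mono (Submodule.span_le.2 hsub)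
      have hc : ∀ K : Set (Fin n), LinearIndepOn ℚ (column M) K →
          Module.finrank ℚ (Submodule.span ℚ (column M '' K)) = K.ncard := by
        intro K hK
        classical
        have h := finrank_span_eq_card (R := ℚ) (b := fun x : K => column M x) hK
        rw [← Nat.card_coe_set_eq, Nat.card_eq_fintype_card, ← h, Set.image_eq_range]
      rw [hc I hI, hc J hJ] at hle
      omega)
    (fun I _ => Set.subset_univ I)).matroid

/-- The set of characteristic vectors of the common bases of the two vectorial matroids. -/
def commonBaseVectors {r n : ℕ} (M₁ M₂ : Matrix (Fin r) (Fin n) ℤ) : Set (Fin n → ℤ) :=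
  {x | ∃ B : Set (Fin n), (vectorialMatroid M₁).IsBase B ∧ (vectorialMatroid M₂).IsBase B ∧
    x = B.indicator 1}

/-- The point `W x`, as a point of `ℝ^d`. -/
def image {d n : ℕ} (W : Matrix (Fin d) (Fin n) ℤ) (x : Fin n → ℤ) : Fin d → ℝ :=
  fun i => ((W.mulVec x i : ℤ) : ℝ)

/-- The sense of the optimization. -/
inductive Sense
  | max
  | min

/-- `x` is the characteristic vector of a common base that is optimal for `f (W x)`. -/
def IsOptimal {d r n : ℕ} (opt : Sense) (M₁ M₂ : Matrix (Fin r) (Fin n) ℤ)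
    (W : Matrix (Fin d) (Fin n) ℤ) (f : (Fin d → ℝ) → ℝ) (x : Fin n → ℤ) : Prop :=
  x ∈ commonBaseVectors M₁ M₂ ∧
    match opt with
    | .max => ∀ y ∈ commonBaseVectors M₁ M₂, f (image W y) ≤ f (image W x)
    | .min => ∀ y ∈ commonBaseVectors M₁ M₂, f (image W x) ≤ f (image W y)

/-- `max |W i j|` (it is `0` if there are no entries). -/
def maxAbs {d n : ℕ} (W : Matrix (Fin d) (Fin n) ℤ) : ℕ :=
  Finset.univ.sup fun i => Finset.univ.sup fun j => (W i j).natAbs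

/-! ### The machine: a random access machine with integer cells, a random bit generator and a
comparison oracle -/

/-- The number of bits (with one sign bit) in the binary encoding of an integer. -/
def bitLength (z : ℤ) : ℕ := z.natAbs.size + 1

/-- The total binary encoding length of an integer matrix. -/
def encodingLength {r n : ℕ} (M : Matrix (Fin r) (Fin n) ℤ) : ℕ :=
  ∑ i, ∑ j, bitLength (M i j)

/-- The state of the machine: integer registers `reg 0, reg 1, …`, integer arrays
`mem 0, mem 1, …` (cell `k` of array `a` is `mem a k`), and the number of random bits consumed. -/
structure Store where
  reg : ℕ → ℤ
  mem : ℕ → ℤ → ℤ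
  coins : ℕ

/-- Elementary operations on integers. -/
inductive BinOp
  | add
  | sub
  | mul
  | div
  | mod
  | lt
  | eq

/-- `div` and `mod` are Euclidean division with remainder (with `x / 0 = 0` and `x % 0 = x`);
the tests `lt` and `eq` return `1` for true and `0` for false. -/
def BinOp.apply : BinOp → ℤ → ℤ → ℤ
  | .add, x, y => x + y
  | .sub, x, y => x - y
  | .mul, x, y => x * y
  | .div, x, y => x / y
  | .mod, x, y => x % y
  | .lt, x, y => if x < y then 1 else 0
  | .eq, x, y => if x = y then 1 else 0

/-- Expressions: literals, registers, array cells (with computed index), and operations. -/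
inductive Expr
  | lit (z : ℤ)
  | reg (x : ℕ)
  | load (a : ℕ) (k : Expr)
  | bin (op : BinOp) (e₁ e₂ : Expr)

/-- The value of an expression. -/
def Expr.eval (s : Store) : Expr → ℤ
  | .lit z => z
  | .reg x => s.reg x
  | .load a k => s.mem a (k.eval s)
  | .bin op e₁ e₂ => op.apply (e₁.eval s) (e₂.eval s)

/-- Costs are pairs: the number of elementary steps (uniform cost), and the time in the
logarithmic cost measure, where handling an integer costs its bit length. The cost of evaluating
an expression: every node costs one elementary step, and the bit length of its value. -/
def Expr.cost (s : Store) : Expr → ℕ × ℕ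
  | .lit z => (1, bitLength z)
  | .reg x => (1, bitLength (s.reg x))
  | .load a k => (1, bitLength (s.mem a (k.eval s))) + k.cost s
  | .bin op e₁ e₂ =>
      (1, bitLength (op.apply (e₁.eval s) (e₂.eval s))) + e₁.cost s + e₂.cost s

/-- Programs for the machine. -/
inductive Program (d : ℕ)
  | skip
  /-- assign the value of `e` to register `x` -/
  | set (x : ℕ) (e : Expr)
  /-- write the value of `e` to the cell of array `a` whose index is the value of `k` -/
  | store (a : ℕ) (k e : Expr)
  /-- put a fresh random bit into register `x` -/
  | flip (x : ℕ)
  /-- ask the oracle to compare two integer points of `ℝ^d`; the answer goes to register `x` -/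
  | query (x : ℕ) (u v : Fin d → Expr)
  | seq (p q : Program d)
  /-- run `p` if the value of `e` is nonzero, and `q` otherwise -/
  | ite (e : Expr) (p q : Program d)
  /-- repeat `p` while the value of `e` is nonzero -/
  | loop (e : Expr) (p : Program d)

/-- Assignment to a register. -/
def Store.setReg (s : Store) (x : ℕ) (z : ℤ) : Store :=
  { s with reg := Function.update s.reg x z }

/-- Assignment to an array cell. -/
def Store.setMem (s : Store) (a : ℕ) (k z : ℤ) : Store :=
  { s with mem := Function.update s.mem a (Function.update (s.mem a) k z) }

/-- The comparison oracle of `f : ℝ^d → ℝ`: it tells whether `f u ≤ f v`. -/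
noncomputable def comparisonOracle {d : ℕ} (f : (Fin d → ℝ) → ℝ) (u v : Fin d → ℤ) : Bool :=
  open Classical in decide (f (fun i => (u i : ℝ)) ≤ f (fun i => (v i : ℝ)))

/-- `Exec O ω p s s' c`: with oracle `O` and random bits `ω 0, ω 1, …`, the program `p` started
in the state `s` halts in the state `s'`, at cost `c`. Every command costs one unit in addition
to the expressions it evaluates; a test of a loop is paid for each time it is made. -/
inductive Exec {d : ℕ} (O : (Fin d → ℤ) → (Fin d → ℤ) → Bool) (ω : ℕ → Bool) :
    Program d → Store → Store → ℕ × ℕ → Prop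
  | skip (s : Store) : Exec O ω .skip s s (1, 1)
  | set (s : Store) (x : ℕ) (e : Expr) :
      Exec O ω (.set x e) s (s.setReg x (e.eval s)) ((1, 1) + e.cost s)
  | store (s : Store) (a : ℕ) (k e : Expr) :
      Exec O ω (.store a k e) s (s.setMem a (k.eval s) (e.eval s))
        ((1, 1) + k.cost s + e.cost s)
  | flip (s : Store) (x : ℕ) :
      Exec O ω (.flip x) s
        { s.setReg x (if ω s.coins then 1 else 0) with coins := s.coins + 1 } (1, 1)
  | query (s : Store) (x : ℕ) (u v : Fin d → Expr) :
      Exec O ω (.query x u v) s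
        (s.setReg x (if O (fun i => (u i).eval s) (fun i => (v i).eval s) then 1 else 0))
        ((1, 1) + ∑ i, ((u i).cost s + (v i).cost s))
  | seq {p q : Program d} {s s₁ s₂ : Store} {c₁ c₂ : ℕ × ℕ} :
      Exec O ω p s s₁ c₁ → Exec O ω q s₁ s₂ c₂ → Exec O ω (.seq p q) s s₂ (c₁ + c₂)
  | ite_true {e : Expr} {p q : Program d} {s s₁ : Store} {c : ℕ × ℕ} :
      e.eval s ≠ 0 → Exec O ω p s s₁ c → Exec O ω (.ite e p q) s s₁ ((1, 1) + e.cost s + c)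
  | ite_false {e : Expr} {p q : Program d} {s s₁ : Store} {c : ℕ × ℕ} :
      e.eval s = 0 → Exec O ω q s s₁ c → Exec O ω (.ite e p q) s s₁ ((1, 1) + e.cost s + c)
  | loop_done {e : Expr} {p : Program d} {s : Store} :
      e.eval s = 0 → Exec O ω (.loop e p) s s ((1, 1) + e.cost s)
  | loop_step {e : Expr} {p : Program d} {s s₁ s₂ : Store} {c₁ c₂ : ℕ × ℕ} :
      e.eval s ≠ 0 → Exec O ω p s s₁ c₁ → Exec O ω (.loop e p) s₁ s₂ c₂ →
        Exec O ω (.loop e p) s s₂ ((1, 1) + e.cost s + c₁ + c₂)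

/-! ### Input, output, and randomness -/

/-- A matrix with `n` columns stored row by row: cell `i * n + j` holds the entry `(i, j)`,
all other cells hold `0`. -/
def rowMajor {m n : ℕ} (A : Matrix (Fin m) (Fin n) ℤ) (k : ℤ) : ℤ :=
  ∑ i : Fin m, ∑ j : Fin n, if k = (i : ℤ) * (n : ℤ) + (j : ℤ) then A i j else 0

/-- The initial state on an instance: register `0` holds `n`, register `1` holds `r`, the arrays
`0`, `1`, `2` hold `M₁`, `M₂`, `W`, and everything else is zero. The function `f` is not part of
the state: it is accessible only through the oracle. -/
def initialStore {d r n : ℕ} (M₁ M₂ : Matrix (Fin r) (Fin n) ℤ)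
    (W : Matrix (Fin d) (Fin n) ℤ) : Store where
  reg := fun x => match x with
    | 0 => (n : ℤ)
    | 1 => (r : ℤ)
    | _ => 0
  mem := fun a => match a with
    | 0 => rowMajor M₁
    | 1 => rowMajor M₂
    | 2 => rowMajor W
    | _ => fun _ => 0
  coins := 0

/-- The output vector is read off the first `n` cells of array `3`. -/
def output (n : ℕ) (s : Store) : Fin n → ℤ := fun j => s.mem 3 (j : ℤ)

/-- The law of a sequence of independent fair random bits. -/
noncomputable def fairCoins : MeasureTheory.Measure (ℕ → Bool) :=
  MeasureTheory.Measure.infinitePi fun _ => (PMF.uniformOfFintype Bool).toMeasure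

end MatroidIntersection

/-! The proof turns optimization over common bases into testing coefficients of a determinant. By
Cauchy–Binet (`det_mul_diagonal_mul_transpose`), `det (M₁ diag(v) M₂ᵀ)` is the sum, over column sets
`B`, of the product of the two maximal minors on `B` and `∏ j ∈ B, v j`; exactly the common bases
have nonzero minor products. The columns of `W`, shifted to be nonnegative, are packed into single
numbers `z j` in a base `D` so large that sums over a base produce no carries. Thus `∑ j ∈ B, z j`
determines the image of `B` under `W` (`decode_sum_colWeight`), and for fixed `d` only polynomially
many values, fewer than `D ^ d`, can occur.

With `v j = x j * Y ^ z j` the determinant is a polynomial in `Y` whose `k`-th coefficient collects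
the common bases of number `k` (`det_eq_sum_gcoeff`). A single integer evaluation at `Y = 2H + 1`,
where `H` bounds all coefficients, reveals them as balanced digits (`shifts_emod_eq_iff`). Distinct
bases have distinct monomials in `x`, so no coefficient that has a contributing base vanishes
identically. By Schwartz–Zippel a random `x` avoids, with probability at least 1/2, all
cancellations over all column subsets at once (`half_le_fairCoins_revealing`).

At such a point the attained numbers are known exactly. A scan with the comparison oracle selects
the best one, and deletion of columns as long as the corresponding digit stays nonzero leaves a
common base with that number (`Revealing.greedy`).

For the resource bounds, the determinant is computed by the Faddeev–LeVerrier recursion, whose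
divisions are exact; its number of ring operations depends on `r` and not on the size of the
entries. All loop lengths are bounded in terms of `n` and `W` alone. The logarithmic cost follows
from the step count and a polynomial bound on the bit length of all cells. Program verification uses
the predicate `Runs`, which combines total correctness with these bounds. -/

namespace MatroidIntersection

section

/-! ### Arithmetic on expressions -/

namespace Expr

instance : Add Expr := ⟨.bin .add⟩
instance : Sub Expr := ⟨.bin .sub⟩
instance : Mul Expr := ⟨.bin .mul⟩
instance : Div Expr := ⟨.bin .div⟩
instance : Mod Expr := ⟨.bin .mod⟩

variable (s : Store) (e e' : Expr)

@[simp] theorem eval_lit (z : ℤ) : (lit z).eval s = z := rfl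
@[simp] theorem eval_reg (x : ℕ) : (reg x).eval s = s.reg x := rfl
@[simp] theorem eval_load (a : ℕ) : (load a e).eval s = s.mem a (e.eval s) := rfl
@[simp] theorem eval_add : (e + e').eval s = e.eval s + e'.eval s := rfl
@[simp] theorem eval_sub : (e - e').eval s = e.eval s - e'.eval s := rfl
@[simp] theorem eval_mul : (e * e').eval s = e.eval s * e'.eval s := rfl
@[simp] theorem eval_div : (e / e').eval s = e.eval s / e'.eval s := rfl
@[simp] theorem eval_mod : (e % e').eval s = e.eval s % e'.eval s := rfl
@[simp] theorem eval_lt : (bin .lt e e').eval s = if e.eval s < e'.eval s then 1 else 0 := rfl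
@[simp] theorem eval_eq : (bin .eq e e').eval s = if e.eval s = e'.eval s then 1 else 0 := rfl

/-- The number of nodes of an expression. -/
def size : Expr → ℕ
  | lit _ => 1
  | reg _ => 1
  | load _ k => 1 + k.size
  | bin _ e e' => 1 + e.size + e'.size

/-- The largest absolute value of a literal in an expression. -/
def maxLit : Expr → ℕ
  | lit z => z.natAbs
  | reg _ => 0
  | load _ k => k.maxLit
  | bin _ e e' => max e.maxLit e'.maxLit

theorem size_pos : 0 < e.size := by cases e <;> simp [size]

end Expr

/-! ### Bit lengths of values and logarithmic cost. -/

/-- All cells of the store hold integers of absolute value at most `2 ^ b`. -/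
structure Store.Small (b : ℕ) (s : Store) : Prop where
  reg : ∀ x, (s.reg x).natAbs ≤ 2 ^ b
  mem : ∀ a k, (s.mem a k).natAbs ≤ 2 ^ b

/-- The exponents `u` and `v` add up under multiplication, and the extra `b ≥ 1` supplies the factor
2 needed for sums. An operation node thus contributes `b` to the exponent, which makes the bound
compose along expressions. -/
theorem BinOp.natAbs_apply_le (op : BinOp) {x y : ℤ} {u v b : ℕ} (hb : 1 ≤ b)
    (hx : x.natAbs ≤ 2 ^ u) (hy : y.natAbs ≤ 2 ^ v) :
    (op.apply x y).natAbs ≤ 2 ^ (b + u + v) := by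
  have hu : 2 ^ u ≤ 2 ^ (u + v) := Nat.pow_le_pow_right (by norm_num) (by omega)
  have hv : 2 ^ v ≤ 2 ^ (u + v) := Nat.pow_le_pow_right (by norm_num) (by omega)
  have hp : 2 * 2 ^ (u + v) ≤ 2 ^ (b + u + v) := by
    rw [← pow_succ']
    exact Nat.pow_le_pow_right (by norm_num) (by omega)
  have h1 : 1 ≤ 2 ^ (b + u + v) := Nat.one_le_two_pow
  cases op with
  | add => exact (Int.natAbs_add_le x y).trans (by omega)
  | sub => exact (Int.natAbs_sub_le x y).trans (by omega)
  | mul =>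
    simp only [BinOp.apply, Int.natAbs_mul]
    refine (Nat.mul_le_mul hx hy).trans ?_
    rw [← pow_add]
    omega
  | div => exact (Int.natAbs_ediv_le_natAbs x y).trans (by omega)
  | mod =>
    simp only [BinOp.apply]
    by_cases h : y = 0
    · subst h
      rw [Int.emod_zero]
      omega
    · have := Int.emod_lt x h
      have := Int.emod_nonneg x h
      omega
  | lt => simp only [BinOp.apply]; split_ifs <;> simp [h1]
  | eq => simp only [BinOp.apply]; split_ifs <;> simp [h1]

theorem bitLength_le {z : ℤ} {u : ℕ} (h : z.natAbs ≤ 2 ^ u) : bitLength z ≤ u + 2 := by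
  have : z.natAbs.size ≤ u + 1 :=
    Nat.size_le.2 (h.trans_lt (Nat.pow_lt_pow_right (by norm_num) (Nat.lt_succ_self u)))
  unfold bitLength
  omega

theorem Expr.natAbs_eval_le {s : Store} {b : ℕ} (hb : 1 ≤ b) (hs : s.Small b) :
    ∀ e : Expr, e.maxLit ≤ 2 ^ b → (e.eval s).natAbs ≤ 2 ^ (b * e.size)
  | .lit z, h => by simpa [size, eval, maxLit] using h
  | .reg x, _ => by simpa [size, eval] using hs.reg x
  | .load a k, _ => (hs.mem a _).trans
      (Nat.pow_le_pow_right (by norm_num) (by simp only [size]; nlinarith))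
  | .bin op e e', h => by
    simp only [maxLit, max_le_iff] at h
    have := op.natAbs_apply_le hb (natAbs_eval_le hb hs e h.1) (natAbs_eval_le hb hs e' h.2)
    simpa only [size, eval, mul_add, mul_one] using this

@[simp] theorem Expr.cost_fst (s : Store) : ∀ e : Expr, (e.cost s).1 = e.size
  | .lit z => rfl
  | .reg x => rfl
  | .load a k => by simp [cost, size, cost_fst s k]
  | .bin op e e' => by simp [cost, size, cost_fst s e, cost_fst s e']

/-- The logarithmic cost is small compared to the uniform cost. -/
def LogBounded (b : ℕ) (c : ℕ × ℕ) : Prop := c.2 ≤ c.1 * c.1 * (b + 2)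

/-- This is why the relation is quadratic in the step count: `x² + y² ≤ (x + y)²`, so costs can be
added with no loss. -/
theorem LogBounded.add {b : ℕ} {c c' : ℕ × ℕ} (h : LogBounded b c) (h' : LogBounded b c') :
    LogBounded b (c + c') := by
  simp only [LogBounded, Prod.fst_add, Prod.snd_add] at *
  calc c.2 + c'.2 ≤ (c.1 * c.1 + c'.1 * c'.1) * (b + 2) := by linarith
    _ ≤ _ := Nat.mul_le_mul_right _ (by nlinarith [Nat.zero_le (c.1 * c'.1)])

theorem LogBounded.one {b : ℕ} : LogBounded b (1, 1) := by
  simp [LogBounded]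

theorem LogBounded.sum {b : ℕ} {ι : Type*} (t : Finset ι) (c : ι → ℕ × ℕ)
    (h : ∀ i ∈ t, LogBounded b (c i)) : LogBounded b (∑ i ∈ t, c i) :=
  Finset.sum_induction _ _ (fun _ _ => LogBounded.add) (by simp [LogBounded]) h

theorem Expr.logBounded_cost {s : Store} {b : ℕ} (hb : 1 ≤ b) (hs : s.Small b) :
    ∀ e : Expr, e.maxLit ≤ 2 ^ b → LogBounded b (e.cost s) := by
  -- A value has at most `b * size + 2` bits, and `size ≥ 1` absorbs the 2. Summed over the nodes of
  -- an expression this gives the quadratic bound.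
  have key : ∀ e : Expr, e.maxLit ≤ 2 ^ b →
      bitLength (e.eval s) ≤ e.size * (b + 2) := fun e he => by
    refine (bitLength_le (natAbs_eval_le hb hs e he)).trans ?_
    nlinarith [e.size_pos]
  intro e
  induction e with
  | lit z => intro h; simpa [LogBounded, cost, size] using key _ h
  | reg x => intro h; simpa [LogBounded, cost, size] using key (.reg x) h
  | load a k ih =>
    intro h
    have h1 := key _ h
    have h2 := ih h
    simp only [LogBounded, cost, Prod.fst_add, Prod.snd_add, cost_fst, size, eval] at *
    calc _ ≤ ((1 + k.size) + k.size * k.size) * (b + 2) := by linarith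
      _ ≤ _ := Nat.mul_le_mul_right _ (by nlinarith)
  | bin op e e' ih ih' =>
    intro h
    have h1 := key _ h
    simp only [maxLit, max_le_iff] at h
    have h2 := ih h.1
    have h3 := ih' h.2
    simp only [LogBounded, cost, Prod.fst_add, Prod.snd_add, cost_fst, size, eval] at *
    calc _ ≤ ((1 + e.size + e'.size) + e.size * e.size + e'.size * e'.size) * (b + 2) := by linarith
      _ ≤ _ := Nat.mul_le_mul_right _ (by nlinarith [Nat.zero_le (e.size * e'.size)])

/-! ### Static information on programs -/

namespace Program

variable {d : ℕ}

/-- The largest absolute value of a literal in a program. -/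
def maxLit : Program d → ℕ
  | skip => 0
  | set _ e => e.maxLit
  | store _ k e => max k.maxLit e.maxLit
  | flip _ => 0
  | query _ u v => Finset.univ.sup fun i => max (u i).maxLit (v i).maxLit
  | seq p q => max p.maxLit q.maxLit
  | ite e p q => max e.maxLit (max p.maxLit q.maxLit)
  | loop e p => max e.maxLit p.maxLit

/-- An upper bound on the number of steps of a program, as a polynomial in an upper bound on the
number of rounds of each loop. -/
noncomputable def time : Program d → Polynomial ℕ
  | skip => 1
  | set _ e => .C (1 + e.size)
  | store _ k e => .C (1 + k.size + e.size)
  | flip _ => 1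
  | query _ u v => .C (1 + ∑ i, ((u i).size + (v i).size))
  | seq p q => p.time + q.time
  | ite e p q => .C (1 + e.size) + p.time + q.time
  | loop e p => (.X + 1) * .C (1 + e.size) + .X * p.time

/-- Whether a program assigns to register `x`. -/
def writesReg (x : ℕ) : Program d → Bool
  | set y _ => x == y
  | flip y => x == y
  | query y _ _ => x == y
  | seq p q => p.writesReg x || q.writesReg x
  | ite _ p q => p.writesReg x || q.writesReg x
  | loop _ p => p.writesReg x
  | _ => false

/-- Whether a program writes to array `a`. -/
def writesMem (a : ℕ) : Program d → Bool
  | store a' _ _ => a == a'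
  | seq p q => p.writesMem a || q.writesMem a
  | ite _ p q => p.writesMem a || q.writesMem a
  | loop _ p => p.writesMem a
  | _ => false

/-- Whether a program uses random bits. -/
def flips : Program d → Bool
  | flip _ => true
  | seq p q => p.flips || q.flips
  | ite _ p q => p.flips || q.flips
  | loop _ p => p.flips
  | _ => false

end Program

/-- The stores `s` and `s'` agree except on what the program `p` writes. -/
structure Frame {d : ℕ} (p : Program d) (s s' : Store) : Prop where
  reg : ∀ x, p.writesReg x = false → s'.reg x = s.reg x
  mem : ∀ a, p.writesMem a = false → s'.mem a = s.mem a
  coins : p.flips = false → s'.coins = s.coins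

@[simp] theorem Store.setReg_reg (s : Store) (x y : ℕ) (z : ℤ) :
    (s.setReg x z).reg y = if y = x then z else s.reg y := by
  simp [setReg, Function.update_apply]

@[simp] theorem Store.setReg_mem (s : Store) (x : ℕ) (z : ℤ) : (s.setReg x z).mem = s.mem := rfl

@[simp] theorem Store.setReg_coins (s : Store) (x : ℕ) (z : ℤ) :
    (s.setReg x z).coins = s.coins := rfl

@[simp] theorem Store.setMem_reg (s : Store) (a : ℕ) (k z : ℤ) : (s.setMem a k z).reg = s.reg := rfl

@[simp] theorem Store.setMem_coins (s : Store) (a : ℕ) (k z : ℤ) :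
    (s.setMem a k z).coins = s.coins := rfl

@[simp] theorem Store.setMem_mem (s : Store) (a a' : ℕ) (k z : ℤ) :
    (s.setMem a k z).mem a' = if a' = a then Function.update (s.mem a) k z else s.mem a' := by
  by_cases h : a' = a
  · subst h; simp [setMem]
  · simp [setMem, h]

variable {d : ℕ}

theorem Frame.refl (p : Program d) (s : Store) : Frame p s s := ⟨fun _ _ => rfl, fun _ _ => rfl, fun _ => rfl⟩

theorem Frame.trans {p : Program d} {s s' s'' : Store} (h : Frame p s s') (h' : Frame p s' s'') :
    Frame p s s'' :=
  ⟨fun x hx => (h'.reg x hx).trans (h.reg x hx), fun x hx => (h'.mem x hx).trans (h.mem x hx),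
    fun hx => (h'.coins hx).trans (h.coins hx)⟩

theorem Frame.mono {p q : Program d} {s s' : Store} (h : Frame p s s')
    (hr : ∀ x, q.writesReg x = false → p.writesReg x = false)
    (hm : ∀ x, q.writesMem x = false → p.writesMem x = false)
    (hc : q.flips = false → p.flips = false) : Frame q s s' :=
  ⟨fun x hx => h.reg x (hr x hx), fun x hx => h.mem x (hm x hx), fun hx => h.coins (hc hx)⟩

/-- What a program writes is a Boolean computed from its syntax. Preservation of a register or array
through a long subprogram can therefore be obtained by `rfl`, and invariants need to mention only
what changes. -/
theorem Exec.frame {O : (Fin d → ℤ) → (Fin d → ℤ) → Bool} {ω : ℕ → Bool} {p : Program d}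
    {s s' : Store} {c : ℕ × ℕ} (h : Exec O ω p s s' c) : Frame p s s' := by
  induction h with
  | skip s => exact .refl _ _
  | set s x e => exact ⟨fun y hy => by simp_all [Program.writesReg], fun _ _ => rfl, fun _ => rfl⟩
  | store s a k e => exact ⟨fun _ _ => rfl, fun y hy => by simp_all [Program.writesMem], fun _ => rfl⟩
  | flip s x =>
    exact ⟨fun y hy => by
      simp only [Program.writesReg, beq_eq_false_iff_ne] at hy
      simp [hy], fun _ _ => rfl, fun h => by simp [Program.flips] at h⟩
  | query s x u v => exact ⟨fun y hy => by simp_all [Program.writesReg], fun _ _ => rfl, fun _ => rfl⟩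
  | seq _ _ ih ih' =>
    refine (ih.mono ?_ ?_ ?_).trans (ih'.mono ?_ ?_ ?_) <;>
      simp +contextual [Program.writesReg, Program.writesMem, Program.flips]
  | ite_true _ _ ih =>
    refine ih.mono ?_ ?_ ?_ <;>
      simp +contextual [Program.writesReg, Program.writesMem, Program.flips]
  | ite_false _ _ ih =>
    refine ih.mono ?_ ?_ ?_ <;>
      simp +contextual [Program.writesReg, Program.writesMem, Program.flips]
  | loop_done _ => exact .refl _ _
  | loop_step _ _ _ ih ih' =>
    exact Frame.trans (p := .loop _ _) (ih.mono (fun _ h => h) (fun _ h => h) (fun h => h)) ih'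

/-! ### Total correctness with resource bounds -/

/-- The program `p` started in `s` halts in a state that satisfies `Q`, within the step bound
`p.time` if loops have at most `X` rounds, with all cells bounded by `2 ^ b` throughout. -/
def Runs (O : (Fin d → ℤ) → (Fin d → ℤ) → Bool) (ω : ℕ → Bool) (b X : ℕ) (p : Program d)
    (s : Store) (Q : Store → Prop) : Prop :=
  s.Small b → p.maxLit ≤ 2 ^ b → ∃ s' c, Exec O ω p s s' c ∧ c.1 ≤ p.time.eval X ∧
    LogBounded b c ∧ s'.Small b ∧ Q s'

namespace Runs

variable {O : (Fin d → ℤ) → (Fin d → ℤ) → Bool} {ω : ℕ → Bool} {b X : ℕ} {p q : Program d}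
  {s : Store} {Q Q' : Store → Prop}

theorem conseq (h : Runs O ω b X p s Q) (hQ : ∀ s', s'.Small b → Frame p s s' → Q s' → Q' s') :
    Runs O ω b X p s Q' := fun hs hl =>
  let ⟨s', c, h1, h2, h3, h4, h5⟩ := h hs hl
  ⟨s', c, h1, h2, h3, h4, hQ s' h4 h1.frame h5⟩

theorem skip (h : Q s) : Runs O ω b X .skip s Q := fun hs _ =>
  ⟨s, _, .skip s, by simp [Program.time], .one, hs, h⟩

theorem _root_.MatroidIntersection.Store.Small.setReg (hs : s.Small b) {x : ℕ} {z : ℤ}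
    (hz : z.natAbs ≤ 2 ^ b) : (s.setReg x z).Small b :=
  ⟨fun y => by rw [Store.setReg_reg]; split_ifs; exacts [hz, hs.reg y], hs.mem⟩

theorem _root_.MatroidIntersection.Store.Small.setMem (hs : s.Small b) {a : ℕ} {k z : ℤ}
    (hz : z.natAbs ≤ 2 ^ b) : (s.setMem a k z).Small b :=
  ⟨hs.reg, fun a' k' => by
    rw [Store.setMem_mem]
    split_ifs
    · rw [Function.update_apply]
      split_ifs
      exacts [hz, hs.mem a k']
    · exact hs.mem a' k'⟩

theorem set (hb : 1 ≤ b) {x : ℕ} {e : Expr} (he : (e.eval s).natAbs ≤ 2 ^ b)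
    (h : Q (s.setReg x (e.eval s))) : Runs O ω b X (.set x e) s Q := fun hs hl =>
  ⟨_, _, .set s x e, by simp [Program.time], .add .one (e.logBounded_cost hb hs hl),
    hs.setReg he, h⟩

theorem store (hb : 1 ≤ b) {a : ℕ} {k e : Expr} (he : (e.eval s).natAbs ≤ 2 ^ b)
    (h : Q (s.setMem a (k.eval s) (e.eval s))) : Runs O ω b X (.store a k e) s Q := fun hs hl =>
  ⟨_, _, .store s a k e, by simp [Program.time],
    .add (.add .one (k.logBounded_cost hb hs (le_of_max_le_left hl)))
      (e.logBounded_cost hb hs (le_of_max_le_right hl)),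
    hs.setMem he, h⟩

theorem flip {x : ℕ}
    (h : Q { s.setReg x (if ω s.coins then 1 else 0) with coins := s.coins + 1 }) :
    Runs O ω b X (.flip x) s Q := fun hs _ =>
  have h' : (s.setReg x (if ω s.coins then 1 else 0)).Small b :=
    hs.setReg (by split_ifs <;> simp [Nat.one_le_two_pow])
  ⟨_, _, .flip s x, by simp [Program.time], .one, ⟨h'.reg, h'.mem⟩, h⟩

theorem query (hb : 1 ≤ b) {x : ℕ} {u v : Fin d → Expr}
    (h : Q (s.setReg x (if O (fun i => (u i).eval s) (fun i => (v i).eval s) then 1 else 0))) :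
    Runs O ω b X (.query x u v) s Q := fun hs hl => by
  refine ⟨_, _, .query s x u v, by simp [Program.time, Prod.fst_sum, Polynomial.eval_finsetSum], .add .one (.sum _ _ ?_),
    hs.setReg (by split_ifs <;> simp [Nat.one_le_two_pow]), h⟩
  intro i _
  have hi : max (u i).maxLit (v i).maxLit ≤ 2 ^ b :=
    (Finset.le_sup (f := fun i => max (u i).maxLit (v i).maxLit) (Finset.mem_univ i)).trans hl
  exact .add ((u i).logBounded_cost hb hs (le_of_max_le_left hi))
    ((v i).logBounded_cost hb hs (le_of_max_le_right hi))

theorem seq (h : Runs O ω b X p s fun s' => Runs O ω b X q s' Q) :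
    Runs O ω b X (.seq p q) s Q := fun hs hl => by
  obtain ⟨s₁, c₁, e₁, t₁, l₁, m₁, h₁⟩ := h hs (le_of_max_le_left hl)
  obtain ⟨s₂, c₂, e₂, t₂, l₂, m₂, h₂⟩ := h₁ m₁ (le_of_max_le_right hl)
  exact ⟨s₂, _, e₁.seq e₂, by simpa [Program.time] using Nat.add_le_add t₁ t₂, l₁.add l₂, m₂, h₂⟩

theorem ite (hb : 1 ≤ b) {e : Expr} (h₁ : e.eval s ≠ 0 → Runs O ω b X p s Q)
    (h₂ : e.eval s = 0 → Runs O ω b X q s Q) : Runs O ω b X (.ite e p q) s Q := fun hs hl => by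
  simp only [Program.maxLit, max_le_iff] at hl
  have he := e.logBounded_cost hb hs hl.1
  by_cases h : e.eval s = 0
  · obtain ⟨s₁, c₁, e₁, t₁, l₁, m₁, h₁⟩ := h₂ h hs hl.2.2
    refine ⟨s₁, _, .ite_false h e₁, ?_, .add (.add .one he) l₁, m₁, h₁⟩
    simp [Program.time]
    omega
  · obtain ⟨s₁, c₁, e₁, t₁, l₁, m₁, h₁⟩ := h₁ h hs hl.2.1
    refine ⟨s₁, _, .ite_true h e₁, ?_, .add (.add .one he) l₁, m₁, h₁⟩
    simp [Program.time]
    omega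

/-- The number of rounds `N` is given in advance and the invariant is indexed by the round, so
termination and the step count come from the same induction. -/
theorem loop (hb : 1 ≤ b) {e : Expr} {N : ℕ} (hN : N ≤ X) (Inv : ℕ → Store → Prop)
    (h₀ : Inv 0 s)
    (hstep : ∀ k < N, ∀ s', s'.Small b → Frame p s s' → Inv k s' →
      e.eval s' ≠ 0 ∧ Runs O ω b X p s' (Inv (k + 1)))
    (hdone : ∀ s', s'.Small b → Frame p s s' → Inv N s' → e.eval s' = 0 ∧ Q s') :
    Runs O ω b X (.loop e p) s Q := fun hs hl => by
  have hl' := max_le_iff.1 hl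
  -- Induction on the number `m` of remaining rounds; the guard is paid for `m + 1` times.
  have key : ∀ m k s', m + k = N → s'.Small b → Frame p s s' → Inv k s' →
      ∃ s'' c, Exec O ω (.loop e p) s' s'' c ∧
        c.1 ≤ (m + 1) * (1 + e.size) + m * p.time.eval X ∧
        LogBounded b c ∧ s''.Small b ∧ Q s'' := by
    intro m
    induction m with
    | zero =>
      intro k s' hk hs' hf hI
      obtain rfl : k = N := by omega
      obtain ⟨h0, hq⟩ := hdone s' hs' hf hI
      exact ⟨s', _, .loop_done h0, by simp, .add .one (e.logBounded_cost hb hs' hl'.1), hs', hq⟩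
    | succ m ih =>
      intro k s' hk hs' hf hI
      obtain ⟨h0, hr⟩ := hstep k (by omega) s' hs' hf hI
      obtain ⟨s₁, c₁, e₁, t₁, l₁, m₁, h₁⟩ := hr hs' hl'.2
      obtain ⟨s₂, c₂, e₂, t₂, l₂, m₂, h₂⟩ := ih (k + 1) s₁ (by omega) m₁ (hf.trans e₁.frame) h₁
      refine ⟨s₂, _, .loop_step h0 e₁ e₂, ?_,
        .add (.add (.add .one (e.logBounded_cost hb hs' hl'.1)) l₁) l₂, m₂, h₂⟩
      simp only [Prod.fst_add, Expr.cost_fst]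
      linarith
  obtain ⟨s', c, h1, h2, h3⟩ := key N 0 s rfl hs (.refl _ _) h₀
  refine ⟨s', c, h1, h2.trans ?_, h3⟩
  simp only [Program.time, Polynomial.eval_add, Polynomial.eval_mul, Polynomial.eval_X,
    Polynomial.eval_one, Polynomial.eval_C]
  gcongr

end Runs

/-! ### Counting loops and accumulators. -/

/-- `for i = 0, …, e - 1 do p`. -/
def Program.forLoop (i : ℕ) (e : Expr) (p : Program d) : Program d :=
  .seq (.set i (.lit 0))
    (.loop (.bin .lt (.reg i) e) (.seq p (.set i (.reg i + .lit 1))))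

/-- `acc := e₀; for i = 0, …, e - 1 do acc := e₁`. -/
def Program.fold (acc i : ℕ) (e₀ e e₁ : Expr) : Program d :=
  .seq (.set acc e₀) (.forLoop i e (.set acc e₁))

namespace Runs

variable {O : (Fin d → ℤ) → (Fin d → ℤ) → Bool} {ω : ℕ → Bool} {b X : ℕ} {p q : Program d}
  {s : Store} {Q Q' : Store → Prop}

/-- The bound `e` is evaluated anew before each round, so it must keep the value `N` along the
invariant; `toNat` covers a negative bound, which gives no rounds. The body has to establish the
invariant for the store in which the counter is already incremented. -/
theorem forLoop (hb : 1 ≤ b) {i N : ℕ} {e : Expr} (hX : N ≤ X) (hXb : X ≤ 2 ^ b)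
    (hi : p.writesReg i = false) (Inv : ℕ → Store → Prop)
    (h₀ : Inv 0 (s.setReg i 0))
    (hN : ∀ k ≤ N, ∀ s', Frame (Program.forLoop i e p) s s' → s'.reg i = k → Inv k s' →
      (e.eval s').toNat = N)
    (hstep : ∀ k < N, ∀ s', s'.Small b → Frame (Program.forLoop i e p) s s' → s'.reg i = k →
      Inv k s' → Runs O ω b X p s' fun s'' => Inv (k + 1) (s''.setReg i ((k + 1 : ℕ) : ℤ)))
    (hQ : ∀ s', s'.Small b → Frame (Program.forLoop i e p) s s' → s'.reg i = N → Inv N s' → Q s') :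
    Runs O ω b X (.forLoop i e p) s Q := by
  have hf0 : Frame (Program.forLoop i e p) s (s.setReg i 0) := by
    refine ⟨fun x hx => ?_, fun _ _ => rfl, fun _ => rfl⟩
    simp only [Program.forLoop, Program.writesReg, Bool.or_eq_false_iff, beq_eq_false_iff_ne] at hx
    simp [hx.1]
  have hf : ∀ s', Frame (.seq p (.set i (.reg i + .lit 1))) (s.setReg i 0) s' →
      Frame (Program.forLoop i e p) s s' := fun s' h =>
    hf0.trans (h.mono (by simp [Program.forLoop, Program.writesReg])
      (by simp [Program.forLoop, Program.writesMem]) (by simp [Program.forLoop, Program.flips]))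
  refine .seq (.set hb (by simp) ?_)
  refine .loop hb hX (fun k s' => s'.reg i = k ∧ Inv k s') ⟨by simp, h₀⟩ ?_ ?_
  · rintro k hk s' hs' hF ⟨hik, hI⟩
    have hev := hN k hk.le s' (hf s' hF) hik hI
    refine ⟨?_, .seq ((hstep k hk s' hs' (hf s' hF) hik hI).conseq fun s'' hs'' hF' hI' => ?_)⟩
    · have : (k : ℤ) < e.eval s' := by omega
      simp [hik, this]
    · have hk' : s''.reg i = k := (hF'.reg i hi).trans hik
      have hk1 : (Expr.reg i + Expr.lit 1).eval s'' = ((k + 1 : ℕ) : ℤ) := by simp [hk']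
      refine .set hb ?_ ?_
      · rw [hk1, Int.natAbs_natCast]
        omega
      · rw [hk1]
        exact ⟨by simp, hI'⟩
  · rintro s' hs' hF ⟨hik, hI⟩
    have hev := hN N le_rfl s' (hf s' hF) hik hI
    refine ⟨?_, hQ s' hs' (hf s' hF) hik hI⟩
    have : ¬ (N : ℤ) < e.eval s' := by omega
    simp [hik, this]

/-- The invariant is an equation for the whole store, since only `acc` and `i` change. All side
conditions thereby become evaluations of expressions in an explicit store. -/
theorem fold (hb : 1 ≤ b) {acc i : ℕ} {e₀ e e₁ : Expr} (N : ℕ) (g : ℕ → ℤ) (hai : i ≠ acc)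
    (hX : N ≤ X) (hXb : X ≤ 2 ^ b) (hg : ∀ k ≤ N, (g k).natAbs ≤ 2 ^ b)
    (h₀ : e₀.eval s = g 0)
    (hN : ∀ k ≤ N, (e.eval ((s.setReg acc (g k)).setReg i k)).toNat = N)
    (hstep : ∀ k < N, e₁.eval ((s.setReg acc (g k)).setReg i k) = g (k + 1))
    (hQ : Q ((s.setReg acc (g N)).setReg i N)) :
    Runs O ω b X (.fold acc i e₀ e e₁) s Q := by
  refine .seq (.set hb (by rw [h₀]; exact hg 0 (Nat.zero_le _)) ?_)
  refine .forLoop hb hX hXb (by simpa [Program.writesReg] using hai)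
    (fun k s' => s' = (s.setReg acc (g k)).setReg i k) (by rw [h₀]; rfl) ?_ ?_ ?_
  · rintro k hk s' - - rfl
    exact hN k hk
  · rintro k hk s' - - - rfl
    refine .set hb ?_ ?_
    · rw [hstep k hk]
      exact hg _ hk
    · rw [hstep k hk]
      simp only [Store.setReg]
      congr 1
      funext x
      simp only [Function.update_apply]
      split_ifs <;> rfl
  · rintro s' - - - rfl
    exact hQ

end Runs

end

section

/-! ### The Faddeev–LeVerrier algorithm -/

section FaddeevLeVerrier

open Polynomial Matrix

variable {r : ℕ}

/-- In the Leibniz expansion only diagonal entries have a nonzero derivative. Differentiating the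
factor of column `i` keeps the permutations fixing `i`, and these make up the `i`-th diagonal
cofactor. -/
theorem derivative_charpoly_eq_trace_adjugate {R : Type*} [CommRing R]
    (A : Matrix (Fin r) (Fin r) R) :
    derivative A.charpoly = (adjugate (charmatrix A)).trace := by
  have hd : ∀ i j, derivative (charmatrix A i j) = if i = j then 1 else 0 := by
    intro i j
    by_cases h : i = j
    · subst h; simp
    · simp [h]
  simp only [Matrix.charpoly, det_apply, derivative_sum, derivative_smul, derivative_prod_finset, hd,
    trace, diag_apply, adjugate_apply, Finset.smul_sum]
  rw [Finset.sum_comm]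
  refine Finset.sum_congr rfl fun i _ => Finset.sum_congr rfl fun σ _ => ?_
  congr 1
  by_cases h : σ i = i
  · rw [← Finset.prod_erase_mul _ _ (Finset.mem_univ i)]
    simp only [h, if_true, updateRow_self, Pi.single_eq_same]
    congr 1
    refine Finset.prod_congr rfl fun k hk => ?_
    have : σ k ≠ i := fun hki => (Finset.mem_erase.1 hk).1 (σ.injective (hki.trans h.symm))
    rw [updateRow_ne this]
  · simp only [h, if_false, mul_zero]
    symm
    refine Finset.prod_eq_zero (Finset.mem_univ (σ.symm i)) ?_
    have : σ.symm i ≠ i := fun hk => h ((Equiv.symm_apply_eq σ).1 hk).symm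
    simp [this]

/-- The coefficient matrices of the adjugate of the characteristic matrix. -/
noncomputable def adjCoeff (A : Matrix (Fin r) (Fin r) ℤ) (k : ℕ) : Matrix (Fin r) (Fin r) ℤ :=
  (adjugate (charmatrix A)).map fun p => p.coeff k

variable (A : Matrix (Fin r) (Fin r) ℤ)

theorem charmatrix_mul_adj_entry (i j : Fin r) :
    X * adjugate (charmatrix A) i j - ∑ l, C (A i l) * adjugate (charmatrix A) l j =
      A.charpoly * (1 : Matrix (Fin r) (Fin r) ℤ[X]) i j := by
  have h := congrFun (congrFun (mul_adjugate (charmatrix A)) i) j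
  rw [mul_apply] at h
  simp only [charmatrix_apply, sub_mul, Finset.sum_sub_distrib, diagonal_apply, ite_mul, zero_mul,
    Finset.sum_ite_eq, Finset.mem_univ, if_true] at h
  rw [h, Matrix.smul_apply, smul_eq_mul, Matrix.charpoly]

/-- Comparison of the coefficients of `X ^ (k + 1)` in `(X - A) * adj (X - A) = χ * 1`. -/
theorem adjCoeff_succ (k : ℕ) :
    adjCoeff A k = A * adjCoeff A (k + 1) + A.charpoly.coeff (k + 1) • 1 := by
  ext i j
  have h := congrArg (fun p => p.coeff (k + 1)) (charmatrix_mul_adj_entry A i j)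
  simp only [coeff_sub, coeff_X_mul, finsetSum_coeff, coeff_C_mul, one_apply, mul_ite, mul_one,
    mul_zero] at h
  simp only [adjCoeff, map_apply, Matrix.add_apply, mul_apply, Matrix.smul_apply, one_apply, smul_eq_mul,
    mul_ite, mul_one, mul_zero]
  rw [sub_eq_iff_eq_add] at h
  rw [h]
  split_ifs <;> simp [add_comm]

theorem mul_adjCoeff_zero : A * adjCoeff A 0 + A.charpoly.coeff 0 • 1 = 0 := by
  ext i j
  have h := congrArg (fun p => p.coeff 0) (charmatrix_mul_adj_entry A i j)
  simp only [coeff_sub, coeff_X_mul_zero, finsetSum_coeff, coeff_C_mul, one_apply, mul_ite,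
    mul_one, mul_zero] at h
  simp only [adjCoeff, map_apply, Matrix.add_apply, mul_apply, Matrix.smul_apply, one_apply, smul_eq_mul,
    mul_ite, mul_one, mul_zero, Matrix.zero_apply]
  rw [zero_sub] at h
  rw [← neg_eq_zero, neg_add, h]
  split_ifs <;> simp

/-- The coefficients vanish for large `k`, since there are finitely many polynomial entries. The
recursion `adjCoeff_succ` carries this down to `r`, because `χ` has no coefficient above degree `r`.
-/
theorem adjCoeff_eq_zero {k : ℕ} (hk : r ≤ k) : adjCoeff A k = 0 := by
  obtain ⟨N, hN⟩ : ∃ N, ∀ k, N ≤ k → adjCoeff A k = 0 := by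
    refine ⟨Finset.univ.sup fun i => Finset.univ.sup fun j =>
      (adjugate (charmatrix A) i j).natDegree + 1, fun k hk => ?_⟩
    ext i j
    refine coeff_eq_zero_of_natDegree_lt (Nat.lt_of_succ_le (le_trans ?_ hk))
    exact le_trans (Finset.le_sup (f := fun j => (adjugate (charmatrix A) i j).natDegree + 1)
      (Finset.mem_univ j)) (Finset.le_sup (f := fun i => Finset.univ.sup fun j =>
      (adjugate (charmatrix A) i j).natDegree + 1) (Finset.mem_univ i))
  have key : ∀ m k, r ≤ k → N ≤ k + m → adjCoeff A k = 0 := by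
    intro m
    induction m with
    | zero => exact fun k _ h => hN k h
    | succ m ih =>
      intro k hk hm
      have hdeg : A.charpoly.coeff (k + 1) = 0 := by
        refine coeff_eq_zero_of_natDegree_lt ?_
        rw [charpoly_natDegree_eq_dim, Fintype.card_fin]
        omega
      rw [adjCoeff_succ, ih (k + 1) (by omega) (by omega), hdeg]
      simp
  exact key N k hk (by omega)

theorem trace_adjCoeff (k : ℕ) :
    (adjCoeff A k).trace = (k + 1 : ℕ) * A.charpoly.coeff (k + 1) := by
  have h := congrArg (fun p => p.coeff k) (derivative_charpoly_eq_trace_adjugate A)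
  simp only [coeff_derivative, trace, diag_apply, finsetSum_coeff] at h
  simp only [adjCoeff, trace, diag_apply, map_apply]
  rw [← h]
  push_cast
  ring

/-- Newton's identities: take traces in the coefficient recursion and replace the trace of the
adjugate coefficient by that of `χ'`. The factor `k` on the right is what makes the division in the
algorithm exact. -/
theorem trace_mul_adjCoeff {j k : ℕ} (hjk : j + k = r) :
    -(A * adjCoeff A j).trace = k * A.charpoly.coeff j := by
  have hr : (r : ℤ) = j + k := by exact_mod_cast hjk.symm
  cases j with
  | zero =>
    have h := congrArg trace (mul_adjCoeff_zero A)
    simp only [trace_add, trace_smul, trace_one, Fintype.card_fin, smul_eq_mul, trace_zero] at h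
    rw [hr] at h
    push_cast at h
    linarith
  | succ j =>
    have h := congrArg trace (adjCoeff_succ A j)
    rw [trace_adjCoeff] at h
    simp only [trace_add, trace_smul, trace_one, Fintype.card_fin, smul_eq_mul] at h
    rw [hr] at h
    push_cast at h ⊢
    linarith

/-- The iterates `(T, c)` of the Faddeev–LeVerrier algorithm for the `r × r` matrix that is stored
row by row in `A`. -/
def faddeev (r : ℕ) (A : ℕ → ℤ) : ℕ → (ℕ → ℤ) × ℤ
  | 0 => (fun _ => 0, 1)
  | k + 1 =>
    let T := fun q => (faddeev r A k).2 * A q +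
      ∑ l ∈ Finset.range r, A (q / r * r + l) * (faddeev r A k).1 (l * r + q % r)
    (T, (0 - ∑ l ∈ Finset.range r, T (l * r + l)) / (k + 1))

theorem flat_div {m r : ℕ} (i : Fin m) (j : Fin r) : ((i : ℕ) * r + j) / r = i := by
  rw [mul_comm, Nat.mul_add_div (by have := j.2; omega), Nat.div_eq_of_lt j.2, add_zero]

theorem flat_mod {m r : ℕ} (i : Fin m) (j : Fin r) : ((i : ℕ) * r + j) % r = j := by
  rw [mul_comm, Nat.mul_add_mod, Nat.mod_eq_of_lt j.2]

/-- The iteration runs through the coefficients of `χ` from the top: after `k` rounds it has reached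
degree `j = r - k`, hence the constant coefficient after `r` rounds. -/
theorem faddeev_eq {F : ℕ → ℤ} (hF : ∀ i j : Fin r, F (i * r + j) = A i j) :
    ∀ k j : ℕ, j + k = r → (∀ i l : Fin r, (faddeev r F k).1 (i * r + l) = (A * adjCoeff A j) i l) ∧
      (faddeev r F k).2 = A.charpoly.coeff j := by
  intro k
  induction k with
  | zero =>
    intro j hj
    obtain rfl : j = r := by omega
    refine ⟨fun i l => by simp [faddeev, adjCoeff_eq_zero A le_rfl], ?_⟩
    have h := A.charpoly_monic
    rw [Monic, leadingCoeff, charpoly_natDegree_eq_dim, Fintype.card_fin] at h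
    exact h.symm
  | succ k ih =>
    intro j hj
    obtain ⟨h1, h2⟩ := ih (j + 1) (by omega)
    have hT : ∀ i l : Fin r, (faddeev r F (k + 1)).1 (i * r + l) = (A * adjCoeff A j) i l := by
      intro i l
      rw [adjCoeff_succ]
      simp only [faddeev, flat_div, flat_mod, h2, hF]
      rw [Finset.sum_range (fun m => F (i * r + m) * (faddeev r F k).1 (m * r + l))]
      simp only [hF, h1, mul_add, Matrix.add_apply, Matrix.mul_smul, Matrix.mul_one,
        Matrix.smul_apply, smul_eq_mul]
      rw [add_comm, ← mul_apply]
    refine ⟨hT, ?_⟩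
    have htr : ∑ l ∈ Finset.range r, (faddeev r F (k + 1)).1 (l * r + l) =
        (A * adjCoeff A j).trace := by
      rw [Finset.sum_range (fun l => (faddeev r F (k + 1)).1 (l * r + l))]
      simp [hT, trace]
    have h : (faddeev r F (k + 1)).2 =
      (0 - ∑ l ∈ Finset.range r, (faddeev r F (k + 1)).1 (l * r + l)) / (k + 1) := rfl
    rw [h, htr, zero_sub, trace_mul_adjCoeff A hj]
    push_cast
    exact Int.mul_ediv_cancel_left _ (by positivity)

theorem faddeev_eq_det {F : ℕ → ℤ} (hF : ∀ i j : Fin r, F (i * r + j) = A i j) :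
    (faddeev r F r).2 = (-1) ^ r * A.det := by
  rw [(faddeev_eq A hF r 0 (zero_add r)).2, det_eq_sign_charpoly_coeff, Fintype.card_fin,
    ← mul_assoc, ← mul_pow]
  simp

end FaddeevLeVerrier

end

section

open Matrix

variable {r n : ℕ}

/-! ### The Cauchy–Binet formula and common bases -/

/-- The maximal minor of a matrix on a set of `r` columns; `0` for sets of other sizes. -/
def colMinor (P : Matrix (Fin r) (Fin n) ℤ) (B : Finset (Fin n)) : ℤ :=
  if h : B.card = r then (P.submatrix id (B.orderEmbOfFin h)).det else 0

/-- Row `i` of the product is a combination of the rows of `Q` with coefficients `P i j`; the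
determinant is expanded by multilinearity in the rows. -/
theorem det_mul_eq_sum_functions (P : Matrix (Fin r) (Fin n) ℤ) (Q : Matrix (Fin n) (Fin r) ℤ) :
    (P * Q).det = ∑ f : Fin r → Fin n, (∏ i, P i (f i)) * (Q.submatrix f id).det := by
  have h1 : P * Q = Matrix.of fun i => ∑ j, P i j • Q j := by
    ext i k
    simp [mul_apply]
  rw [h1]
  have h2 := (detRowAlternating (R := ℤ) (n := Fin r)).toMultilinearMap.map_sum
    (fun i j => P i j • Q j)
  have h3 : ∀ f : Fin r → Fin n,
      (detRowAlternating (R := ℤ) (n := Fin r)).toMultilinearMap (fun i => P i (f i) • Q (f i)) =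
      (∏ i, P i (f i)) * (Q.submatrix f id).det := fun f =>
    MultilinearMap.map_smul_univ _ _ _
  simp only [h3] at h2
  exact h2

/-- The functions with image `B` are the increasing enumeration of `B` composed with a permutation.
Reordering the rows of the second factor gives the sign, and the sum becomes the Leibniz formula for
the minor of `P`. -/
theorem sum_image_eq_of_card {P Q : Matrix (Fin r) (Fin n) ℤ} {B : Finset (Fin n)}
    (h : B.card = r) :
    ∑ f : Fin r → Fin n with Finset.univ.image f = B,
      (∏ i, P i (f i)) * ((Qᵀ).submatrix f id).det = colMinor P B * colMinor Q B := by
  have hs : ∑ f : Fin r → Fin n with Finset.univ.image f = B,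
      (∏ i, P i (f i)) * ((Qᵀ).submatrix f id).det =
      ∑ σ : Equiv.Perm (Fin r), (∏ i, P i (B.orderEmbOfFin h (σ i))) *
        ((Qᵀ).submatrix (fun i => B.orderEmbOfFin h (σ i)) id).det := by
    symm
    refine Finset.sum_bij (fun σ _ i => B.orderEmbOfFin h (σ i)) ?_ ?_ ?_ ?_
    · intro σ _
      simp only [Finset.mem_filter, Finset.mem_univ, true_and]
      ext j
      have hr := congrArg (fun t => j ∈ t) (Finset.range_orderEmbOfFin B h)
      simp only [Set.mem_range, Finset.mem_coe, eq_iff_iff] at hr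
      rw [← hr]
      simp only [Finset.mem_image, Finset.mem_univ, true_and]
      exact ⟨fun ⟨a, ha⟩ => ⟨σ a, ha⟩, fun ⟨a, ha⟩ => ⟨σ.symm a, by simpa using ha⟩⟩
    · intro σ _ τ _ hστ
      ext i
      have := congrFun hστ i
      rw [(B.orderEmbOfFin h).injective this]
    · intro f hf
      simp only [Finset.mem_filter, Finset.mem_univ, true_and] at hf
      have hinj : Function.Injective f := by
        have : (Finset.univ.image f).card = (Finset.univ : Finset (Fin r)).card := by
          rw [hf, h, Finset.card_fin]
        exact fun a b hab => Finset.card_image_iff.1 this (by simp) (by simp) hab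
      have hex : ∀ i, ∃ k, B.orderEmbOfFin h k = f i := by
        intro i
        have hr := congrArg (fun t => f i ∈ t) (Finset.range_orderEmbOfFin B h)
        simp only [Set.mem_range, Finset.mem_coe, eq_iff_iff] at hr
        rw [hr, ← hf]
        simp
      choose σ hσ using hex
      have hσi : Function.Injective σ := fun a b hab => hinj (by rw [← hσ, ← hσ, hab])
      refine ⟨Equiv.ofBijective σ (Finite.injective_iff_bijective.1 hσi), Finset.mem_univ _, ?_⟩
      funext i
      exact hσ i
    · intro σ _
      rfl
  rw [hs]
  have hdet : ∀ σ : Equiv.Perm (Fin r),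
      ((Qᵀ).submatrix (fun i => B.orderEmbOfFin h (σ i)) id).det =
        Equiv.Perm.sign σ * (Q.submatrix id (B.orderEmbOfFin h)).det := by
    intro σ
    rw [← det_transpose (Q.submatrix id _)]
    refine (det_permute σ ((Qᵀ).submatrix (B.orderEmbOfFin h) id)).trans ?_
    simp
  have hP : (P.submatrix id (B.orderEmbOfFin h)).det =
      ∑ σ : Equiv.Perm (Fin r), Equiv.Perm.sign σ * ∏ i, P i (B.orderEmbOfFin h (σ i)) := by
    rw [← det_transpose, det_apply']
    simp
  simp only [hdet]
  rw [colMinor, colMinor, dif_pos h, dif_pos h, hP, Finset.sum_mul]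
  refine Finset.sum_congr rfl fun σ _ => ?_
  ring

/-- Cauchy–Binet, by grouping the functions according to their image. An image of size other than
`r` comes from a non-injective function, which repeats a row. -/
theorem det_mul_diagonal_mul_transpose (P Q : Matrix (Fin r) (Fin n) ℤ) (v : Fin n → ℤ) :
    (P * diagonal v * Qᵀ).det =
      ∑ B : Finset (Fin n), colMinor P B * colMinor Q B * ∏ j ∈ B, v j := by
  rw [det_mul_eq_sum_functions,
    ← Finset.sum_fiberwise (s := Finset.univ) (g := fun f : Fin r → Fin n => Finset.univ.image f)]
  refine Finset.sum_congr rfl fun B _ => ?_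
  by_cases h : B.card = r
  · rw [← sum_image_eq_of_card h, Finset.sum_mul]
    refine Finset.sum_congr rfl fun f hf => ?_
    simp only [Finset.mem_filter, Finset.mem_univ, true_and] at hf
    have hinj : Function.Injective f := by
      have : (Finset.univ.image f).card = (Finset.univ : Finset (Fin r)).card := by
        rw [hf, h, Finset.card_fin]
      exact fun a b hab => Finset.card_image_iff.1 this (by simp) (by simp) hab
    have hv : ∏ j ∈ B, v j = ∏ i, v (f i) := by
      rw [← hf, Finset.prod_image fun a _ b _ hab => hinj hab]
    rw [hv]
    simp only [mul_diagonal, Finset.prod_mul_distrib]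
    ring
  · rw [colMinor, dif_neg h, zero_mul, zero_mul]
    refine Finset.sum_eq_zero fun f hf => ?_
    simp only [Finset.mem_filter, Finset.mem_univ, true_and] at hf
    have hninj : ¬ Function.Injective f := fun hinj => h (by
      rw [← hf, Finset.card_image_of_injective _ hinj, Finset.card_fin])
    simp only [Function.Injective, not_forall] at hninj
    obtain ⟨a, b, hab, hne⟩ := hninj
    rw [det_zero_of_row_eq hne (by funext k; simp [hab]), mul_zero]

theorem colMinor_ne_zero_iff {M : Matrix (Fin r) (Fin n) ℤ} (B : Finset (Fin n)) :
    colMinor M B ≠ 0 ↔ B.card = r ∧ LinearIndepOn ℚ (column M) (B : Set (Fin n)) := by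
  by_cases h : B.card = r
  · rw [colMinor, dif_pos h, ← Finset.range_orderEmbOfFin B h,
      linearIndepOn_range_iff (B.orderEmbOfFin h).injective]
    have h1 : LinearIndependent ℚ (column M ∘ B.orderEmbOfFin h) ↔
        IsUnit ((M.submatrix id (B.orderEmbOfFin h)).map (Int.castRingHom ℚ)) :=
      linearIndependent_cols_iff_isUnit
    rw [h1, isUnit_iff_isUnit_det, ← RingHom.mapMatrix_apply, ← RingHom.map_det, isUnit_iff_ne_zero]
    simp [h]
  · simp [colMinor, h]

theorem isBase_iff_colMinor_ne_zero {M : Matrix (Fin r) (Fin n) ℤ}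
    (hM : (vectorialMatroid M).eRank = (r : ℕ∞)) (B : Finset (Fin n)) :
    (vectorialMatroid M).IsBase (B : Set (Fin n)) ↔ colMinor M B ≠ 0 := by
  have hI : ∀ I : Set (Fin n), (vectorialMatroid M).Indep I ↔ LinearIndepOn ℚ (column M) I :=
    fun I => by simp [vectorialMatroid]
  rw [colMinor_ne_zero_iff]
  constructor
  · intro hB
    refine ⟨?_, (hI _).1 hB.indep⟩
    have := hB.encard_eq_eRank
    rw [hM, Set.encard_coe_eq_coe_finsetCard] at this
    exact_mod_cast this
  · rintro ⟨hc, hB⟩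
    have hB' := (hI _).2 hB
    refine hB'.isBase_of_eRk_ge (Set.toFinite _) ?_
    rw [hB'.eRk_eq_encard, hM, Set.encard_coe_eq_coe_finsetCard, hc]

end

section

open Matrix

variable {d r n : ℕ}

/-! ### Digit extraction -/

/-- The successive quotients in the extraction of the balanced digits of `V` in base `Y`, where
`H` is the largest digit. -/
def shifts (H Y V : ℤ) : ℕ → ℤ
  | 0 => V
  | k + 1 => (shifts H Y V k + H) / Y

/-- The lowest digit plus `H` lies in `[0, 2H] = [0, Y - 1]`, so the floor division by `Y` removes
exactly this digit, even if it is negative. -/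
theorem shifts_eq {H Y : ℤ} (hY : Y = 2 * H + 1) {N : ℕ} {g : ℕ → ℤ}
    (hg : ∀ k, |g k| ≤ H) {V : ℤ} (hV : V = ∑ k ∈ Finset.range N, g k * Y ^ k) :
    ∀ k m : ℕ, k + m = N → shifts H Y V k = ∑ i ∈ Finset.range m, g (k + i) * Y ^ i := by
  intro k
  induction k with
  | zero => intro m hm; simp [shifts, hV, ← hm]
  | succ k ih =>
    intro m hm
    rw [shifts, ih (m + 1) (by omega), Finset.sum_range_succ']
    have h1 : ∑ i ∈ Finset.range m, g (k + (i + 1)) * Y ^ (i + 1) =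
        Y * ∑ i ∈ Finset.range m, g (k + 1 + i) * Y ^ i := by
      rw [Finset.mul_sum]
      refine Finset.sum_congr rfl fun i _ => ?_
      rw [show k + (i + 1) = k + 1 + i by ring]
      ring
    have hb := abs_le.1 (hg k)
    rw [h1, add_zero, pow_zero, mul_one, add_assoc, add_comm,
      Int.add_mul_ediv_left _ _ (by omega), Int.ediv_eq_zero_of_lt (by omega) (by omega), zero_add]

theorem shifts_emod_eq_iff {H Y : ℤ} (hY : Y = 2 * H + 1) {N : ℕ} {g : ℕ → ℤ}
    (hg : ∀ k, |g k| ≤ H) {V : ℤ} (hV : V = ∑ k ∈ Finset.range N, g k * Y ^ k) {k : ℕ}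
    (hk : k < N) : (shifts H Y V k + H) % Y = H ↔ g k = 0 := by
  obtain ⟨m, rfl⟩ := Nat.exists_eq_add_of_lt hk
  rw [shifts_eq hY hg hV k (m + 1) (by omega), Finset.sum_range_succ']
  have h1 : ∑ i ∈ Finset.range m, g (k + (i + 1)) * Y ^ (i + 1) =
      Y * ∑ i ∈ Finset.range m, g (k + 1 + i) * Y ^ i := by
    rw [Finset.mul_sum]
    refine Finset.sum_congr rfl fun i _ => ?_
    rw [show k + (i + 1) = k + 1 + i by ring]
    ring
  have hb := abs_le.1 (hg k)
  rw [h1, add_zero, pow_zero, mul_one, add_assoc, add_comm, Int.add_mul_emod_self_left,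
    Int.emod_eq_of_lt (by omega) (by omega)]
  omega

theorem natAbs_shifts_le {H Y V : ℤ} (k : ℕ) :
    (shifts H Y V k).natAbs ≤ V.natAbs + k * H.natAbs := by
  induction k with
  | zero => simp [shifts]
  | succ k ih =>
    have h := (Int.natAbs_ediv_le_natAbs (shifts H Y V k + H) Y).trans (Int.natAbs_add_le _ _)
    rw [shifts, add_mul]
    omega

/-! ### Weight vectors as single numbers -/

/-- Evaluation of the number with digits `u 0, …, u (m - 1)` in base `D`. -/
def horner (D : ℤ) (u : ℕ → ℤ) : ℕ → ℤ
  | 0 => 0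
  | m + 1 => horner D u m * D + u m

theorem horner_sum {ι : Type*} (D : ℤ) (B : Finset ι) (u : ι → ℕ → ℤ) (m : ℕ) :
    ∑ j ∈ B, horner D (u j) m = horner D (fun i => ∑ j ∈ B, u j i) m := by
  induction m with
  | zero => simp [horner]
  | succ m ih => simp only [horner, Finset.sum_add_distrib, ← Finset.sum_mul, ih]

theorem horner_nonneg {D : ℤ} (hD : 0 ≤ D) {u : ℕ → ℤ} (m : ℕ) (hu : ∀ i < m, 0 ≤ u i) :
    0 ≤ horner D u m := by
  induction m with
  | zero => simp [horner]
  | succ m ih =>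
    have := ih fun i hi => hu i (hi.trans m.lt_succ_self)
    have := hu m m.lt_succ_self
    simp only [horner]
    positivity

theorem horner_lt {D : ℤ} {u : ℕ → ℤ} (m : ℕ) (hu : ∀ i < m, 0 ≤ u i ∧ u i < D) :
    horner D u m < D ^ m := by
  induction m with
  | zero => simp [horner]
  | succ m ih =>
    have h1 := ih fun i hi => hu i (hi.trans m.lt_succ_self)
    have h2 := hu m m.lt_succ_self
    rw [horner, pow_succ]
    nlinarith

/-- The digit `u 0` is the most significant one, so digit `i` becomes the last one after `m - 1 - i`
divisions. -/
theorem horner_div_iterate {D : ℤ} {u : ℕ → ℤ} {m : ℕ} (hu : ∀ i < m, 0 ≤ u i ∧ u i < D) (t : ℕ) :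
    ∀ i, i + 1 + t = m → ((· / D)^[t] (horner D u m)) % D = u i := by
  induction t generalizing m with
  | zero =>
    rintro i rfl
    have h := hu i (by omega)
    simp only [Function.iterate_zero, id, horner]
    rw [add_comm, Int.add_mul_emod_self_right, Int.emod_eq_of_lt h.1 h.2]
  | succ t ih =>
    rintro i rfl
    have h := hu (i + 1 + t) (by omega)
    rw [Function.iterate_succ_apply]
    have h1 : horner D u (i + 1 + (t + 1)) / D = horner D u (i + 1 + t) := by
      rw [show i + 1 + (t + 1) = i + 1 + t + 1 by ring, horner, add_comm,
        Int.add_mul_ediv_right _ _ (by omega), Int.ediv_eq_zero_of_lt h.1 h.2, zero_add]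
    rw [h1]
    exact ih (fun j hj => hu j (by omega)) i rfl

theorem rowMajor_apply {m : ℕ} (A : Matrix (Fin m) (Fin n) ℤ) (i : Fin m) (j : Fin n) :
    rowMajor A ((i : ℤ) * n + j) = A i j := by
  unfold rowMajor
  rw [Finset.sum_eq_single i, Finset.sum_eq_single j]
  · simp
  · intro j' _ hj'
    rw [if_neg]
    intro h
    apply hj'
    ext
    omega
  · simp
  · intro i' _ hi'
    refine Finset.sum_eq_zero fun j' _ => ?_
    rw [if_neg]
    intro h
    apply hi'
    have hn : (i : ℕ) * n + j = i' * n + j' := by exact_mod_cast h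
    ext
    rw [← flat_div i' j', ← hn, flat_div]
  · simp

/-- The weight of column `j`, as a single number in base `D`; the digits are shifted by `w`. -/
def colWeight (W : Matrix (Fin d) (Fin n) ℤ) (w D : ℤ) (j : ℕ) : ℕ → ℤ :=
  horner D fun i => rowMajor W ((i : ℤ) * n + j) + w

variable {W : Matrix (Fin d) (Fin n) ℤ} {w D : ℤ}

theorem digit_bounds (hW : ∀ i j, |W i j| ≤ w) {i : ℕ} (hi : i < d) (j : Fin n) :
    0 ≤ rowMajor W ((i : ℤ) * n + j) + w ∧ rowMajor W ((i : ℤ) * n + j) + w ≤ 2 * w := by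
  have h := rowMajor_apply W ⟨i, hi⟩ j
  have h' := abs_le.1 (hW ⟨i, hi⟩ j)
  simp only at h
  rw [h]
  omega

theorem colWeight_nonneg (hW : ∀ i j, |W i j| ≤ w) (hD : D = 2 * n * w + 1) (hw : 0 ≤ w)
    (j : Fin n) {k : ℕ} (hk : k ≤ d) : 0 ≤ colWeight W w D j k :=
  horner_nonneg (by rw [hD]; positivity) k fun _ hi => (digit_bounds hW (by omega) j).1

/-- At most `n` shifted digits, each at most `2 * w`, are added, and `D` exceeds `2 * n * w`: adding
column weights never produces a carry. -/
theorem digit_sum_bounds (hW : ∀ i j, |W i j| ≤ w) (hD : D = 2 * n * w + 1) (hw : 0 ≤ w)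
    (B : Finset (Fin n)) (i : ℕ) (hi : i < d) :
    0 ≤ ∑ j ∈ B, (rowMajor W ((i : ℤ) * n + (j : ℕ)) + w) ∧
      ∑ j ∈ B, (rowMajor W ((i : ℤ) * n + (j : ℕ)) + w) < D := by
  refine ⟨Finset.sum_nonneg fun j _ => (digit_bounds hW hi j).1, ?_⟩
  have h1 : ∑ j ∈ B, (rowMajor W ((i : ℤ) * n + (j : ℕ)) + w) ≤ B.card • (2 * w) :=
    Finset.sum_le_card_nsmul _ _ _ fun j _ => (digit_bounds hW hi j).2
  have h2 : (B.card : ℤ) ≤ n := by exact_mod_cast card_finset_fin_le B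
  rw [nsmul_eq_mul] at h1
  nlinarith

theorem sum_colWeight_lt (hW : ∀ i j, |W i j| ≤ w) (hD : D = 2 * n * w + 1) (hw : 0 ≤ w)
    (B : Finset (Fin n)) : ∑ j ∈ B, colWeight W w D (j : ℕ) d < D ^ d := by
  unfold colWeight
  rw [horner_sum]
  exact horner_lt d (digit_sum_bounds hW hD hw B)

theorem colWeight_lt (hW : ∀ i j, |W i j| ≤ w) (hD : D = 2 * n * w + 1) (hw : 0 ≤ w)
    (j : Fin n) {k : ℕ} (hk : k ≤ d) : colWeight W w D j k < D ^ k := by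
  have h := horner_lt (D := D) (u := fun i => rowMajor W ((i : ℤ) * n + j) + w) k
    fun i hi => by simpa using digit_sum_bounds hW hD hw {j} i (by omega)
  exact h

/-- Recovery of the `i`-th coordinate of the total weight from its number. -/
theorem decode_sum_colWeight (hW : ∀ i j, |W i j| ≤ w) (hD : D = 2 * n * w + 1) (hw : 0 ≤ w)
    {B : Finset (Fin n)} (hB : B.card = r) (i : Fin d) :
    ((· / D)^[d - 1 - i] (∑ j ∈ B, colWeight W w D (j : ℕ) d)) % D - r * w =
      W.mulVec ((B : Set (Fin n)).indicator 1) i := by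
  unfold colWeight
  rw [horner_sum, horner_div_iterate (digit_sum_bounds hW hD hw B) (d - 1 - i) i (by omega),
    Finset.sum_add_distrib, Finset.sum_const, hB, nsmul_eq_mul, add_sub_cancel_right]
  simp only [rowMajor_apply, mulVec, dotProduct, Set.indicator_apply, Finset.mem_coe, Pi.one_apply,
    mul_ite, mul_one, mul_zero, Finset.sum_ite_mem, Finset.univ_inter]

/-! ### The generating polynomial of the common bases -/

/-- The contribution to the generating polynomial, at the point `x`, of the column sets contained
in `S` whose weight is `k`. -/
def gcoeff (M₁ M₂ : Matrix (Fin r) (Fin n) ℤ) (z : Fin n → ℕ) (x : Fin n → ℤ)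
    (S : Finset (Fin n)) (k : ℕ) : ℤ :=
  ∑ B : Finset (Fin n) with B ⊆ S ∧ ∑ j ∈ B, z j = k,
    colMinor M₁ B * colMinor M₂ B * ∏ j ∈ B, x j

variable {M₁ M₂ : Matrix (Fin r) (Fin n) ℤ} {z : Fin n → ℕ} {x : Fin n → ℤ}

/-- In Cauchy–Binet the factor `Y ^ z j` turns into `Y` to the total weight of `B`, and the 0/1
factors kill every `B` that is not contained in `S`. Sorting by total weight gives the polynomial.
-/
theorem det_eq_sum_gcoeff {N : ℕ} (hN : ∀ B : Finset (Fin n), ∑ j ∈ B, z j < N) (Y : ℤ)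
    (S : Finset (Fin n)) :
    (M₁ * diagonal (fun j => (if j ∈ S then 1 else 0) * (x j * Y ^ z j)) * M₂ᵀ).det =
      ∑ k ∈ Finset.range N, gcoeff M₁ M₂ z x S k * Y ^ k := by
  rw [det_mul_diagonal_mul_transpose]
  simp only [gcoeff, Finset.sum_filter, Finset.sum_mul]
  rw [Finset.sum_comm]
  refine Finset.sum_congr rfl fun B _ => ?_
  rw [Finset.prod_mul_distrib, Finset.prod_mul_distrib, Finset.prod_pow_eq_pow_sum,
    Finset.sum_eq_single (∑ j ∈ B, z j)]
  · by_cases hB : B ⊆ S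
    · rw [Finset.prod_congr rfl fun j hj => if_pos (hB hj)]
      simp [hB]
      ring
    · obtain ⟨j, hj, hjS⟩ := Finset.not_subset.1 hB
      rw [Finset.prod_eq_zero hj (if_neg hjS)]
      simp [hB]
  · intro k _ hk
    rw [if_neg fun h => hk h.2.symm, zero_mul]
  · exact fun h => absurd (Finset.mem_range.2 (hN B)) h

/-! ### Size of the minors and of the coefficients. -/

theorem natAbs_colMinor_le {P : Matrix (Fin r) (Fin n) ℤ} {a : ℕ} (hP : ∀ i j, (P i j).natAbs ≤ a)
    (hr : r ≤ n) (B : Finset (Fin n)) : (colMinor P B).natAbs ≤ (a + n + 2) ^ (2 * n) := by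
  unfold colMinor
  split_ifs with h
  · have h1 := det_le (abv := AbsoluteValue.abs) (x := (a : ℤ))
      (A := P.submatrix id (B.orderEmbOfFin h)) fun i j => by
        have := hP i (B.orderEmbOfFin h j)
        simp only [AbsoluteValue.abs_apply, submatrix_apply, id]
        rw [← Int.natCast_natAbs]
        exact_mod_cast this
    simp only [AbsoluteValue.abs_apply, Fintype.card_fin, nsmul_eq_mul] at h1
    have h2 : (P.submatrix id (B.orderEmbOfFin h)).det.natAbs ≤ r.factorial * a ^ r := by
      zify
      exact h1
    refine h2.trans ?_
    calc r.factorial * a ^ r ≤ r ^ r * a ^ r := Nat.mul_le_mul_right _ r.factorial_le_pow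
      _ ≤ (a + n + 2) ^ r * (a + n + 2) ^ r := by gcongr <;> omega
      _ = (a + n + 2) ^ (2 * r) := by ring
      _ ≤ (a + n + 2) ^ (2 * n) := Nat.pow_le_pow_right (by omega) (by omega)
  · simp

/-- The exponent collects `2n` for each of the two minors, `n` for the product of the `x j`, and `n`
for the number of sets. The extra 4 is room for later estimates that need a small power of the base
even when `n = 0`. -/
theorem natAbs_gcoeff_le {a K : ℕ} (h₁ : ∀ i j, (M₁ i j).natAbs ≤ a)
    (h₂ : ∀ i j, (M₂ i j).natAbs ≤ a) (hr : r ≤ n) (hx : ∀ j, (x j).natAbs ≤ 2 ^ K)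
    (S : Finset (Fin n)) (k : ℕ) :
    (gcoeff M₁ M₂ z x S k).natAbs ≤ ((a + n + 2) * 2 ^ K) ^ (6 * n + 4) := by
  set c := (a + n + 2) * 2 ^ K with hc
  have hK : 1 ≤ 2 ^ K := Nat.one_le_two_pow
  have hac : a + n + 2 ≤ c := Nat.le_mul_of_pos_right _ hK
  have hKc : 2 ^ K ≤ c := Nat.le_mul_of_pos_left _ (by omega)
  have hterm : ∀ B : Finset (Fin n),
      (colMinor M₁ B * colMinor M₂ B * ∏ j ∈ B, x j).natAbs ≤ c ^ (5 * n) := by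
    intro B
    rw [Int.natAbs_mul, Int.natAbs_mul, ← Int.natAbsHom_apply (∏ j ∈ B, x j), map_prod]
    have h3 : ∏ j ∈ B, Int.natAbsHom (x j) ≤ c ^ n :=
      (Finset.prod_le_pow_card B _ c fun j _ => (hx j).trans hKc).trans
        (Nat.pow_le_pow_right (by omega) (card_finset_fin_le B))
    calc _ ≤ c ^ (2 * n) * c ^ (2 * n) * c ^ n := by
          gcongr
          · exact (natAbs_colMinor_le h₁ hr B).trans (Nat.pow_le_pow_left hac _)
          · exact (natAbs_colMinor_le h₂ hr B).trans (Nat.pow_le_pow_left hac _)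
      _ = c ^ (5 * n) := by ring
  unfold gcoeff
  refine (Int.natAbs_sum_le _ _).trans ((Finset.sum_le_card_nsmul _ _ _ fun B _ => hterm B).trans ?_)
  have hcard : (Finset.univ.filter fun B : Finset (Fin n) => B ⊆ S ∧ ∑ j ∈ B, z j = k).card ≤
      c ^ n := by
    refine (Finset.card_le_univ _).trans ?_
    rw [Fintype.card_finset, Fintype.card_fin]
    exact Nat.pow_le_pow_left (by omega) _
  rw [smul_eq_mul]
  calc _ ≤ c ^ n * c ^ (5 * n) := Nat.mul_le_mul_right _ hcard
    _ = c ^ (6 * n) := by ring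
    _ ≤ _ := Nat.pow_le_pow_right (by omega) (by omega)

/-! ### Points that reveal all common bases -/

/-- At the point `x`, no family of common bases is hidden by cancellation. -/
def Revealing (M₁ M₂ : Matrix (Fin r) (Fin n) ℤ) (z : Fin n → ℕ) (x : Fin n → ℤ) : Prop :=
  ∀ B S : Finset (Fin n), B ⊆ S → colMinor M₁ B * colMinor M₂ B ≠ 0 →
    gcoeff M₁ M₂ z x S (∑ j ∈ B, z j) ≠ 0

/-- Greedy deletion of the elements `0, 1, …` as long as `P` is kept. -/
noncomputable def greedy (P : Finset (Fin n) → Prop) : ℕ → Finset (Fin n)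
  | 0 => Finset.univ
  | k + 1 => open Classical in
    if P ((greedy P k).filter fun j => (j : ℕ) ≠ k) then (greedy P k).filter fun j => (j : ℕ) ≠ k
    else greedy P k

theorem greedy_anti (P : Finset (Fin n) → Prop) : Antitone (greedy P) :=
  antitone_nat_of_succ_le fun k => by
    rw [greedy]
    split_ifs
    exacts [Finset.filter_subset _ _, le_rfl]

theorem greedy_prop {P : Finset (Fin n) → Prop} (h : P Finset.univ) (k : ℕ) : P (greedy P k) := by
  induction k with
  | zero => exact h
  | succ k ih =>
    rw [greedy]
    split_ifs with h'
    exacts [h', ih]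

theorem exists_of_gcoeff_ne_zero {S : Finset (Fin n)} {k : ℕ} (h : gcoeff M₁ M₂ z x S k ≠ 0) :
    ∃ B ⊆ S, ∑ j ∈ B, z j = k ∧ colMinor M₁ B * colMinor M₂ B ≠ 0 := by
  obtain ⟨B, hB, h0⟩ := Finset.exists_ne_zero_of_sum_ne_zero h
  simp only [Finset.mem_filter, Finset.mem_univ, true_and] at hB
  exact ⟨B, hB.1, hB.2, left_ne_zero_of_mul h0⟩

/-- Some `B` with nonzero minor product and number `k` lies inside the final set. If a column `j`
outside `B` survived, then at stage `j` the set without `j` still contained `B`, and at a revealing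
point the test would have allowed the deletion. So the final set is `B` itself. -/
theorem Revealing.greedy (hx : Revealing M₁ M₂ z x) {k : ℕ}
    (hk : gcoeff M₁ M₂ z x Finset.univ k ≠ 0) :
    ∑ j ∈ greedy (fun S => gcoeff M₁ M₂ z x S k ≠ 0) n, z j = k ∧
      colMinor M₁ (greedy (fun S => gcoeff M₁ M₂ z x S k ≠ 0) n) *
        colMinor M₂ (greedy (fun S => gcoeff M₁ M₂ z x S k ≠ 0) n) ≠ 0 := by
  set P : Finset (Fin n) → Prop := fun S => gcoeff M₁ M₂ z x S k ≠ 0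
  obtain ⟨B, hB, hz, h0⟩ := exists_of_gcoeff_ne_zero (greedy_prop (P := P) hk n)
  suffices h : MatroidIntersection.greedy P n = B by rw [h]; exact ⟨hz, h0⟩
  refine Finset.Subset.antisymm (fun j hj => ?_) hB
  by_contra hjB
  have hj1 : j ∈ MatroidIntersection.greedy P (j + 1) := greedy_anti P (by omega) hj
  have hsub : B ⊆ (MatroidIntersection.greedy P j).filter fun i => (i : ℕ) ≠ j := by
    intro i hi
    refine Finset.mem_filter.2 ⟨greedy_anti P (by omega) (hB hi), fun hij => hjB ?_⟩
    rwa [← Fin.ext hij]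
  have hP : P ((MatroidIntersection.greedy P j).filter fun i => (i : ℕ) ≠ j) := by
    have := hx B _ hsub h0
    rwa [hz] at this
  rw [MatroidIntersection.greedy, if_pos hP] at hj1
  exact (Finset.mem_filter.1 hj1).2 rfl

end

section

open MeasureTheory

variable {r n : ℕ} {M₁ M₂ : Matrix (Fin r) (Fin n) ℤ} {z : Fin n → ℕ}

/-! ### Random points are revealing -/

/-- The number whose binary digits are the `k` random bits from position `t` on. -/
def bits (ω : ℕ → Bool) (t : ℕ) : ℕ → ℤ
  | 0 => 0
  | k + 1 => 2 * bits ω t k + (if ω (t + k) then 1 else 0)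

theorem bits_bounds (ω : ℕ → Bool) (t k : ℕ) : 0 ≤ bits ω t k ∧ bits ω t k < 2 ^ k := by
  induction k with
  | zero => simp [bits]
  | succ k ih =>
    rw [bits, pow_succ]
    split_ifs <;> omega

theorem natAbs_bits_le (ω : ℕ → Bool) (t k : ℕ) : (bits ω t k).natAbs ≤ 2 ^ k := by
  have h := bits_bounds ω t k
  zify
  rw [abs_of_nonneg h.1]
  exact h.2.le

theorem bits_inj {ω ω' : ℕ → Bool} {t k : ℕ} (h : bits ω t k = bits ω' t k) :
    ∀ i < k, ω (t + i) = ω' (t + i) := by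
  induction k with
  | zero => simp
  | succ k ih =>
    rw [bits, bits] at h
    have hbit : ω (t + k) = ω' (t + k) ∧ bits ω t k = bits ω' t k := by
      cases h1 : ω (t + k) <;> cases h2 : ω' (t + k) <;> simp [h1, h2] at h ⊢ <;> omega
    intro i hi
    rcases Nat.lt_succ_iff_lt_or_eq.1 hi with hi | rfl
    exacts [ih hbit.2 i hi, hbit.1]

instance : IsProbabilityMeasure fairCoins := by
  unfold fairCoins
  infer_instance

theorem fairCoins_cylinder (ω₀ : ℕ → Bool) (m : ℕ) :
    fairCoins {ω | ∀ i < m, ω i = ω₀ i} = ((2 : ENNReal) ^ m)⁻¹ := by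
  have h : {ω : ℕ → Bool | ∀ i < m, ω i = ω₀ i} =
      Set.pi (Finset.range m : Set ℕ) fun i => {ω₀ i} := by
    ext ω
    simp [Set.mem_pi]
  rw [h, fairCoins, Measure.infinitePi_pi _ (fun _ _ => measurableSet_singleton _)]
  simp only [PMF.toMeasure_apply_singleton _ _ (measurableSet_singleton _),
    PMF.uniformOfFintype_apply, Fintype.card_bool]
  simp [ENNReal.inv_pow]

/-- The `n` blocks of `K` bits together are the first `n * K` coins, so a value of all numbers
prescribes a cylinder, or is not attained at all. -/
theorem fairCoins_bits_eq_le (n K : ℕ) (v : Fin n → ℤ) :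
    fairCoins {ω | (fun j : Fin n => bits ω (j * K) K) = v} ≤ ((2 : ENNReal) ^ (n * K))⁻¹ := by
  by_cases h : ∃ ω₀, (fun j : Fin n => bits ω₀ (j * K) K) = v
  · obtain ⟨ω₀, rfl⟩ := h
    rw [← fairCoins_cylinder ω₀]
    refine measure_mono fun ω hω i hi => ?_
    have hK : 0 < K := Nat.pos_of_ne_zero (by rintro rfl; simp at hi)
    have hj : i / K < n := (Nat.div_lt_iff_lt_mul hK).2 hi
    have h1 := bits_inj (congrFun hω ⟨i / K, hj⟩) (i % K) (Nat.mod_lt _ hK)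
    simpa [Nat.div_add_mod'] using h1
  · rw [Set.eq_empty_of_forall_notMem (s := {ω | _ = v}) fun ω hω => h ⟨ω, hω⟩]
    simp

/-- Schwartz–Zippel on the grid `[0, 2 ^ K) ^ n`: by the degree condition at most half of its points
are roots, and each point has probability at most `2 ^ (-n * K)`. -/
theorem fairCoins_eval_eq_zero_le {P : MvPolynomial (Fin n) ℤ} (hP : P ≠ 0) {K : ℕ}
    (hdeg : 2 * P.totalDegree ≤ 2 ^ K) :
    fairCoins {ω | MvPolynomial.eval (fun j : Fin n => bits ω (j * K) K) P = 0} ≤ 1 / 2 := by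
  classical
  set S : Finset ℤ := Finset.Ico 0 (2 ^ K) with hS
  have hcardS : S.card = 2 ^ K := by
    rw [hS, Int.card_Ico, sub_zero]
    exact_mod_cast Int.toNat_natCast (2 ^ K)
  set T := (Fintype.piFinset fun _ : Fin n => S).filter fun f => MvPolynomial.eval f P = 0
  have hT : 2 * T.card ≤ 2 ^ (n * K) := by
    have h := MvPolynomial.schwartz_zippel_totalDegree hP S
    rw [hcardS, div_le_div_iff₀ (by positivity) (by positivity)] at h
    have h' : T.card * 2 ^ K ≤ P.totalDegree * (2 ^ K) ^ n := by exact_mod_cast h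
    have h2 : 2 * T.card * 2 ^ K ≤ 2 ^ (n * K) * 2 ^ K := by
      calc 2 * T.card * 2 ^ K = 2 * (T.card * 2 ^ K) := by ring
        _ ≤ 2 * (P.totalDegree * (2 ^ K) ^ n) := by gcongr
        _ = (2 * P.totalDegree) * (2 ^ (n * K)) := by rw [← pow_mul, mul_comm K n]; ring
        _ ≤ 2 ^ K * (2 ^ (n * K)) := by gcongr
        _ = _ := mul_comm _ _
    exact Nat.le_of_mul_le_mul_right h2 (by positivity)
  calc _ ≤ fairCoins (⋃ v ∈ T, {ω | (fun j : Fin n => bits ω (j * K) K) = v}) := by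
        refine measure_mono fun ω hω => ?_
        simp only [Set.mem_iUnion, Set.mem_ofPred_eq]
        refine ⟨_, Finset.mem_filter.2 ⟨?_, hω⟩, rfl⟩
        simp only [Fintype.mem_piFinset, hS, Finset.mem_Ico]
        exact fun j => bits_bounds ω _ K
    _ ≤ ∑ v ∈ T, fairCoins {ω | (fun j : Fin n => bits ω (j * K) K) = v} :=
        measure_biUnion_finset_le _ _
    _ ≤ ∑ v ∈ T, ((2 : ENNReal) ^ (n * K))⁻¹ := Finset.sum_le_sum fun v _ => fairCoins_bits_eq_le n K v
    _ = T.card / (2 : ENNReal) ^ (n * K) := by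
        rw [Finset.sum_const, nsmul_eq_mul, div_eq_mul_inv]
    _ ≤ 1 / 2 := by
        rw [ENNReal.div_le_iff_le_mul (by simp) (by simp), one_div, ← ENNReal.div_eq_inv_mul,
          ENNReal.le_div_iff_mul_le (by simp) (by simp), mul_comm]
        exact_mod_cast hT

/-- `gcoeff`, as a polynomial in the point. -/
noncomputable def gcoeffPoly (M₁ M₂ : Matrix (Fin r) (Fin n) ℤ) (z : Fin n → ℕ)
    (S : Finset (Fin n)) (k : ℕ) : MvPolynomial (Fin n) ℤ :=
  ∑ B : Finset (Fin n) with B ⊆ S ∧ ∑ j ∈ B, z j = k,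
    MvPolynomial.C (colMinor M₁ B * colMinor M₂ B) * ∏ j ∈ B, MvPolynomial.X j

theorem eval_gcoeffPoly (x : Fin n → ℤ) (S : Finset (Fin n)) (k : ℕ) :
    MvPolynomial.eval x (gcoeffPoly M₁ M₂ z S k) = gcoeff M₁ M₂ z x S k := by
  simp [gcoeffPoly, gcoeff]

theorem totalDegree_gcoeffPoly_le (S : Finset (Fin n)) (k : ℕ) :
    (gcoeffPoly M₁ M₂ z S k).totalDegree ≤ n := by
  refine MvPolynomial.totalDegree_finsetSum_le fun B _ => ?_
  refine (MvPolynomial.totalDegree_mul _ _).trans ?_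
  rw [MvPolynomial.totalDegree_C, zero_add]
  refine (MvPolynomial.totalDegree_finsetProd _ _).trans ?_
  simpa using card_finset_fin_le B

/-- Evaluate at the characteristic vector of `B`. A contributing set has `r` elements, as does `B`,
and its product survives only if it is contained in `B`; so only `B` contributes. -/
theorem gcoeffPoly_ne_zero {B S : Finset (Fin n)} (hBS : B ⊆ S)
    (hB : colMinor M₁ B * colMinor M₂ B ≠ 0) : gcoeffPoly M₁ M₂ z S (∑ j ∈ B, z j) ≠ 0 := by
  intro h
  have h1 := congrArg (MvPolynomial.eval fun j => if j ∈ B then 1 else 0) h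
  rw [eval_gcoeffPoly, map_zero, gcoeff, Finset.sum_eq_single B] at h1
  · rw [Finset.prod_congr rfl fun j hj => if_pos hj] at h1
    simp at h1
    exact hB (by simpa using h1)
  · intro B' _ hne
    by_contra hcon
    have h2 := left_ne_zero_of_mul hcon
    have hc := ((colMinor_ne_zero_iff B).1 (left_ne_zero_of_mul hB)).1
    have hc' := ((colMinor_ne_zero_iff B').1 (left_ne_zero_of_mul h2)).1
    refine hne (Finset.eq_of_subset_of_card_le (fun j hj => ?_) (by omega))
    by_contra hjB
    exact right_ne_zero_of_mul hcon (Finset.prod_eq_zero hj (if_neg hjB))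
  · intro h
    simp [hBS] at h

theorem half_le_fairCoins_revealing (M₁ M₂ : Matrix (Fin r) (Fin n) ℤ) (z : Fin n → ℕ) :
    (1 / 2 : ENNReal) ≤ fairCoins {ω | Revealing M₁ M₂ z
      fun j => bits ω (j * (3 * n + 1)) (3 * n + 1)} := by
  classical
  -- The product over all pairs `(B, S)` has at most `4 ^ n` factors of degree at most `n`, hence
  -- degree at most `2 ^ (3 * n)`; one more bit brings the failure probability down to 1/2.
  set K := 3 * n + 1 with hK
  let F : Finset (Fin n) × Finset (Fin n) → MvPolynomial (Fin n) ℤ := fun p =>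
    if p.1 ⊆ p.2 ∧ colMinor M₁ p.1 * colMinor M₂ p.1 ≠ 0 then
      gcoeffPoly M₁ M₂ z p.2 (∑ j ∈ p.1, z j) else 1
  have hF : ∏ p, F p ≠ 0 := by
    refine Finset.prod_ne_zero_iff.2 fun p _ => ?_
    by_cases h : p.1 ⊆ p.2 ∧ colMinor M₁ p.1 * colMinor M₂ p.1 ≠ 0
    · simp only [F, if_pos h]
      exact gcoeffPoly_ne_zero h.1 h.2
    · simp only [F, if_neg h]
      exact one_ne_zero
  have hdeg : (∏ p, F p).totalDegree ≤ 2 ^ (3 * n) := by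
    refine (MvPolynomial.totalDegree_finsetProd _ _).trans ?_
    refine (Finset.sum_le_card_nsmul _ _ n fun p _ => ?_).trans ?_
    · simp only [F]
      split_ifs
      · exact totalDegree_gcoeffPoly_le _ _
      · simp
    · rw [Finset.card_univ, Fintype.card_prod, Fintype.card_finset, Fintype.card_fin, smul_eq_mul]
      calc 2 ^ n * 2 ^ n * n ≤ 2 ^ n * 2 ^ n * 2 ^ n := by gcongr; exact Nat.lt_two_pow_self.le
        _ = 2 ^ (3 * n) := by ring
  have hbad := fairCoins_eval_eq_zero_le hF (K := K) (by rw [hK, pow_succ]; omega)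
  have hcover : (Set.univ : Set (ℕ → Bool)) ⊆
      {ω | Revealing M₁ M₂ z fun j => bits ω (j * K) K} ∪
        {ω | MvPolynomial.eval (fun j : Fin n => bits ω (j * K) K) (∏ p, F p) = 0} := by
    intro ω _
    by_cases h : MvPolynomial.eval (fun j : Fin n => bits ω (j * K) K) (∏ p, F p) = 0
    · exact Or.inr h
    · refine Or.inl fun B S hBS hB => ?_
      rw [MvPolynomial.eval_prod] at h
      have := Finset.prod_ne_zero_iff.1 h (B, S) (Finset.mem_univ _)
      simp only [F, if_pos (And.intro hBS hB)] at this
      rwa [eval_gcoeffPoly] at this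
  -- Subadditivity holds for arbitrary sets, so the measurability of the revealing event plays no
  -- role.
  have h1 := (measure_mono hcover).trans (measure_union_le (μ := fairCoins) _ _)
  rw [measure_univ] at h1
  have h2 : (1 / 2 : ENNReal) + 1 / 2 ≤ fairCoins {ω | Revealing M₁ M₂ z
      fun j => bits ω (j * K) K} + 1 / 2 := by
    rw [ENNReal.add_halves]
    exact h1.trans (by gcongr)
  exact (ENNReal.add_le_add_iff_right (by simp)).1 h2

end

section

open MatroidIntersection.Program MatroidIntersection.Expr

variable {d : ℕ}

/-! ### A program for the generating polynomial -/

/-- Fill array `5` with the matrix `M₁ diag(S v) M₂ᵀ`, where `S` is array `3` and `v` is array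
`4`. -/
def productProgram : Program d :=
  .forLoop 14 (reg 1 * reg 1) (.seq
    (.fold 20 15 (lit 0) (reg 0) (reg 20 + load 0 (reg 14 / reg 1 * reg 0 + reg 15) *
      (load 3 (reg 15) * load 4 (reg 15)) * load 1 (reg 14 % reg 1 * reg 0 + reg 15)))
    (.store 5 (reg 14) (reg 20)))

/-- One round of the Faddeev–LeVerrier algorithm. -/
def faddeevRound : Program d :=
  .seq (.forLoop 14 (reg 1 * reg 1) (.seq
      (.fold 20 15 (reg 8 * load 5 (reg 14)) (reg 1)
        (reg 20 + load 5 (reg 14 / reg 1 * reg 1 + reg 15) *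
          load 6 (reg 16 * (reg 1 * reg 1) + (reg 15 * reg 1 + reg 14 % reg 1))))
      (.store 6 ((reg 16 + lit 1) * (reg 1 * reg 1) + reg 14) (reg 20))))
  (.seq (.fold 20 15 (lit 0) (reg 1)
      (reg 20 + load 6 ((reg 16 + lit 1) * (reg 1 * reg 1) + (reg 15 * reg 1 + reg 15))))
    (.set 8 ((lit 0 - reg 20) / (reg 16 + lit 1))))

/-- Put the determinant of `M₁ diag(S v) M₂ᵀ`, up to sign, into register `8`. -/
def detProgram : Program d :=
  .seq productProgram (.seq (.set 8 (lit 1)) (.forLoop 16 (reg 1) faddeevRound))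

/-- The partial sums of the entry with number `q` of `M₁ diag(S v) M₂ᵀ`. -/
def productEntry (n r : ℕ) (s : Store) (q k : ℕ) : ℤ :=
  ∑ j ∈ Finset.range k, s.mem 0 ((q / r * n + j : ℕ) : ℤ) * (s.mem 3 j * s.mem 4 j) *
    s.mem 1 ((q % r * n + j : ℕ) : ℤ)

variable {O : (Fin d → ℤ) → (Fin d → ℤ) → Bool} {ω : ℕ → Bool} {b X : ℕ}

theorem runs_productProgram {s : Store} {n r : ℕ} (hb : 1 ≤ b) (hXb : X ≤ 2 ^ b)
    (hn : s.reg 0 = n) (hr : s.reg 1 = r) (hnX : n ≤ X) (hrX : r * r ≤ X)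
    (hα : ∀ q < r * r, ∀ k ≤ n, (productEntry n r s q k).natAbs ≤ 2 ^ b) :
    Runs O ω b X (productProgram : Program d) s fun s' =>
      ∀ q < r * r, s'.mem 5 q = productEntry n r s q n := by
  refine .forLoop (N := r * r) hb hrX hXb rfl
    (fun k s' => ∀ q < k, s'.mem 5 q = productEntry n r s q n) (by simp) ?_ ?_ ?_
  · intro k _ s' hF _ _
    have h1 := hF.reg 1 rfl
    simp only [eval_mul, eval_reg, h1, hr]
    exact_mod_cast Int.toNat_natCast (r * r)
  · intro k hk s' _ hF hik hI
    have h0 := (hF.reg 0 rfl).trans hn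
    have h1 := (hF.reg 1 rfl).trans hr
    have m0 := hF.mem 0 rfl
    have m1 := hF.mem 1 rfl
    have m3 := hF.mem 3 rfl
    have m4 := hF.mem 4 rfl
    refine .seq (.fold hb n (productEntry n r s k) (by decide) hnX hXb (hα k hk)
      (by simp [productEntry]) (by simp [h0]) ?_ ?_)
    · intro j hj
      simp [productEntry, Finset.sum_range_succ, h0, h1, m0, m1, m3, m4, hik]
    · refine .store hb (by simpa using hα k hk n le_rfl) ?_
      intro q hq
      rcases Nat.lt_succ_iff_lt_or_eq.1 hq with hq' | rfl
      · have : (q : ℤ) ≠ k := by exact_mod_cast hq'.ne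
        simp [hik, this, hI q hq']
      · simp [hik]
  · intro s' _ _ _ hI
    exact hI

/-- One matrix step enlarges the numbers by a factor at most `(r + 1) * α`, the trace by at most `r`
more, and division does not enlarge them. Partial sums are included because the machine stores each
of them in a register. -/
theorem natAbs_faddeev_le {r α : ℕ} {F : ℕ → ℤ} (hF : ∀ q < r * r, (F q).natAbs ≤ α) (k : ℕ) :
    (faddeev r F k).2.natAbs ≤ ((r + 1) ^ 2 * (α + 1)) ^ k ∧
    (∀ q < r * r, ((faddeev r F k).1 q).natAbs ≤ ((r + 1) ^ 2 * (α + 1)) ^ k) ∧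
    (∀ q < r * r, ∀ m ≤ r, ((faddeev r F k).2 * F q + ∑ l ∈ Finset.range m,
      F (q / r * r + l) * (faddeev r F k).1 (l * r + q % r)).natAbs ≤
        ((r + 1) ^ 2 * (α + 1)) ^ (k + 1)) ∧
    ∀ m ≤ r, (∑ l ∈ Finset.range m, (faddeev r F (k + 1)).1 (l * r + l)).natAbs ≤
        ((r + 1) ^ 2 * (α + 1)) ^ (k + 1) := by
  set β := (r + 1) ^ 2 * (α + 1) with hβ
  have hidx : ∀ q < r * r, ∀ l < r, q / r * r + l < r * r ∧ l * r + q % r < r * r := by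
    intro q hq l hl
    have h1 : q / r + 1 ≤ r := Nat.div_lt_of_lt_mul hq
    have h2 : q % r < r := Nat.mod_lt _ (by omega)
    constructor <;> nlinarith
  have step1 : ∀ k, (faddeev r F k).2.natAbs ≤ β ^ k →
      (∀ q < r * r, ((faddeev r F k).1 q).natAbs ≤ β ^ k) →
      ∀ q < r * r, ∀ m ≤ r, ((faddeev r F k).2 * F q + ∑ l ∈ Finset.range m,
      F (q / r * r + l) * (faddeev r F k).1 (l * r + q % r)).natAbs ≤ (r + 1) * α * β ^ k := by
    intro k hc hT q hq m hm
    refine (Int.natAbs_add_le _ _).trans ?_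
    have h1 : ((faddeev r F k).2 * F q).natAbs ≤ α * β ^ k := by
      rw [Int.natAbs_mul, mul_comm]
      exact Nat.mul_le_mul (hF q hq) hc
    have h2 : (∑ l ∈ Finset.range m,
        F (q / r * r + l) * (faddeev r F k).1 (l * r + q % r)).natAbs ≤ m * (α * β ^ k) := by
      refine (Int.natAbs_sum_le _ _).trans ?_
      refine (Finset.sum_le_card_nsmul _ _ (α * β ^ k) fun l hl => ?_).trans (by simp)
      have hl' := hidx q hq l ((Finset.mem_range.1 hl).trans_le hm)
      rw [Int.natAbs_mul]
      exact Nat.mul_le_mul (hF _ hl'.1) (hT _ hl'.2)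
    calc _ ≤ α * β ^ k + m * (α * β ^ k) := Nat.add_le_add h1 h2
      _ ≤ α * β ^ k + r * (α * β ^ k) := by gcongr
      _ = _ := by ring
  have step2 : ∀ k, (∀ q < r * r, ∀ m ≤ r, ((faddeev r F k).2 * F q + ∑ l ∈ Finset.range m,
      F (q / r * r + l) * (faddeev r F k).1 (l * r + q % r)).natAbs ≤ (r + 1) * α * β ^ k) →
      ∀ m ≤ r, (∑ l ∈ Finset.range m, (faddeev r F (k + 1)).1 (l * r + l)).natAbs ≤
        β ^ (k + 1) := by
    intro k h m hm
    refine (Int.natAbs_sum_le _ _).trans ?_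
    refine (Finset.sum_le_card_nsmul _ _ ((r + 1) * α * β ^ k) fun l hl => ?_).trans ?_
    · have hl' := (Finset.mem_range.1 hl).trans_le hm
      exact h _ (by nlinarith) r le_rfl
    · rw [Finset.card_range, smul_eq_mul, pow_succ, hβ]
      calc m * ((r + 1) * α * ((r + 1) ^ 2 * (α + 1)) ^ k)
          ≤ (r + 1) * ((r + 1) * (α + 1) * ((r + 1) ^ 2 * (α + 1)) ^ k) := by
            gcongr <;> omega
        _ = _ := by ring
  have hle : ∀ k, (r + 1) * α * β ^ k ≤ β ^ (k + 1) := by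
    intro k
    rw [pow_succ, mul_comm (β ^ k), hβ]
    gcongr
    · nlinarith
    · omega
  have main : ∀ k, (faddeev r F k).2.natAbs ≤ β ^ k ∧
      ∀ q < r * r, ((faddeev r F k).1 q).natAbs ≤ β ^ k := by
    intro k
    induction k with
    | zero => simp [faddeev]
    | succ k ih =>
      have h1 := step1 k ih.1 ih.2
      refine ⟨?_, fun q hq => (h1 q hq r le_rfl).trans (hle k)⟩
      refine (Int.natAbs_ediv_le_natAbs _ _).trans ?_
      rw [zero_sub, Int.natAbs_neg]
      exact step2 k h1 r le_rfl
  have h1 := step1 k (main k).1 (main k).2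
  exact ⟨(main k).1, (main k).2, fun q hq m hm => (h1 q hq m hm).trans (hle k), step2 k h1⟩

/-- Array `6` keeps the iterates in consecutive layers of `r * r` cells. Round `k` reads layer `k`
and writes layer `k + 1`, so no cell that is still needed gets overwritten. -/
theorem runs_faddeevRound {s : Store} {r k : ℕ} {F : ℕ → ℤ} (hb : 1 ≤ b) (hXb : X ≤ 2 ^ b)
    (hr : s.reg 1 = r) (hk : s.reg 16 = k) (hrX : r ≤ X) (hrrX : r * r ≤ X)
    (hF : ∀ q < r * r, s.mem 5 q = F q) (hc : s.reg 8 = (faddeev r F k).2)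
    (hT : ∀ q < r * r, s.mem 6 ((k * (r * r) + q : ℕ) : ℤ) = (faddeev r F k).1 q)
    (hsum : ∀ q < r * r, ∀ m ≤ r, ((faddeev r F k).2 * F q + ∑ l ∈ Finset.range m,
      F (q / r * r + l) * (faddeev r F k).1 (l * r + q % r)).natAbs ≤ 2 ^ b)
    (htr : ∀ m ≤ r, (∑ l ∈ Finset.range m, (faddeev r F (k + 1)).1 (l * r + l)).natAbs ≤ 2 ^ b) :
    Runs O ω b X (faddeevRound : Program d) s fun s' =>
      s'.reg 8 = (faddeev r F (k + 1)).2 ∧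
      (∀ q < r * r, s'.mem 6 (((k + 1) * (r * r) + q : ℕ) : ℤ) = (faddeev r F (k + 1)).1 q) ∧
      ∀ q < r * r, s'.mem 6 q = s.mem 6 q := by
  have hidx : ∀ q < r * r, ∀ l < r, q / r * r + l < r * r ∧ l * r + q % r < r * r := by
    intro q hq l hl
    have h1 : q / r + 1 ≤ r := Nat.div_lt_of_lt_mul hq
    have h2 : q % r < r := Nat.mod_lt _ (by omega)
    constructor <;> nlinarith
  refine .seq (.forLoop (N := r * r) hb hrrX hXb rfl (fun m s' =>
    (∀ q < m, s'.mem 6 (((k + 1) * (r * r) + q : ℕ) : ℤ) = (faddeev r F (k + 1)).1 q) ∧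
    ∀ q < (k + 1) * (r * r), s'.mem 6 q = s.mem 6 q) (by simp) ?_ ?_ ?_)
  · intro m _ s' hf _ _
    have h1 := (hf.reg 1 rfl).trans hr
    simp only [eval_mul, eval_reg, h1]
    exact_mod_cast Int.toNat_natCast (r * r)
  · intro q hq s' _ hf hiq ⟨hI, hI'⟩
    have h1 := (hf.reg 1 rfl).trans hr
    have h16 := (hf.reg 16 rfl).trans hk
    have h8 := (hf.reg 8 rfl).trans hc
    have m5 := hf.mem 5 rfl
    refine .seq (.fold hb r (fun m => (faddeev r F k).2 * F q + ∑ l ∈ Finset.range m,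
      F (q / r * r + l) * (faddeev r F k).1 (l * r + q % r)) (by decide) hrX hXb (hsum q hq)
      (by simp [h8, hiq, m5, hF q hq]) (by simp [h1]) ?_ ?_)
    · intro l hl
      obtain ⟨hl1, hl2⟩ := hidx q hq l hl
      have e1 := hF _ hl1
      have e2 := hT _ hl2
      rw [← hI' _ (by nlinarith)] at e2
      push_cast at e1 e2
      simp [h1, h16, hiq, m5, e1, e2, Finset.sum_range_succ, add_assoc]
    · refine .store hb (by simpa using hsum q hq r le_rfl) ?_
      have hix : (((reg 16 + lit 1) * (reg 1 * reg 1) + reg 14).eval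
          ((s'.setReg 20 ((faddeev r F k).2 * F q + ∑ l ∈ Finset.range r,
            F (q / r * r + l) * (faddeev r F k).1 (l * r + q % r))).setReg 15 r)) =
          (((k + 1) * (r * r) + q : ℕ) : ℤ) := by
        simp [h16, h1, hiq]
      rw [hix]
      refine ⟨fun p hp => ?_, fun p hp => ?_⟩
      · rcases Nat.lt_succ_iff_lt_or_eq.1 hp with hp' | rfl
        · have : (((k + 1) * (r * r) + p : ℕ) : ℤ) ≠ (((k + 1) * (r * r) + q : ℕ) : ℤ) := by
            norm_cast
            omega
          simp only [Store.setReg_mem, Store.setMem_mem, if_true, Function.update_of_ne this]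
          exact hI p hp'
        · simp only [Store.setReg_mem, Store.setMem_mem, if_true, Function.update_self]
          simp [faddeev]
      · have : ((p : ℕ) : ℤ) ≠ (((k + 1) * (r * r) + q : ℕ) : ℤ) := by
          norm_cast
          omega
        simp only [Store.setReg_mem, Store.setMem_mem, if_true, Function.update_of_ne this]
        exact hI' p hp
  · intro s' _ hf _ ⟨hI, hI'⟩
    have h1 := (hf.reg 1 rfl).trans hr
    have h16 := (hf.reg 16 rfl).trans hk
    refine .seq (.fold hb r (fun m => ∑ l ∈ Finset.range m, (faddeev r F (k + 1)).1 (l * r + l))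
      (by decide) hrX hXb htr (by simp) (by simp [h1]) ?_ ?_)
    · intro l hl
      have e1 := hI (l * r + l) (by nlinarith)
      push_cast at e1
      simp [h1, h16, e1, Finset.sum_range_succ]
    · have hev : ((lit 0 - reg 20) / (reg 16 + lit 1)).eval ((s'.setReg 20
          (∑ l ∈ Finset.range r, (faddeev r F (k + 1)).1 (l * r + l))).setReg 15 r) =
          (faddeev r F (k + 1)).2 := by
        simp [h16, faddeev]
      refine .set hb ?_ ?_
      · rw [hev]
        refine (Int.natAbs_ediv_le_natAbs _ _).trans ?_
        rw [zero_sub, Int.natAbs_neg]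
        exact htr r le_rfl
      · rw [hev]
        refine ⟨by simp, by simpa using hI, fun q hq => ?_⟩
        simpa using hI' q (by nlinarith)

/-- The zero iterate is read from layer 0 of array `6`. That layer is never written, and its being
zero is part of the conclusion so that the program can be run again on the same store. -/
theorem runs_detProgram {s : Store} {n r α : ℕ} (hb : 1 ≤ b) (hXb : X ≤ 2 ^ b)
    (hn : s.reg 0 = n) (hr : s.reg 1 = r) (hnX : n ≤ X) (hrX : r ≤ X) (hrrX : r * r ≤ X)
    (hα : ∀ q < r * r, ∀ k ≤ n, (productEntry n r s q k).natAbs ≤ α)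
    (hαb : ((r + 1) ^ 2 * (α + 1)) ^ (r + 1) ≤ 2 ^ b) (h6 : ∀ q < r * r, s.mem 6 (q : ℕ) = 0) :
    Runs O ω b X (detProgram : Program d) s fun s' =>
      s'.reg 8 = (faddeev r (fun q => productEntry n r s q n) r).2 ∧
      ∀ q < r * r, s'.mem 6 (q : ℕ) = 0 := by
  set F := fun q => productEntry n r s q n with hFdef
  have hpos : 1 ≤ (r + 1) ^ 2 * (α + 1) := Nat.mul_pos (by positivity) (by omega)
  have hpow : ∀ k, k ≤ r + 1 → ((r + 1) ^ 2 * (α + 1)) ^ k ≤ 2 ^ b := fun k hk =>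
    (Nat.pow_le_pow_right hpos hk).trans hαb
  have hαb' : α ≤ 2 ^ b := by
    refine le_trans ?_ (hpow 1 (by omega))
    rw [pow_one]
    nlinarith [Nat.zero_le (r ^ 2 + 2 * r)]
  have hFα : ∀ q < r * r, (F q).natAbs ≤ α := fun q hq => hα q hq n le_rfl
  refine .seq ((runs_productProgram hb hXb hn hr hnX hrrX
    fun q hq k hk => (hα q hq k hk).trans hαb').conseq fun s₁ _ hf₁ h5 => ?_)
  refine .seq (.set hb (by simp [Nat.one_le_two_pow]) ?_)
  refine .forLoop (N := r) hb hrX hXb rfl (fun k s' => s'.reg 8 = (faddeev r F k).2 ∧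
    (∀ q < r * r, s'.mem 6 ((k * (r * r) + q : ℕ) : ℤ) = (faddeev r F k).1 q) ∧
    ∀ q < r * r, s'.mem 6 (q : ℕ) = 0) ?_ ?_ ?_ ?_
  · have m6 := hf₁.mem 6 rfl
    refine ⟨by simp [faddeev], fun q hq => ?_, fun q hq => ?_⟩
    · simpa [faddeev, m6] using h6 q hq
    · simpa [m6] using h6 q hq
  · intro k _ s' hf _ _
    have h1 := hf.reg 1 rfl
    have h1' := hf₁.reg 1 rfl
    simp [h1, h1', hr]
  · intro k hk s' _ hf h16 ⟨hc, hT, h0⟩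
    have h1 : s'.reg 1 = r := by
      rw [hf.reg 1 rfl, Store.setReg_reg, if_neg (by decide), hf₁.reg 1 rfl, hr]
    have h5' : ∀ q < r * r, s'.mem 5 q = F q := fun q hq => by
      rw [hf.mem 5 rfl]
      exact h5 q hq
    obtain ⟨-, -, b1, b2⟩ := natAbs_faddeev_le hFα k
    refine (runs_faddeevRound hb hXb h1 h16 hrX hrrX h5' hc hT
      (fun q hq m hm => (b1 q hq m hm).trans (hpow _ (by omega)))
      (fun m hm => (b2 m hm).trans (hpow _ (by omega)))).conseq ?_
    rintro s'' - - ⟨g1, g2, g3⟩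
    refine ⟨by simpa using g1, g2, fun q hq => ?_⟩
    exact (g3 q hq).trans (h0 q hq)
  · rintro s' - - - ⟨hc, -, h0⟩
    exact ⟨hc, h0⟩

end

section

open MatroidIntersection.Program MatroidIntersection.Expr

variable {d n r : ℕ}

/-! ### The parameters of the algorithm -/

/-- The sum of the squares of the first `N` cells of an array. -/
def sumSq (m : ℤ → ℤ) (N : ℕ) : ℕ := ∑ k ∈ Finset.range N, (m k).natAbs * (m k).natAbs

theorem sumSq_mono (m : ℤ → ℤ) {k N : ℕ} (h : k ≤ N) : sumSq m k ≤ sumSq m N :=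
  Finset.sum_le_sum_of_subset (Finset.range_mono h)

/-- An integer is bounded in absolute value by its square, so a sum of squares is a bound on all
entries that the machine computes without sign tests. It stays polynomial in the largest entry. -/
theorem natAbs_le_sumSq (m : ℤ → ℤ) {k N : ℕ} (h : k < N) : (m k).natAbs ≤ sumSq m N :=
  (Nat.le_mul_self _).trans (Finset.single_le_sum
    (f := fun k : ℕ => (m k).natAbs * (m k).natAbs) (fun _ _ => Nat.zero_le _)
    (Finset.mem_range.2 h))

theorem sumSq_succ (m : ℤ → ℤ) (k : ℕ) : (sumSq m (k + 1) : ℤ) = sumSq m k + m k * m k := by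
  rw [sumSq, Finset.sum_range_succ, Nat.cast_add]
  congr 1
  push_cast
  rw [← abs_mul, abs_mul_self]

theorem flat_lt {m n i j : ℕ} (hi : i < m) (hj : j < n) : i * n + j < m * n := by
  nlinarith

theorem natAbs_le_sumSq_rowMajor {m : ℕ} (A : Matrix (Fin m) (Fin n) ℤ) (i : Fin m) (j : Fin n) :
    (A i j).natAbs ≤ sumSq (rowMajor A) (m * n) := by
  rw [← rowMajor_apply A i j]
  exact_mod_cast natAbs_le_sumSq (rowMajor A) (flat_lt i.2 j.2)

/-- An upper bound on the weights. -/
def weightBound (W : Matrix (Fin d) (Fin n) ℤ) : ℕ := sumSq (rowMajor W) (d * n)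

/-- The base in which weight vectors are encoded as numbers. -/
def weightBase (W : Matrix (Fin d) (Fin n) ℤ) : ℕ := 2 * n * weightBound W + 1

/-- The weight of a column as a single number. -/
def weightCode (W : Matrix (Fin d) (Fin n) ℤ) (j : Fin n) : ℕ :=
  (colWeight W (weightBound W) (weightBase W) j d).toNat

/-- An upper bound on the entries of the two matrices and of the random point. -/
def entryBound (M₁ M₂ : Matrix (Fin r) (Fin n) ℤ) : ℕ :=
  (sumSq (rowMajor M₁) (r * n) + sumSq (rowMajor M₂) (r * n) + n + 2) * 2 ^ (3 * n + 1)

/-- An upper bound on the coefficients of the generating polynomial. -/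
def digitBound (M₁ M₂ : Matrix (Fin r) (Fin n) ℤ) : ℕ := entryBound M₁ M₂ ^ (6 * n + 4)

/-- The point at which the generating polynomial is evaluated. -/
def evalPoint (M₁ M₂ : Matrix (Fin r) (Fin n) ℤ) : ℕ := 2 * digitBound M₁ M₂ + 1

/-- An upper bound on the number of rounds of each loop. -/
def loopBound (W : Matrix (Fin d) (Fin n) ℤ) : ℕ :=
  d * n + n * n + 6 * n + 4 + d + weightBound W + weightBase W + weightBase W ^ d

/-- An upper bound on the absolute values of all numbers that occur. -/
def cellBound (M₁ M₂ : Matrix (Fin r) (Fin n) ℤ) (W : Matrix (Fin d) (Fin n) ℤ) : ℕ :=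
  (loopBound W + 2) * evalPoint M₁ M₂ ^ ((weightBase W ^ d + 3) * (n + 1))

section bounds

variable (M₁ M₂ : Matrix (Fin r) (Fin n) ℤ) (W : Matrix (Fin d) (Fin n) ℤ)

theorem weight_le (i : Fin d) (j : Fin n) : |W i j| ≤ weightBound W := by
  rw [← Int.natCast_natAbs]
  exact_mod_cast natAbs_le_sumSq_rowMajor W i j

theorem natCast_weightBase : (weightBase W : ℤ) = 2 * n * weightBound W + 1 := by
  simp [weightBase]

theorem natCast_weightCode (j : Fin n) :
    (weightCode W j : ℤ) = colWeight W (weightBound W) (weightBase W) j d :=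
  Int.toNat_of_nonneg (colWeight_nonneg (weight_le W) (natCast_weightBase W) (by positivity) j le_rfl)

theorem sum_weightCode_lt (B : Finset (Fin n)) : ∑ j ∈ B, weightCode W j < weightBase W ^ d := by
  have h := sum_colWeight_lt (weight_le W) (natCast_weightBase W) (by positivity) B
  simp only [← natCast_weightCode] at h
  exact_mod_cast h

theorem weightCode_lt (j : Fin n) : weightCode W j < weightBase W ^ d := by
  simpa using sum_weightCode_lt W {j}

theorem two_le_entryBound : 2 ≤ entryBound M₁ M₂ := by
  have : 1 ≤ 2 ^ (3 * n + 1) := Nat.one_le_two_pow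
  unfold entryBound
  nlinarith

theorem sumSq_add_le_entryBound :
    sumSq (rowMajor M₁) (r * n) + sumSq (rowMajor M₂) (r * n) + n + 2 ≤ entryBound M₁ M₂ :=
  Nat.le_mul_of_pos_right _ (by positivity)

theorem pow_le_entryBound : 2 ^ (3 * n + 1) ≤ entryBound M₁ M₂ :=
  Nat.le_mul_of_pos_left _ (by omega)

theorem entryBound_pow_le {k : ℕ} (hk : k ≤ 6 * n + 4) :
    entryBound M₁ M₂ ^ k ≤ digitBound M₁ M₂ :=
  Nat.pow_le_pow_right (by have := two_le_entryBound M₁ M₂; omega) hk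

theorem entryBound_le : entryBound M₁ M₂ ≤ digitBound M₁ M₂ := by
  simpa using entryBound_pow_le M₁ M₂ (k := 1) (by omega)

theorem one_le_evalPoint : 1 ≤ evalPoint M₁ M₂ := by
  unfold evalPoint
  omega

theorem evalPoint_pow_le_cellBound {k : ℕ} (hk : k ≤ (weightBase W ^ d + 3) * (n + 1)) :
    evalPoint M₁ M₂ ^ k ≤ cellBound M₁ M₂ W :=
  (Nat.pow_le_pow_right (one_le_evalPoint M₁ M₂) hk).trans (Nat.le_mul_of_pos_left _ (by omega))

theorem evalPoint_le_cellBound : evalPoint M₁ M₂ ≤ cellBound M₁ M₂ W := by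
  simpa using evalPoint_pow_le_cellBound M₁ M₂ W (k := 1) (Nat.mul_pos (by omega) (by omega))

theorem loopBound_le_cellBound : loopBound W ≤ cellBound M₁ M₂ W :=
  le_trans (by omega) (Nat.le_mul_of_pos_right (loopBound W + 2)
    (Nat.pos_of_ne_zero (pow_ne_zero _ (by have := one_le_evalPoint M₁ M₂; omega))))

end bounds

/-! ### Preparation -/

/-- Compute the parameters of the algorithm. -/
def setupProgram (d : ℕ) : Program d :=
  .seq (.fold 2 14 (lit 0) (lit d * reg 0) (reg 2 + load 2 (reg 14) * load 2 (reg 14)))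
  (.seq (.set 3 (lit 2 * reg 0 * reg 2 + lit 1))
  (.seq (.fold 6 14 (lit 1) (lit d) (reg 6 * reg 3))
  (.seq (.set 7 (lit 3 * reg 0 + lit 1))
  (.seq (.fold 10 14 (lit 0) (reg 1 * reg 0) (reg 10 + load 0 (reg 14) * load 0 (reg 14)))
  (.seq (.fold 10 14 (reg 10) (reg 1 * reg 0) (reg 10 + load 1 (reg 14) * load 1 (reg 14)))
  (.seq (.fold 11 14 (reg 10 + reg 0 + lit 2) (reg 7) (reg 11 * lit 2))
  (.seq (.fold 4 14 (lit 1) (lit 6 * reg 0 + lit 4) (reg 4 * reg 11))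
    (.set 5 (lit 2 * reg 4 + lit 1)))))))))

/-- The input and the parameters are in place. -/
structure Ready (M₁ M₂ : Matrix (Fin r) (Fin n) ℤ) (W : Matrix (Fin d) (Fin n) ℤ) (s : Store) :
    Prop where
  cols : s.reg 0 = n
  rank : s.reg 1 = r
  weight : s.reg 2 = weightBound W
  base : s.reg 3 = weightBase W
  digit : s.reg 4 = digitBound M₁ M₂
  point : s.reg 5 = evalPoint M₁ M₂
  codes : s.reg 6 = (weightBase W ^ d : ℕ)
  coins : s.reg 7 = (3 * n + 1 : ℕ)
  fst : s.mem 0 = rowMajor M₁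
  snd : s.mem 1 = rowMajor M₂
  weights : s.mem 2 = rowMajor W

/-- The conditions on `p` are closed Boolean computations, provable by `rfl` for the concrete
programs below. -/
theorem Ready.frame {M₁ M₂ : Matrix (Fin r) (Fin n) ℤ} {W : Matrix (Fin d) (Fin n) ℤ} {s s' : Store}
    {p : Program d} (h : Ready M₁ M₂ W s) (hf : Frame p s s')
    (hr : (List.range 8).all (fun x => !p.writesReg x) = true)
    (hm : (List.range 3).all (fun a => !p.writesMem a) = true) : Ready M₁ M₂ W s' := by
  have hr' : ∀ x < 8, s'.reg x = s.reg x := fun x hx => hf.reg x (by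
    simpa using List.all_eq_true.1 hr x (List.mem_range.2 hx))
  have hm' : ∀ a < 3, s'.mem a = s.mem a := fun a ha => hf.mem a (by
    simpa using List.all_eq_true.1 hm a (List.mem_range.2 ha))
  constructor
  · rw [hr' 0 (by norm_num), h.cols]
  · rw [hr' 1 (by norm_num), h.rank]
  · rw [hr' 2 (by norm_num), h.weight]
  · rw [hr' 3 (by norm_num), h.base]
  · rw [hr' 4 (by norm_num), h.digit]
  · rw [hr' 5 (by norm_num), h.point]
  · rw [hr' 6 (by norm_num), h.codes]
  · rw [hr' 7 (by norm_num), h.coins]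
  · rw [hm' 0 (by norm_num), h.fst]
  · rw [hm' 1 (by norm_num), h.snd]
  · rw [hm' 2 (by norm_num), h.weights]

variable {O : (Fin d → ℤ) → (Fin d → ℤ) → Bool} {ω : ℕ → Bool} {b : ℕ}
  {M₁ M₂ : Matrix (Fin r) (Fin n) ℤ} {W : Matrix (Fin d) (Fin n) ℤ}

theorem runs_setupProgram (hb : 1 ≤ b) (hrn : r ≤ n) (hcb : cellBound M₁ M₂ W ≤ 2 ^ b) :
    Runs O ω b (loopBound W) (setupProgram d) (initialStore M₁ M₂ W) (Ready M₁ M₂ W) := by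
  have hXb := (loopBound_le_cellBound M₁ M₂ W).trans hcb
  have hYb := (evalPoint_le_cellBound M₁ M₂ W).trans hcb
  have hHY : digitBound M₁ M₂ ≤ evalPoint M₁ M₂ := by unfold evalPoint; omega
  have hcH := entryBound_le M₁ M₂
  have hac := sumSq_add_le_entryBound M₁ M₂
  have hrn' : r * n ≤ n * n := Nat.mul_le_mul_right _ hrn
  have hX : loopBound W = d * n + n * n + 6 * n + 4 + d + weightBound W + weightBase W +
    weightBase W ^ d := rfl
  have hD1 : 1 ≤ weightBase W := by unfold weightBase; omega
  refine .seq (.fold hb (d * n) (fun k => sumSq (rowMajor W) k) (by decide) (by omega) hXb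
    (fun k hk => ?_) (by simp [sumSq]) (fun k _ => ?_) (fun k _ => ?_) ?_)
  · have := sumSq_mono (rowMajor W) hk
    rw [Int.natAbs_natCast]
    change _ ≤ weightBound W at this
    omega
  · simp only [initialStore, eval_mul, eval_lit, eval_reg, Store.setReg_reg]
    exact_mod_cast Int.toNat_natCast (d * n)
  · simp [initialStore, sumSq_succ]
  refine .seq (.set hb ?_ ?_)
  · simp only [initialStore, eval_add, eval_mul, eval_lit, eval_reg, Store.setReg_reg]
    have : ((2 * n * weightBound W + 1 : ℕ) : ℤ).natAbs ≤ 2 ^ b := by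
      rw [Int.natAbs_natCast]
      change weightBase W ≤ _
      omega
    simpa [weightBound] using this
  refine .seq (.fold hb d (fun k => (weightBase W : ℤ) ^ k) (by decide) (by omega) hXb
    (fun k hk => ?_) (by simp) (by simp) (fun k _ => ?_) ?_)
  · have := Nat.pow_le_pow_right hD1 hk
    rw [Int.natAbs_pow, Int.natAbs_natCast]
    omega
  · simp [initialStore, weightBase, weightBound, pow_succ]
  refine .seq (.set hb ?_ ?_)
  · simp [initialStore]
    omega
  refine .seq (.fold hb (r * n) (fun k => sumSq (rowMajor M₁) k) (by decide) (by omega) hXb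
    (fun k hk => ?_) (by simp [sumSq]) (fun k _ => ?_) (fun k _ => ?_) ?_)
  · have := sumSq_mono (rowMajor M₁) hk
    rw [Int.natAbs_natCast]
    omega
  · simp only [initialStore, eval_mul, eval_reg, Store.setReg_reg]
    exact_mod_cast Int.toNat_natCast (r * n)
  · simp [initialStore, sumSq_succ]
  refine .seq (.fold hb (r * n)
    (fun k => (sumSq (rowMajor M₁) (r * n) : ℤ) + sumSq (rowMajor M₂) k) (by decide) (by omega) hXb
    (fun k hk => ?_) (by simp [sumSq]) (fun k _ => ?_) (fun k _ => ?_) ?_)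
  · have := sumSq_mono (rowMajor M₂) hk
    omega
  · simp only [initialStore, eval_mul, eval_reg, Store.setReg_reg]
    exact_mod_cast Int.toNat_natCast (r * n)
  · simp [initialStore, sumSq_succ, add_assoc]
  refine .seq (.fold hb (3 * n + 1) (fun k => ((sumSq (rowMajor M₁) (r * n) +
    sumSq (rowMajor M₂) (r * n) + n + 2) * 2 ^ k : ℕ)) (by decide) (by omega) hXb
    (fun k hk => ?_) (by simp [initialStore]) (fun k _ => ?_) (fun k _ => ?_) ?_)
  · have h1 : 2 ^ k ≤ 2 ^ (3 * n + 1) := Nat.pow_le_pow_right (by norm_num) hk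
    have := Nat.mul_le_mul_left
      (sumSq (rowMajor M₁) (r * n) + sumSq (rowMajor M₂) (r * n) + n + 2) h1
    change _ ≤ entryBound M₁ M₂ at this
    rw [Int.natAbs_natCast]
    omega
  · simp only [initialStore, eval_reg, Store.setReg_reg, eval_add, eval_mul, eval_lit]
    simp
    omega
  · simp [pow_succ, mul_assoc]
  refine .seq (.fold hb (6 * n + 4) (fun k => (entryBound M₁ M₂ ^ k : ℕ)) (by decide) (by omega) hXb
    (fun k hk => ?_) (by simp) (fun k _ => ?_) (fun k _ => ?_) ?_)
  · have := entryBound_pow_le M₁ M₂ hk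
    rw [Int.natAbs_natCast]
    omega
  · simp [initialStore]
    omega
  · simp [pow_succ, entryBound]
  refine .set hb ?_ ?_
  · have : ((evalPoint M₁ M₂ : ℕ) : ℤ).natAbs ≤ 2 ^ b := hYb
    simpa [evalPoint, digitBound] using this
  · constructor <;>
      simp [initialStore, weightBound, weightBase, evalPoint, digitBound, entryBound]

/-- Choose a random point, and store the numbers `x j * Y ^ z j`. -/
def sampleProgram (d : ℕ) : Program d :=
  .forLoop 13 (reg 0)
    (.seq (.set 20 (lit 0))
    (.seq (.forLoop 14 (reg 7) (.seq (.flip 21) (.set 20 (lit 2 * reg 20 + reg 21))))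
    (.seq (.fold 22 14 (lit 0) (lit d)
      (reg 22 * reg 3 + (load 2 (reg 14 * reg 0 + reg 13) + reg 2)))
    (.seq (.fold 23 14 (lit 1) (reg 22) (reg 23 * reg 5))
    (.seq (.store 4 (reg 13) (reg 20 * reg 23))
      (.store 3 (reg 13) (lit 1)))))))

/-- The random point. -/
def samplePoint (n : ℕ) (ω : ℕ → Bool) (j : Fin n) : ℤ := bits ω (j * (3 * n + 1)) (3 * n + 1)

/-- The input, the parameters and the point `x` are in place. -/
structure Sampled (M₁ M₂ : Matrix (Fin r) (Fin n) ℤ) (W : Matrix (Fin d) (Fin n) ℤ)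
    (x : Fin n → ℤ) (s : Store) : Prop where
  ready : Ready M₁ M₂ W s
  value : ∀ j : Fin n, s.mem 4 (j : ℕ) = x j * evalPoint M₁ M₂ ^ weightCode W j
  layer : ∀ q < r * r, s.mem 6 (q : ℕ) = 0

/-- Array `3` holds the characteristic vector of `S`. -/
def HoldsSet (S : Finset (Fin n)) (s : Store) : Prop :=
  ∀ j : Fin n, s.mem 3 (j : ℕ) = if j ∈ S then 1 else 0

theorem natAbs_sample_le (ω : ℕ → Bool) (t m : ℕ) (hm : m ≤ weightBase W ^ d) :
    (bits ω t (3 * n + 1) * (evalPoint M₁ M₂ : ℤ) ^ m).natAbs ≤ cellBound M₁ M₂ W := by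
  rw [Int.natAbs_mul, Int.natAbs_pow, Int.natAbs_natCast]
  have h1 : (bits ω t (3 * n + 1)).natAbs ≤ evalPoint M₁ M₂ := by
    have h1 := natAbs_bits_le ω t (3 * n + 1)
    have h2 := pow_le_entryBound M₁ M₂
    have h3 := entryBound_le M₁ M₂
    unfold evalPoint
    omega
  calc _ ≤ evalPoint M₁ M₂ * evalPoint M₁ M₂ ^ m := Nat.mul_le_mul_right _ h1
    _ = evalPoint M₁ M₂ ^ (m + 1) := by rw [pow_succ, mul_comm]
    _ ≤ _ := evalPoint_pow_le_cellBound M₁ M₂ W (by nlinarith)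

theorem runs_sampleProgram {s : Store} (hb : 1 ≤ b) (hcb : cellBound M₁ M₂ W ≤ 2 ^ b)
    (hs : Ready M₁ M₂ W s) (h6 : s.mem 6 = fun _ => 0) (hc : s.coins = 0) :
    Runs O ω b (loopBound W) (sampleProgram d) s fun s' =>
      Sampled M₁ M₂ W (samplePoint n ω) s' ∧ HoldsSet (Finset.univ : Finset (Fin n)) s' := by
  have hXb := (loopBound_le_cellBound M₁ M₂ W).trans hcb
  have hYb := (evalPoint_le_cellBound M₁ M₂ W).trans hcb
  have hX : loopBound W = d * n + n * n + 6 * n + 4 + d + weightBound W + weightBase W +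
    weightBase W ^ d := rfl
  have hKY : 2 ^ (3 * n + 1) ≤ evalPoint M₁ M₂ := by
    have h2 := pow_le_entryBound M₁ M₂
    have h3 := entryBound_le M₁ M₂
    unfold evalPoint
    omega
  have hD1 : 1 ≤ weightBase W := by unfold weightBase; omega
  -- Counting the consumed coins shows that column `k` uses the block that starts at `k * (3 * n +
  -- 1)`, as in `samplePoint`.
  refine .forLoop (N := n) hb (by omega) hXb rfl (fun k s' => s'.coins = k * (3 * n + 1) ∧
    (∀ j : Fin n, (j : ℕ) < k →
      s'.mem 4 (j : ℕ) = samplePoint n ω j * evalPoint M₁ M₂ ^ weightCode W j) ∧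
    ∀ j : Fin n, (j : ℕ) < k → s'.mem 3 (j : ℕ) = 1) (by simp [hc]) ?_ ?_ ?_
  · intro k _ s' hf _ _
    simp [hf.reg 0 rfl, hs.cols]
  · intro k hk s' _ hf hik ⟨hco, hv, h3⟩
    have hs' := hs.frame hf rfl rfl
    refine .seq (.set hb (by simp) ?_)
    refine .seq (.forLoop (N := 3 * n + 1) hb (by omega) hXb rfl (fun i s'' =>
      s''.reg 20 = bits ω (k * (3 * n + 1)) i ∧ s''.coins = k * (3 * n + 1) + i)
      (by simp [bits, hco]) ?_ ?_ ?_)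
    · intro i _ s'' hf' _ _
      simp only [eval_reg, hf'.reg 7 rfl, Store.setReg_reg]
      simp only [show (7 : ℕ) ≠ 20 by decide, if_false, hs'.coins, Int.toNat_natCast]
    · rintro i hi s'' - - - ⟨h20, hco'⟩
      have hbit : bits ω (k * (3 * n + 1)) (i + 1) = 2 * bits ω (k * (3 * n + 1)) i +
        (if ω (k * (3 * n + 1) + i) then 1 else 0) := rfl
      refine .seq (.flip (.set hb ?_ ?_))
      · have h1 := natAbs_bits_le ω (k * (3 * n + 1)) (i + 1)
        have h2 : 2 ^ (i + 1) ≤ 2 ^ (3 * n + 1) := Nat.pow_le_pow_right (by norm_num) (by omega)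
        have h4 := (h1.trans h2).trans (hKY.trans hYb)
        rw [hbit] at h4
        simpa [h20, hco'] using h4
      · rw [hbit]
        simp [h20, hco', add_assoc]
    · intro s₂ _ hf₂ _ ⟨h20, hco₂⟩
      have hs₁ : Ready M₁ M₂ W (s'.setReg 20 ((lit 0).eval s')) :=
        hs'.frame (Exec.set (O := O) (ω := ω) s' 20 (lit 0)).frame rfl rfl
      have hs₂ := hs₁.frame hf₂ rfl rfl
      have hik₂ : s₂.reg 13 = k := by
        rw [hf₂.reg 13 rfl]
        simpa using hik
      have hw0 : (0 : ℤ) ≤ weightBound W := by positivity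
      refine .seq (.fold hb d (colWeight W (weightBound W) (weightBase W) k) (by decide) (by omega)
        hXb (fun i hi => ?_) (by simp [colWeight, horner]) (by simp) (fun i _ => ?_) ?_)
      · have h1 := colWeight_nonneg (weight_le W) (natCast_weightBase W) hw0 ⟨k, hk⟩ hi
        have h2 := colWeight_lt (weight_le W) (natCast_weightBase W) hw0 ⟨k, hk⟩ hi
        have h3 : weightBase W ^ i ≤ weightBase W ^ d := Nat.pow_le_pow_right hD1 hi
        have h4 : (colWeight W (weightBound W) (weightBase W) k i).natAbs < weightBase W ^ i := by
          zify
          rw [abs_of_nonneg h1]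
          exact h2
        omega
      · simp [hik₂, hs₂.base, hs₂.cols, hs₂.weights, hs₂.weight, colWeight, horner]
      rw [← natCast_weightCode W ⟨k, hk⟩]
      have hz := weightCode_lt W ⟨k, hk⟩
      -- The power is formed by one multiplication per unit of the exponent. This is affordable
      -- since the exponent is below `weightBase W ^ d`, which is polynomial in `n` and the largest
      -- weight for fixed `d`.
      refine .seq (.fold hb (weightCode W ⟨k, hk⟩) (fun i => (evalPoint M₁ M₂ : ℤ) ^ i) (by decide)
        (by omega) hXb (fun i hi => ?_) (by simp) (by simp) (fun i _ => ?_) ?_)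
      · rw [Int.natAbs_pow, Int.natAbs_natCast]
        exact (evalPoint_pow_le_cellBound M₁ M₂ W (by nlinarith)).trans hcb
      · simp [hs₂.point, pow_succ]
      refine .seq (.store hb ?_ (.store hb ?_ ?_))
      · simp only [eval_mul, eval_reg, Store.setReg_reg]
        simpa [h20] using (natAbs_sample_le ω (k * (3 * n + 1)) _ hz.le).trans hcb
      · simp [Nat.one_le_two_pow]
      · have m4 := hf₂.mem 4 rfl
        have m3 := hf₂.mem 3 rfl
        refine ⟨?_, fun j hj => ?_, fun j hj => ?_⟩
        · simp [hco₂]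
          ring
        · rcases Nat.lt_succ_iff_lt_or_eq.1 hj with hj' | hj'
          · have hne : ((j : ℕ) : ℤ) ≠ k := by exact_mod_cast hj'.ne
            simp [hik₂, hne, m4, hv j hj']
          · obtain rfl : j = ⟨k, hk⟩ := Fin.ext hj'
            simp [hik₂, h20, samplePoint]
        · rcases Nat.lt_succ_iff_lt_or_eq.1 hj with hj' | hj'
          · have hne : ((j : ℕ) : ℤ) ≠ k := by exact_mod_cast hj'.ne
            simp [hik₂, hne, m3, h3 j hj']
          · obtain rfl : j = ⟨k, hk⟩ := Fin.ext hj'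
            simp [hik₂]
  · rintro s' - hf - ⟨-, hv, h3⟩
    refine ⟨⟨hs.frame hf rfl rfl, fun j => hv j j.2, fun q _ => ?_⟩, fun j => ?_⟩
    · rw [hf.mem 6 rfl, h6]
    · simpa using h3 j j.2

end

section

open Matrix MatroidIntersection.Program MatroidIntersection.Expr

variable {d n r : ℕ} {O : (Fin d → ℤ) → (Fin d → ℤ) → Bool} {ω : ℕ → Bool} {b : ℕ}
  {M₁ M₂ : Matrix (Fin r) (Fin n) ℤ} {W : Matrix (Fin d) (Fin n) ℤ} {x : Fin n → ℤ}

/-! ### Evaluation of the generating polynomial -/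

/-- The generating polynomial, evaluated by the program. -/
def genValue (M₁ M₂ : Matrix (Fin r) (Fin n) ℤ) (W : Matrix (Fin d) (Fin n) ℤ) (x : Fin n → ℤ)
    (S : Finset (Fin n)) : ℤ :=
  (-1) ^ r * (M₁ * diagonal (fun j => (if j ∈ S then 1 else 0) *
    (x j * (evalPoint M₁ M₂ : ℤ) ^ weightCode W j)) * M₂ᵀ).det

theorem genValue_eq_sum (S : Finset (Fin n)) : genValue M₁ M₂ W x S =
    ∑ k ∈ Finset.range (weightBase W ^ d),
      ((-1) ^ r * gcoeff M₁ M₂ (weightCode W) x S k) * (evalPoint M₁ M₂ : ℤ) ^ k := by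
  rw [genValue, det_eq_sum_gcoeff (sum_weightCode_lt W), Finset.mul_sum]
  exact Finset.sum_congr rfl fun k _ => by ring

/-- Signed coefficients are bounded by `digitBound`, so they are the balanced digits of the computed
value. The sign `(-1) ^ r` left over from the characteristic polynomial does not affect which digits
vanish. -/
theorem digit_eq_iff (hrn : r ≤ n) (hx : ∀ j, (x j).natAbs ≤ 2 ^ (3 * n + 1))
    (S : Finset (Fin n)) {k : ℕ} (hk : k < weightBase W ^ d) :
    (shifts (digitBound M₁ M₂) (evalPoint M₁ M₂) (genValue M₁ M₂ W x S) k + digitBound M₁ M₂) %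
      (evalPoint M₁ M₂ : ℤ) = digitBound M₁ M₂ ↔ gcoeff M₁ M₂ (weightCode W) x S k = 0 := by
  rw [shifts_emod_eq_iff (g := fun k => (-1) ^ r * gcoeff M₁ M₂ (weightCode W) x S k)
    (by simp [evalPoint]) (fun k => ?_) (genValue_eq_sum S) hk]
  · simp
  · rw [abs_mul, abs_neg_one_pow, one_mul, ← Int.natCast_natAbs]
    exact_mod_cast natAbs_gcoeff_le
      (a := sumSq (rowMajor M₁) (r * n) + sumSq (rowMajor M₂) (r * n))
      (fun i j => (natAbs_le_sumSq_rowMajor M₁ i j).trans (by omega))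
      (fun i j => (natAbs_le_sumSq_rowMajor M₂ i j).trans (by omega)) hrn hx S k

/-- A bound on the entries of the product matrix. -/
def productBound (M₁ M₂ : Matrix (Fin r) (Fin n) ℤ) (W : Matrix (Fin d) (Fin n) ℤ) : ℕ :=
  evalPoint M₁ M₂ ^ (weightBase W ^ d + 1)

theorem natAbs_productEntry_le {s : Store} (hs : Sampled M₁ M₂ W x s) {S : Finset (Fin n)}
    (hS : HoldsSet S s) (hx : ∀ j, (x j).natAbs ≤ 2 ^ (3 * n + 1)) {q : ℕ} (hq : q < r * r) {k : ℕ}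
    (hk : k ≤ n) : (productEntry n r s q k).natAbs ≤ productBound M₁ M₂ W := by
  have hr : 0 < r := Nat.pos_of_ne_zero (by rintro rfl; simp at hq)
  have h1 : q / r < r := Nat.div_lt_of_lt_mul hq
  have h2 : q % r < r := Nat.mod_lt _ hr
  set c := entryBound M₁ M₂ with hc
  have hac := sumSq_add_le_entryBound M₁ M₂
  have hKc := pow_le_entryBound M₁ M₂
  have hY := one_le_evalPoint M₁ M₂
  refine (Int.natAbs_sum_le _ _).trans ?_
  refine (Finset.sum_le_card_nsmul _ _ (c * (c * evalPoint M₁ M₂ ^ (weightBase W ^ d)) * c)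
    fun j hj => ?_).trans ?_
  · have hj' : j < n := (Finset.mem_range.1 hj).trans_le hk
    rw [Int.natAbs_mul, Int.natAbs_mul, Int.natAbs_mul, hs.ready.fst, hs.ready.snd]
    have e3 : (s.mem 3 j).natAbs ≤ 1 := by
      rw [hS ⟨j, hj'⟩]
      split_ifs <;> simp
    have e4 : (s.mem 4 j).natAbs ≤ c * evalPoint M₁ M₂ ^ (weightBase W ^ d) := by
      rw [hs.value ⟨j, hj'⟩, Int.natAbs_mul, Int.natAbs_pow, Int.natAbs_natCast]
      exact Nat.mul_le_mul ((hx _).trans hKc) (Nat.pow_le_pow_right hY (weightCode_lt W _).le)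
    have e1 := natAbs_le_sumSq (rowMajor M₁) (flat_lt h1 hj')
    have e2 := natAbs_le_sumSq (rowMajor M₂) (flat_lt h2 hj')
    refine Nat.mul_le_mul (Nat.mul_le_mul (e1.trans (by omega)) ?_) (e2.trans (by omega))
    calc _ ≤ 1 * (c * evalPoint M₁ M₂ ^ (weightBase W ^ d)) := Nat.mul_le_mul e3 e4
      _ = _ := one_mul _
  · rw [Finset.card_range, smul_eq_mul, productBound]
    -- The four factors bound the number of summands, an entry of each matrix, and a coordinate of
    -- the random point.
    have hc4 : c ^ 4 ≤ evalPoint M₁ M₂ := by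
      have : c ^ 4 ≤ digitBound M₁ M₂ := entryBound_pow_le M₁ M₂ (by omega)
      unfold evalPoint
      omega
    calc k * (c * (c * evalPoint M₁ M₂ ^ (weightBase W ^ d)) * c)
        ≤ c * (c * (c * evalPoint M₁ M₂ ^ (weightBase W ^ d)) * c) :=
          Nat.mul_le_mul_right _ (by omega)
      _ = c ^ 4 * evalPoint M₁ M₂ ^ (weightBase W ^ d) := by ring
      _ ≤ evalPoint M₁ M₂ * evalPoint M₁ M₂ ^ (weightBase W ^ d) := Nat.mul_le_mul_right _ hc4
      _ = _ := by rw [pow_succ, mul_comm]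

/-- One factor `evalPoint` absorbs `(r + 1) ^ 2` and another the `+ 1`; with the exponent
`weightBase W ^ d + 1` of `productBound` this explains the 3 in `cellBound`. -/
theorem productBound_pow_le (hrn : r ≤ n) :
    ((r + 1) ^ 2 * (productBound M₁ M₂ W + 1)) ^ (r + 1) ≤
      evalPoint M₁ M₂ ^ ((weightBase W ^ d + 3) * (n + 1)) := by
  have hY := one_le_evalPoint M₁ M₂
  have h1 : (r + 1) ^ 2 ≤ evalPoint M₁ M₂ := by
    have := entryBound_pow_le M₁ M₂ (k := 2) (by omega)
    have hac := sumSq_add_le_entryBound M₁ M₂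
    have : (r + 1) ^ 2 ≤ entryBound M₁ M₂ ^ 2 := Nat.pow_le_pow_left (by omega) 2
    unfold evalPoint
    omega
  have hY2 : 2 ≤ evalPoint M₁ M₂ := by
    have := entryBound_le M₁ M₂
    have := two_le_entryBound M₁ M₂
    unfold evalPoint
    omega
  have h2 : productBound M₁ M₂ W + 1 ≤ evalPoint M₁ M₂ * productBound M₁ M₂ W := by
    have : 1 ≤ productBound M₁ M₂ W := Nat.one_le_pow _ _ hY
    nlinarith
  calc _ ≤ (evalPoint M₁ M₂ * (evalPoint M₁ M₂ * productBound M₁ M₂ W)) ^ (r + 1) := by gcongr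
    _ = evalPoint M₁ M₂ ^ ((weightBase W ^ d + 3) * (r + 1)) := by
      rw [productBound]
      ring
    _ ≤ _ := Nat.pow_le_pow_right hY (by gcongr)

theorem faddeev_productEntry {s : Store} (hs : Sampled M₁ M₂ W x s) {S : Finset (Fin n)}
    (hS : HoldsSet S s) :
    (faddeev r (fun q => productEntry n r s q n) r).2 = genValue M₁ M₂ W x S := by
  refine faddeev_eq_det _ fun i k => ?_
  rw [productEntry, flat_div, flat_mod, Finset.sum_range (fun j => s.mem 0 ((i * n + j : ℕ) : ℤ) *
    (s.mem 3 j * s.mem 4 j) * s.mem 1 ((k * n + j : ℕ) : ℤ)), mul_apply]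
  refine Finset.sum_congr rfl fun j _ => ?_
  rw [mul_diagonal, transpose_apply, hs.ready.fst, hs.ready.snd, hs.value j, hS j]
  push_cast
  rw [rowMajor_apply, rowMajor_apply]

theorem runs_detProgram_of_sampled {s : Store} (hb : 1 ≤ b) (hrn : r ≤ n)
    (hcb : cellBound M₁ M₂ W ≤ 2 ^ b) (hx : ∀ j, (x j).natAbs ≤ 2 ^ (3 * n + 1))
    (hs : Sampled M₁ M₂ W x s) {S : Finset (Fin n)} (hS : HoldsSet S s) :
    Runs O ω b (loopBound W) (detProgram : Program d) s fun s' =>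
      s'.reg 8 = genValue M₁ M₂ W x S ∧ Sampled M₁ M₂ W x s' ∧ HoldsSet S s' := by
  have hXb := (loopBound_le_cellBound M₁ M₂ W).trans hcb
  have hX : loopBound W = d * n + n * n + 6 * n + 4 + d + weightBound W + weightBase W +
    weightBase W ^ d := rfl
  have hrr : r * r ≤ n * n := Nat.mul_le_mul hrn hrn
  refine (runs_detProgram hb hXb hs.ready.cols hs.ready.rank (by omega) (by omega) (by omega)
    (fun q hq k hk => natAbs_productEntry_le hs hS hx hq hk)
    ((productBound_pow_le hrn).trans ((evalPoint_pow_le_cellBound M₁ M₂ W le_rfl).trans hcb))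
    hs.layer).conseq ?_
  rintro s' - hf ⟨h8, h6⟩
  refine ⟨h8.trans (faddeev_productEntry hs hS), ⟨hs.ready.frame hf rfl rfl, fun j => ?_, h6⟩,
    fun j => ?_⟩
  · rw [hf.mem 4 rfl, hs.value]
  · rw [hf.mem 3 rfl, hS]

theorem natAbs_genValue_le {s : Store} (hrn : r ≤ n) (hx : ∀ j, (x j).natAbs ≤ 2 ^ (3 * n + 1))
    (hs : Sampled M₁ M₂ W x s) {S : Finset (Fin n)} (hS : HoldsSet S s) :
    (genValue M₁ M₂ W x S).natAbs ≤ evalPoint M₁ M₂ ^ ((weightBase W ^ d + 3) * (n + 1)) := by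
  rw [← faddeev_productEntry hs hS]
  have h := (natAbs_faddeev_le (fun q hq => natAbs_productEntry_le hs hS hx hq le_rfl) r).1
  refine h.trans (le_trans (Nat.pow_le_pow_right ?_ (Nat.le_succ r)) (productBound_pow_le hrn))
  exact Nat.mul_pos (by positivity) (by omega)

/-- Up to `loopBound W` additions of the offset, one further offset, and the value itself are each
at most the same power of `evalPoint`; this is the factor `loopBound W + 2` in `cellBound`. -/
theorem natAbs_shifts_genValue_le {s : Store} (hrn : r ≤ n)
    (hx : ∀ j, (x j).natAbs ≤ 2 ^ (3 * n + 1)) (hs : Sampled M₁ M₂ W x s) {S : Finset (Fin n)}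
    (hS : HoldsSet S s) {k : ℕ} (hk : k ≤ weightBase W ^ d) :
    (shifts (digitBound M₁ M₂) (evalPoint M₁ M₂) (genValue M₁ M₂ W x S) k).natAbs +
      digitBound M₁ M₂ ≤ cellBound M₁ M₂ W := by
  have h1 := natAbs_shifts_le (H := digitBound M₁ M₂) (Y := evalPoint M₁ M₂)
    (V := genValue M₁ M₂ W x S) k
  have h2 := natAbs_genValue_le hrn hx hs hS
  have hY := one_le_evalPoint M₁ M₂
  set E := (weightBase W ^ d + 3) * (n + 1)
  have h3 : digitBound M₁ M₂ ≤ evalPoint M₁ M₂ ^ E := by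
    refine le_trans (by unfold evalPoint; omega)
      (Nat.pow_le_pow_right hY (show 1 ≤ E from Nat.mul_pos (by omega) (by omega)) |>.trans'
        (pow_one _).ge)
  rw [Int.natAbs_natCast] at h1
  have h4 : k ≤ loopBound W := hk.trans (by unfold loopBound; omega)
  calc _ ≤ evalPoint M₁ M₂ ^ E + k * digitBound M₁ M₂ + digitBound M₁ M₂ := by omega
    _ ≤ evalPoint M₁ M₂ ^ E + loopBound W * evalPoint M₁ M₂ ^ E + evalPoint M₁ M₂ ^ E := by gcongr
    _ = _ := by
      rw [cellBound]
      ring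

/-! ### The search for the best weight -/

/-- Divide `t` times by the base. -/
def divs : ℕ → Expr → Expr
  | 0, e => e
  | t + 1, e => divs t (e / reg 3)

theorem eval_divs (s : Store) (t : ℕ) (e : Expr) :
    (divs t e).eval s = (· / s.reg 3)^[t] (e.eval s) := by
  induction t generalizing e with
  | zero => rfl
  | succ t ih => rw [divs, ih, Function.iterate_succ_apply, eval_div, eval_reg]

/-- The weight vector whose number is in register `y`. -/
def decodeExpr (y : ℕ) (i : Fin d) : Expr :=
  divs (d - 1 - i) (reg y) % reg 3 - reg 1 * reg 2

/-- The weight vector with number `k`. -/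
def decode (r : ℕ) (W : Matrix (Fin d) (Fin n) ℤ) (k : ℤ) (i : Fin d) : ℤ :=
  ((· / (weightBase W : ℤ))^[d - 1 - i] k) % weightBase W - r * weightBound W

theorem eval_decodeExpr {s : Store} (hs : Ready M₁ M₂ W s) (y : ℕ) :
    (fun i => (decodeExpr y i : Expr).eval s) = decode r W (s.reg y) := by
  funext i
  simp [decodeExpr, decode, eval_divs, hs.base, hs.rank, hs.weight]

/-- The size of `B` matters because each of its columns contributes the shift `weightBound W` to
every digit, and decoding subtracts `r` times this shift. -/
theorem decode_sum_weightCode {B : Finset (Fin n)} (hB : B.card = r) :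
    decode r W ((∑ j ∈ B, weightCode W j : ℕ) : ℤ) =
      W.mulVec ((B : Set (Fin n)).indicator 1) := by
  funext i
  rw [← decode_sum_colWeight (weight_le W) (natCast_weightBase W) (by positivity) hB i]
  push_cast
  simp only [natCast_weightCode]
  rfl

/-- Whether `v` is at least as good as `u`, according to the oracle. -/
def prefers (opt : Sense) (O : (Fin d → ℤ) → (Fin d → ℤ) → Bool) (u v : Fin d → ℤ) : Bool :=
  match opt with
  | .max => O u v
  | .min => O v u

/-- The first value for maximization, the second one for minimization. -/
def Sense.pick {α : Type*} (opt : Sense) (a a' : α) : α :=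
  match opt with
  | .max => a
  | .min => a'

/-- Find the best weight that is attained. -/
def scanProgram (d : ℕ) (opt : Sense) : Program d :=
  .seq (.set 9 (lit (-1))) (.forLoop 14 (reg 6)
    (.seq (.set 8 (reg 8 + reg 4))
    (.seq (.ite (bin .eq (reg 8 % reg 5) (reg 4)) .skip
      (.seq (.query 20 (decodeExpr (opt.pick 9 14)) (decodeExpr (opt.pick 14 9)))
        (.ite (reg 20 + bin .lt (reg 9) (lit 0)) (.set 9 (reg 14)) .skip)))
      (.set 8 (reg 8 / reg 5)))))

/-! ### The running optimum of a scan. -/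

/-- The number `v` is the best among the attained numbers below `k`, or `-1` if there is none. -/
def IsBest (A : ℕ → Prop) (le : ℤ → ℤ → Prop) (k : ℕ) (v : ℤ) : Prop :=
  (v = -1 ∧ ∀ i < k, ¬ A i) ∨ ∃ m < k, v = m ∧ A m ∧ ∀ i < k, A i → le i m

theorem IsBest.succ_of_not {A : ℕ → Prop} {le : ℤ → ℤ → Prop} {k : ℕ} {v : ℤ}
    (h : IsBest A le k v) (hk : ¬ A k) : IsBest A le (k + 1) v := by
  rcases h with ⟨hv, h⟩ | ⟨m, hm, hv, hA, h⟩
  · refine Or.inl ⟨hv, fun i hi => ?_⟩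
    rcases Nat.lt_succ_iff_lt_or_eq.1 hi with hi | rfl
    exacts [h i hi, hk]
  · refine Or.inr ⟨m, by omega, hv, hA, fun i hi hAi => ?_⟩
    rcases Nat.lt_succ_iff_lt_or_eq.1 hi with hi | rfl
    exacts [h i hi hAi, absurd hAi hk]

/-- The case `v < 0` is the first attained number: there the program has queried a meaningless
vector decoded from `-1`, and the answer must be ignored. -/
theorem IsBest.succ {A : ℕ → Prop} {le : ℤ → ℤ → Prop} (htrans : ∀ u v w, le u v → le v w → le u w)
    (htotal : ∀ u v, le u v ∨ le v u) {k : ℕ} {v : ℤ} (h : IsBest A le k v) (hk : A k) :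
    ((v < 0 ∨ le v k) → IsBest A le (k + 1) k) ∧
      (¬ (v < 0 ∨ le v k) → IsBest A le (k + 1) v) := by
  have hkk : le k k := (htotal k k).elim id id
  rcases h with ⟨hv, h⟩ | ⟨m, hm, hv, hA, h⟩
  · refine ⟨fun _ => Or.inr ⟨k, by omega, rfl, hk, fun i hi hAi => ?_⟩, fun h' => by omega⟩
    rcases Nat.lt_succ_iff_lt_or_eq.1 hi with hi | rfl
    exacts [absurd hAi (h i hi), hkk]
  · subst hv
    refine ⟨fun h' => Or.inr ⟨k, by omega, rfl, hk, fun i hi hAi => ?_⟩, fun h' =>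
      Or.inr ⟨m, by omega, rfl, hA, fun i hi hAi => ?_⟩⟩
    · have hmk : le m k := h'.resolve_left (by omega)
      rcases Nat.lt_succ_iff_lt_or_eq.1 hi with hi | rfl
      exacts [htrans _ _ _ (h i hi hAi) hmk, hkk]
    · rcases Nat.lt_succ_iff_lt_or_eq.1 hi with hi | rfl
      exacts [h i hi hAi, (htotal _ _).resolve_left fun hle => h' (Or.inr hle)]

/-- This also covers `-1`, which becomes 0. It keeps the later loops within their bounds on unlucky
coins too, when no attained number is found. -/
theorem IsBest.toNat_lt {A : ℕ → Prop} {le : ℤ → ℤ → Prop} {k : ℕ} (hk : 0 < k) {v : ℤ}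
    (h : IsBest A le k v) : v.toNat < k := by
  rcases h with ⟨hv, -⟩ | ⟨m, hm, hv, -⟩ <;> omega

theorem runs_scanProgram {opt : Sense} {s : Store} (hb : 1 ≤ b) (hrn : r ≤ n)
    (hcb : cellBound M₁ M₂ W ≤ 2 ^ b) (hx : ∀ j, (x j).natAbs ≤ 2 ^ (3 * n + 1))
    (hs : Sampled M₁ M₂ W x s) {S : Finset (Fin n)} (hS : HoldsSet S s)
    (h8 : s.reg 8 = genValue M₁ M₂ W x S)
    (htrans : ∀ u v w, prefers opt O u v → prefers opt O v w → prefers opt O u w)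
    (htotal : ∀ u v, prefers opt O u v ∨ prefers opt O v u) :
    Runs O ω b (loopBound W) (scanProgram d opt) s fun s' =>
      IsBest (fun k => gcoeff M₁ M₂ (weightCode W) x S k ≠ 0)
        (fun u v => prefers opt O (decode r W u) (decode r W v)) (weightBase W ^ d) (s'.reg 9) ∧
      Sampled M₁ M₂ W x s' ∧ HoldsSet S s' := by
  have hXb := (loopBound_le_cellBound M₁ M₂ W).trans hcb
  have hX : loopBound W = d * n + n * n + 6 * n + 4 + d + weightBound W + weightBase W +
    weightBase W ^ d := rfl
  set A := fun k => gcoeff M₁ M₂ (weightCode W) x S k ≠ 0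
  set le : ℤ → ℤ → Prop := fun u v => prefers opt O (decode r W u) (decode r W v) = true with hle
  have htrans' : ∀ u v w, le u v → le v w → le u w := fun u v w => htrans _ _ _
  have htotal' : ∀ u v, le u v ∨ le v u := fun u v => htotal _ _
  refine .seq (.set hb (by simp [Nat.one_le_two_pow]) ?_)
  refine .forLoop (N := weightBase W ^ d) hb (by omega) hXb rfl (fun k s' =>
    s'.reg 8 = shifts (digitBound M₁ M₂) (evalPoint M₁ M₂) (genValue M₁ M₂ W x S) k ∧
    IsBest A le k (s'.reg 9)) ?_ ?_ ?_ ?_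
  · exact ⟨by simpa [shifts] using h8, Or.inl ⟨by simp, by simp⟩⟩
  · intro k _ s' hf _ _
    simp only [eval_reg, hf.reg 6 rfl, Store.setReg_reg]
    simp only [show (6 : ℕ) ≠ 9 by decide, if_false, hs.ready.codes, Int.toNat_natCast]
  · rintro k hk s' - hf hik ⟨hV, hB⟩
    have hs₁ : Ready M₁ M₂ W (s.setReg 9 ((lit (-1)).eval s)) :=
      hs.ready.frame (Exec.set (O := O) (ω := ω) s 9 (lit (-1))).frame rfl rfl
    have hs' : Ready M₁ M₂ W s' := hs₁.frame hf rfl rfl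
    have hVb := natAbs_shifts_genValue_le hrn hx hs hS hk.le
    have hadd : (shifts (digitBound M₁ M₂) (evalPoint M₁ M₂) (genValue M₁ M₂ W x S) k +
        digitBound M₁ M₂).natAbs ≤ 2 ^ b := by
      refine (Int.natAbs_add_le _ _).trans ?_
      rw [Int.natAbs_natCast]
      omega
    have hev : (reg 8 + reg 4).eval s' =
        shifts (digitBound M₁ M₂) (evalPoint M₁ M₂) (genValue M₁ M₂ W x S) k +
          digitBound M₁ M₂ := by simp [hV, hs'.digit]
    refine .seq (.set hb (by rwa [hev]) ?_)
    rw [hev]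
    set s₂ := s'.setReg 8 (shifts (digitBound M₁ M₂) (evalPoint M₁ M₂)
      (genValue M₁ M₂ W x S) k + digitBound M₁ M₂) with hs₂
    have hdig := digit_eq_iff (M₁ := M₁) (M₂ := M₂) (W := W) hrn hx S hk
    have hready₂ : Ready M₁ M₂ W s₂ :=
      hs'.frame (p := (.set 8 (lit 0) : Program d))
        ⟨fun y hy => by simp_all [writesReg], fun _ _ => rfl, fun _ => rfl⟩ rfl rfl
    refine .seq (.conseq (Q := fun s'' => IsBest A le (k + 1) (s''.reg 9)) ?_ ?_)
    · refine .ite hb (fun h => .skip ?_) (fun h => .seq (.query hb ?_))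
      · have : ¬ A k := by
          have h' : (shifts (digitBound M₁ M₂) (evalPoint M₁ M₂) (genValue M₁ M₂ W x S) k +
            digitBound M₁ M₂) % (evalPoint M₁ M₂ : ℤ) = digitBound M₁ M₂ := by
            by_contra hcon
            apply h
            simp [hs₂, hs'.point, hs'.digit, hcon]
          exact not_not.2 (hdig.1 h')
        simpa [hs₂] using hB.succ_of_not this
      · have hAk : A k := by
          intro h0
          have := hdig.2 h0
          simp [hs₂, hs'.point, hs'.digit, this] at h
        have hq : O (fun i => (decodeExpr (opt.pick 9 14) i).eval s₂)
            (fun i => (decodeExpr (opt.pick 14 9) i).eval s₂) =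
            prefers opt O (decode r W (s'.reg 9)) (decode r W k) := by
          have e9 : (fun i => (decodeExpr 9 i : Expr).eval s₂) = decode r W (s'.reg 9) := by
            rw [eval_decodeExpr hready₂]
            simp [hs₂]
          have e14 : (fun i => (decodeExpr 14 i : Expr).eval s₂) = decode r W k := by
            rw [eval_decodeExpr hready₂]
            simp [hs₂, hik]
          cases opt <;> simp only [prefers, Sense.pick, e9, e14]
        rw [hq]
        have hsucc := hB.succ htrans' htotal' hAk
        -- The sum of two 0/1 values is nonzero exactly when one of the two tests succeeds.
        have hcond : (reg 20 + bin .lt (reg 9) (lit 0)).eval (s₂.setReg 20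
            (if prefers opt O (decode r W (s'.reg 9)) (decode r W k) = true then 1 else 0)) ≠ 0 ↔
            s'.reg 9 < 0 ∨ le (s'.reg 9) k := by
          simp only [eval_add, eval_reg, Store.setReg_reg, eval_lt, eval_lit, hs₂, hle]
          simp only [if_true, show (9 : ℕ) ≠ 20 by decide, show (9 : ℕ) ≠ 8 by decide, if_false]
          split_ifs with h1 h2 h2 <;> simp [h1, h2]
        refine .ite hb (fun h1 => .set hb ?_ ?_) (fun h1 => .skip ?_)
        · have : k ≤ 2 ^ b := by omega
          simpa [hs₂, hik] using this
        · simpa [hs₂, hik] using hsucc.1 (hcond.1 h1)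
        · simpa [hs₂] using hsucc.2 fun h2 => hcond.2 h2 h1
    · intro s₃ _ hf₃ hB₃
      have hk8 : s₃.reg 8 = shifts (digitBound M₁ M₂) (evalPoint M₁ M₂)
          (genValue M₁ M₂ W x S) k + digitBound M₁ M₂ := by
        rw [hf₃.reg 8 rfl]
        simp [hs₂]
      have hk5 : s₃.reg 5 = evalPoint M₁ M₂ := by
        rw [hf₃.reg 5 rfl]
        exact hready₂.point
      refine .set hb ?_ ⟨?_, ?_⟩
      · simp only [eval_div, eval_reg, hk8, hk5]
        exact (Int.natAbs_ediv_le_natAbs _ _).trans hadd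
      · simp [hk8, hk5, shifts]
      · simpa using hB₃
  · rintro s' - hf - ⟨-, hB⟩
    have hs₁ : Ready M₁ M₂ W (s.setReg 9 ((lit (-1)).eval s)) :=
      hs.ready.frame (Exec.set (O := O) (ω := ω) s 9 (lit (-1))).frame rfl rfl
    refine ⟨hB, ⟨hs₁.frame hf rfl rfl, fun j => ?_, fun q hq => ?_⟩, fun j => ?_⟩
    · rw [hf.mem 4 rfl]
      exact hs.value j
    · rw [hf.mem 6 rfl]
      exact hs.layer q hq
    · rw [hf.mem 3 rfl]
      exact hS j

/-! ### Self-reduction -/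

/-- Delete a column if the best weight is still attained. -/
def greedyRound : Program d :=
  .seq (.store 3 (reg 13) (lit 0))
    (.seq detProgram
    (.seq (.fold 8 14 (reg 8) (reg 9) ((reg 8 + reg 4) / reg 5))
      (.store 3 (reg 13) (bin .eq ((reg 8 + reg 4) % reg 5) (reg 4)))))

/-- Delete columns as long as the best weight is attained. -/
def greedyProgram (d : ℕ) : Program d := .forLoop 13 (reg 0) greedyRound

/-- Column `k` is removed tentatively by writing 0, the determinant is recomputed, and the digit
number `v.toNat` is tested. The result of the test is itself the new cell: 0 confirms the deletion,
1 undoes it. -/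
theorem runs_greedyProgram {s : Store} {v : ℤ} (hb : 1 ≤ b) (hrn : r ≤ n)
    (hcb : cellBound M₁ M₂ W ≤ 2 ^ b) (hx : ∀ j, (x j).natAbs ≤ 2 ^ (3 * n + 1))
    (hs : Sampled M₁ M₂ W x s) (hS : HoldsSet (Finset.univ : Finset (Fin n)) s)
    (h9 : s.reg 9 = v) (hv : v.toNat < weightBase W ^ d) :
    Runs O ω b (loopBound W) (greedyProgram d) s fun s' =>
      HoldsSet (greedy (fun S => gcoeff M₁ M₂ (weightCode W) x S v.toNat ≠ 0) n) s' := by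
  have hXb := (loopBound_le_cellBound M₁ M₂ W).trans hcb
  have hX : loopBound W = d * n + n * n + 6 * n + 4 + d + weightBound W + weightBase W +
    weightBase W ^ d := rfl
  set P : Finset (Fin n) → Prop := fun S => gcoeff M₁ M₂ (weightCode W) x S v.toNat ≠ 0 with hP
  refine .forLoop (N := n) hb (by omega) hXb rfl
    (fun k s' => Sampled M₁ M₂ W x s' ∧ HoldsSet (greedy P k) s') ?_ ?_ ?_ ?_
  · have hf : Frame (.set 13 (lit 0) : Program d) s (s.setReg 13 0) :=
      (Exec.set (O := O) (ω := ω) s 13 (lit 0)).frame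
    exact ⟨⟨hs.ready.frame hf rfl rfl, hs.value, hs.layer⟩, hS⟩
  · intro k _ s' hf _ _
    simp [hf.reg 0 rfl, hs.ready.cols]
  · rintro k hk s' - hf hik ⟨hs', hS'⟩
    have h9' : s'.reg 9 = v := by rw [hf.reg 9 rfl, h9]
    refine .seq (.store hb (by simp) ?_)
    have hf₁ : Frame (.store 3 (reg 13) (lit 0) : Program d) s'
        (s'.setMem 3 ((reg 13).eval s') ((lit 0).eval s')) :=
      (Exec.store (O := O) (ω := ω) s' 3 (reg 13) (lit 0)).frame
    set s₁ := s'.setMem 3 ((reg 13).eval s') ((lit 0).eval s') with hs₁def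
    have hs₁ : Sampled M₁ M₂ W x s₁ := by
      refine ⟨hs'.ready.frame hf₁ rfl rfl, fun j => ?_, fun q hq => ?_⟩
      · rw [hf₁.mem 4 rfl]
        exact hs'.value j
      · rw [hf₁.mem 6 rfl]
        exact hs'.layer q hq
    have hS₁ : HoldsSet ((greedy P k).filter fun j => (j : ℕ) ≠ k) s₁ := by
      intro j
      simp only [hs₁def, Store.setMem_mem, if_true, Function.update_apply, eval_reg, eval_lit, hik,
        Nat.cast_inj, Finset.mem_filter, hS' j]
      by_cases hj : (j : ℕ) = k <;> simp [hj]
    refine .seq ((runs_detProgram_of_sampled hb hrn hcb hx hs₁ hS₁).conseq ?_)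
    rintro s₂ - hf₂ ⟨h8, hs₂, hS₂⟩
    have h9₂ : s₂.reg 9 = v := by rw [hf₂.reg 9 rfl, hf₁.reg 9 rfl, h9']
    have h13₂ : s₂.reg 13 = k := by rw [hf₂.reg 13 rfl, hf₁.reg 13 rfl, hik]
    have hVb : ∀ i ≤ v.toNat, _ := fun i hi =>
      natAbs_shifts_genValue_le hrn hx hs₂ hS₂ (k := i) (hi.trans hv.le)
    refine .seq (.fold hb v.toNat (shifts (digitBound M₁ M₂) (evalPoint M₁ M₂)
      (genValue M₁ M₂ W x ((greedy P k).filter fun j => (j : ℕ) ≠ k))) (by decide) (by omega) hXb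
      (fun i hi => ?_) (by simp [h8, shifts]) (fun i _ => ?_) (fun i _ => ?_) ?_)
    · have := hVb i hi
      omega
    · simp [h9₂]
    · simp [shifts, hs₂.ready.digit, hs₂.ready.point]
    · have hdig := digit_eq_iff (M₁ := M₁) (M₂ := M₂) (W := W) hrn hx
        ((greedy P k).filter fun j => (j : ℕ) ≠ k) hv
      refine .store hb ?_ ⟨⟨?_, ?_, ?_⟩, ?_⟩
      · rw [eval_eq]
        split_ifs <;> simp [Nat.one_le_two_pow]
      · have hr := hs₂.ready
        exact ⟨hr.cols, hr.rank, hr.weight, hr.base, hr.digit, hr.point, hr.codes, hr.coins,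
          hr.fst, hr.snd, hr.weights⟩
      · exact hs₂.value
      · exact hs₂.layer
      · intro j
        have hev : (bin .eq ((reg 8 + reg 4) % reg 5) (reg 4)).eval
            ((s₂.setReg 8 (shifts (digitBound M₁ M₂) (evalPoint M₁ M₂) (genValue M₁ M₂ W x
              ((greedy P k).filter fun j => (j : ℕ) ≠ k)) v.toNat)).setReg 14 v.toNat) =
            if P ((greedy P k).filter fun j => (j : ℕ) ≠ k) then 0 else 1 := by
          simp only [eval_eq, eval_mod, eval_add, eval_reg, Store.setReg_reg]
          simp only [show (8 : ℕ) ≠ 14 by decide, show (4 : ℕ) ≠ 14 by decide,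
            show (5 : ℕ) ≠ 14 by decide, show (4 : ℕ) ≠ 8 by decide, show (5 : ℕ) ≠ 8 by decide,
            if_false, if_true, hs₂.ready.digit, hs₂.ready.point]
          by_cases hc : P ((greedy P k).filter fun j => (j : ℕ) ≠ k)
          · rw [if_pos hc, if_neg fun h => hc (hdig.1 h)]
          · rw [if_neg hc, if_pos (hdig.2 (not_not.1 hc))]
        rw [hev]
        simp only [Store.setReg_mem, Store.setMem_mem, if_true, Function.update_apply, eval_reg,
          Store.setReg_reg]
        simp only [show (13 : ℕ) ≠ 14 by decide, show (13 : ℕ) ≠ 8 by decide, if_false, h13₂,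
          Nat.cast_inj, hS₂ j, greedy]
        by_cases hj : (j : ℕ) = k
        · obtain rfl : j = ⟨k, hk⟩ := Fin.ext hj
          -- Previous rounds delete only smaller columns, so column `k` was present and writing 1
          -- restores the old set.
          have hmem : (⟨k, hk⟩ : Fin n) ∈ greedy P k := by
            have : ∀ i ≤ k, (⟨k, hk⟩ : Fin n) ∈ greedy P i := by
              intro i
              induction i with
              | zero => exact fun _ => Finset.mem_univ _
              | succ i ih =>
                intro hi
                rw [greedy]
                split_ifs
                · exact Finset.mem_filter.2 ⟨ih (by omega), by simp; omega⟩
                · exact ih (by omega)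
            exact this k le_rfl
          split_ifs <;> simp_all
        · split_ifs <;> simp_all
  · rintro s' - - - ⟨-, h⟩
    exact h

/-! ### The whole algorithm -/

/-- The algorithm for nonlinear matroid intersection. -/
def mainProgram (d : ℕ) (opt : Sense) : Program d :=
  .seq (setupProgram d) (.seq (sampleProgram d)
    (.seq detProgram (.seq (scanProgram d opt) (greedyProgram d))))

theorem natAbs_samplePoint_le (ω : ℕ → Bool) (j : Fin n) :
    (samplePoint n ω j).natAbs ≤ 2 ^ (3 * n + 1) := natAbs_bits_le _ _ _

/-- No assumption on the coins enters: the run halts within the bounds for every outcome. Whether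
the point is revealing matters only for what the final set means. -/
theorem runs_mainProgram {opt : Sense} (hb : 1 ≤ b) (hrn : r ≤ n)
    (hcb : cellBound M₁ M₂ W ≤ 2 ^ b)
    (htrans : ∀ u v w, prefers opt O u v → prefers opt O v w → prefers opt O u w)
    (htotal : ∀ u v, prefers opt O u v ∨ prefers opt O v u) :
    Runs O ω b (loopBound W) (mainProgram d opt) (initialStore M₁ M₂ W) fun s' => ∃ v,
      IsBest (fun k => gcoeff M₁ M₂ (weightCode W) (samplePoint n ω) Finset.univ k ≠ 0)
        (fun u v => prefers opt O (decode r W u) (decode r W v)) (weightBase W ^ d) v ∧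
      HoldsSet (greedy (fun S => gcoeff M₁ M₂ (weightCode W) (samplePoint n ω) S v.toNat ≠ 0) n)
        s' := by
  have hx := natAbs_samplePoint_le (n := n) ω
  refine .seq ((runs_setupProgram hb hrn hcb).conseq fun s₁ _ hf₁ hs₁ => ?_)
  refine .seq ((runs_sampleProgram hb hcb hs₁ (hf₁.mem 6 rfl) (hf₁.coins rfl)).conseq ?_)
  rintro s₂ - - ⟨hs₂, hS₂⟩
  refine .seq ((runs_detProgram_of_sampled hb hrn hcb hx hs₂ hS₂).conseq ?_)
  rintro s₃ - - ⟨h8, hs₃, hS₃⟩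
  refine .seq ((runs_scanProgram hb hrn hcb hx hs₃ hS₃ h8 htrans htotal).conseq ?_)
  rintro s₄ - - ⟨hB, hs₄, hS₄⟩
  have hpos : 0 < weightBase W ^ d := Nat.pow_pos (by unfold weightBase; omega)
  exact (runs_greedyProgram hb hrn hcb hx hs₄ hS₄ rfl (hB.toNat_lt hpos)).conseq
    fun s₅ _ _ h => ⟨_, hB, h⟩

/-! ### Optimality of the output at revealing points. -/

theorem mem_commonBaseVectors_iff (h₁ : (vectorialMatroid M₁).eRank = (r : ℕ∞))
    (h₂ : (vectorialMatroid M₂).eRank = (r : ℕ∞)) {y : Fin n → ℤ} :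
    y ∈ commonBaseVectors M₁ M₂ ↔ ∃ B : Finset (Fin n),
      colMinor M₁ B * colMinor M₂ B ≠ 0 ∧ y = (B : Set (Fin n)).indicator 1 := by
  classical
  constructor
  · rintro ⟨B, hB₁, hB₂, rfl⟩
    refine ⟨B.toFinset, mul_ne_zero ((isBase_iff_colMinor_ne_zero h₁ _).1 ?_)
      ((isBase_iff_colMinor_ne_zero h₂ _).1 ?_), ?_⟩ <;> simp [*]
  · rintro ⟨B, hB, rfl⟩
    exact ⟨B, (isBase_iff_colMinor_ne_zero h₁ _).2 (left_ne_zero_of_mul hB),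
      (isBase_iff_colMinor_ne_zero h₂ _).2 (right_ne_zero_of_mul hB), rfl⟩

theorem prefers_comparisonOracle {opt : Sense} {f : (Fin d → ℝ) → ℝ} {u v : Fin d → ℤ} :
    prefers opt (comparisonOracle f) u v = true ↔ match opt with
      | .max => f (fun i => (u i : ℝ)) ≤ f fun i => (v i : ℝ)
      | .min => f (fun i => (v i : ℝ)) ≤ f fun i => (u i : ℝ) := by
  cases opt <;> simp [prefers, comparisonOracle]

/-- A revealing point is used twice: every common base has an attained number, so the scan compares
against all of them and finds at least one; and the greedy set is a common base with the selected
number. -/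
theorem isOptimal_output {opt : Sense} {f : (Fin d → ℝ) → ℝ} {s : Store} {v : ℤ}
    (h₁ : (vectorialMatroid M₁).eRank = (r : ℕ∞)) (h₂ : (vectorialMatroid M₂).eRank = (r : ℕ∞))
    (hne : (commonBaseVectors M₁ M₂).Nonempty) (hx : Revealing M₁ M₂ (weightCode W) x)
    (hv : IsBest (fun k => gcoeff M₁ M₂ (weightCode W) x Finset.univ k ≠ 0)
      (fun u v => prefers opt (comparisonOracle f) (decode r W u) (decode r W v))
      (weightBase W ^ d) v)
    (hs : HoldsSet (greedy (fun S => gcoeff M₁ M₂ (weightCode W) x S v.toNat ≠ 0) n) s) :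
    IsOptimal opt M₁ M₂ W f (output n s) := by
  have hatt : ∀ B : Finset (Fin n), colMinor M₁ B * colMinor M₂ B ≠ 0 →
      gcoeff M₁ M₂ (weightCode W) x Finset.univ (∑ j ∈ B, weightCode W j) ≠ 0 :=
    fun B hB => hx B _ (Finset.subset_univ B) hB
  have hcard : ∀ B : Finset (Fin n), colMinor M₁ B * colMinor M₂ B ≠ 0 → B.card = r :=
    fun B hB => ((colMinor_ne_zero_iff B).1 (left_ne_zero_of_mul hB)).1
  obtain ⟨-, hno⟩ | ⟨m, hm, rfl, hA, hbest⟩ := hv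
  · obtain ⟨y, hy⟩ := hne
    obtain ⟨B, hB, -⟩ := (mem_commonBaseVectors_iff h₁ h₂).1 hy
    exact absurd (hatt B hB) (hno _ (sum_weightCode_lt W B))
  · rw [Int.toNat_natCast] at hs
    obtain ⟨hsum, hB⟩ := hx.greedy hA
    set B := greedy (fun S => gcoeff M₁ M₂ (weightCode W) x S m ≠ 0) n
    have hout : output n s = (B : Set (Fin n)).indicator 1 := by
      funext j
      simp [output, hs j, Set.indicator_apply]
    have hle : ∀ y ∈ commonBaseVectors M₁ M₂, prefers opt (comparisonOracle f)
        (W.mulVec y) (W.mulVec (output n s)) = true := by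
      intro y hy
      obtain ⟨B', hB', rfl⟩ := (mem_commonBaseVectors_iff h₁ h₂).1 hy
      have := hbest _ (sum_weightCode_lt W B') (hatt B' hB')
      rwa [← hsum, decode_sum_weightCode (hcard B' hB'), decode_sum_weightCode (hcard B hB),
        ← hout] at this
    refine ⟨(mem_commonBaseVectors_iff h₁ h₂).2 ⟨B, hB, hout⟩, ?_⟩
    cases opt <;> exact fun y hy => prefers_comparisonOracle.1 (hle y hy)

end

section

open Polynomial

variable {d n r : ℕ} {M₁ M₂ : Matrix (Fin r) (Fin n) ℤ} {W : Matrix (Fin d) (Fin n) ℤ}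

/-! ### Polynomial resource bounds -/

theorem eval_mono (p : ℕ[X]) : Monotone fun x => p.eval x := by
  intro x y hxy
  simp only [eval_eq_sum_range]
  gcongr

theorem rowMajor_eq_zero_or {m : ℕ} (A : Matrix (Fin m) (Fin n) ℤ) (k : ℤ) :
    rowMajor A k = 0 ∨ ∃ i j, rowMajor A k = A i j := by
  by_cases h : ∃ (i : Fin m) (j : Fin n), k = (i : ℤ) * (n : ℤ) + (j : ℤ)
  · obtain ⟨i, j, rfl⟩ := h
    exact Or.inr ⟨i, j, rowMajor_apply A i j⟩
  · push Not at h
    exact Or.inl (Finset.sum_eq_zero fun i _ => Finset.sum_eq_zero fun j _ => if_neg (h i j))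

theorem natAbs_rowMajor_le {m c : ℕ} {A : Matrix (Fin m) (Fin n) ℤ}
    (h : ∀ i j, (A i j).natAbs ≤ c) (k : ℤ) : (rowMajor A k).natAbs ≤ c := by
  rcases rowMajor_eq_zero_or A k with h0 | ⟨i, j, h0⟩ <;> rw [h0]
  exacts [Nat.zero_le _, h i j]

theorem sumSq_rowMajor_le {m c : ℕ} {A : Matrix (Fin m) (Fin n) ℤ}
    (h : ∀ i j, (A i j).natAbs ≤ c) : sumSq (rowMajor A) (m * n) ≤ m * n * (c * c) := by
  refine (Finset.sum_le_card_nsmul _ _ (c * c) fun k _ => ?_).trans (by simp)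
  exact Nat.mul_le_mul (natAbs_rowMajor_le h _) (natAbs_rowMajor_le h _)

theorem natAbs_le_maxAbs (i : Fin d) (j : Fin n) : (W i j).natAbs ≤ maxAbs W :=
  (Finset.le_sup (f := fun j => (W i j).natAbs) (Finset.mem_univ j)).trans
    (Finset.le_sup (f := fun i => Finset.univ.sup fun j => (W i j).natAbs) (Finset.mem_univ i))

theorem natAbs_le_two_pow_encodingLength (M : Matrix (Fin r) (Fin n) ℤ) (i : Fin r) (j : Fin n) :
    (M i j).natAbs ≤ 2 ^ encodingLength M := by
  have h1 : bitLength (M i j) ≤ encodingLength M :=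
    (Finset.single_le_sum (f := fun j => bitLength (M i j)) (fun _ _ => Nat.zero_le _)
      (Finset.mem_univ j)).trans
    (Finset.single_le_sum (f := fun i => ∑ j, bitLength (M i j)) (fun _ _ => Nat.zero_le _)
      (Finset.mem_univ i))
  refine (Nat.lt_size_self _).le.trans (Nat.pow_le_pow_right (by norm_num) ?_)
  unfold bitLength at h1
  omega

/-- A polynomial bound for `weightBase`. -/
noncomputable def basePoly (d : ℕ) : ℕ[X] := C (2 * d) * X ^ 4 + 1

/-- A polynomial bound for `loopBound`. -/
noncomputable def loopPoly (d : ℕ) : ℕ[X] :=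
  C d * X + X ^ 2 + 6 * X + 4 + C d + C d * X ^ 3 + basePoly d + basePoly d ^ d

/-- A polynomial bound for the number of bits of `evalPoint`. -/
noncomputable def pointPoly : ℕ[X] := (2 * X ^ 2 + 6 * X + 3) * (6 * X + 4) + 2

/-- A polynomial bound for the number of bits of `cellBound`. -/
noncomputable def cellPoly (d : ℕ) : ℕ[X] :=
  loopPoly d + 2 + pointPoly * ((basePoly d ^ d + 3) * (X + 1))

theorem weightBound_le {t : ℕ} (ht : n + maxAbs W ≤ t) : weightBound W ≤ d * t ^ 3 := by
  refine (sumSq_rowMajor_le (natAbs_le_maxAbs (W := W))).trans ?_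
  calc d * n * (maxAbs W * maxAbs W) ≤ d * t * (t * t) := by gcongr <;> omega
    _ = _ := by ring

theorem weightBase_le {t : ℕ} (ht : n + maxAbs W ≤ t) : weightBase W ≤ (basePoly d).eval t := by
  simp only [weightBase, basePoly, eval_add, eval_mul, eval_C, eval_pow, eval_X, eval_one]
  have := weightBound_le ht
  calc 2 * n * weightBound W + 1 ≤ 2 * t * (d * t ^ 3) + 1 := by gcongr; omega
    _ = _ := by ring

theorem loopBound_le {t : ℕ} (ht : n + maxAbs W ≤ t) : loopBound W ≤ (loopPoly d).eval t := by
  have h1 := weightBound_le ht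
  have h2 := weightBase_le ht
  have h3 := Nat.pow_le_pow_left h2 d
  have h4 : n ≤ t := by omega
  have h5 : d * n ≤ d * t := Nat.mul_le_mul_left _ h4
  have h6 : n * n ≤ t ^ 2 := by rw [pow_two]; exact Nat.mul_le_mul h4 h4
  simp only [loopBound, loopPoly, eval_add, eval_mul, eval_C, eval_pow, eval_X, eval_ofNat]
  omega

/-- Entries are at most 2 to the encoding length, so their sums of squares contribute polynomially
many bits, and the factor for the random point adds `3 * n + 1` more. -/
theorem entryBound_le_two_pow (hrn : r ≤ n) {t : ℕ}
    (ht : n + encodingLength M₁ + encodingLength M₂ ≤ t) :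
    entryBound M₁ M₂ ≤ 2 ^ (2 * t ^ 2 + 6 * t + 3) := by
  have hM : ∀ M : Matrix (Fin r) (Fin n) ℤ, encodingLength M ≤ t →
      sumSq (rowMajor M) (r * n) ≤ t ^ 2 * 2 ^ (2 * t) := by
    intro M hM
    refine (sumSq_rowMajor_le (natAbs_le_two_pow_encodingLength M)).trans ?_
    calc r * n * (2 ^ encodingLength M * 2 ^ encodingLength M)
        ≤ t * t * (2 ^ t * 2 ^ t) := by
          have hr : r ≤ t := by omega
          have hn : n ≤ t := by omega
          have h2 : 2 ^ encodingLength M ≤ 2 ^ t := Nat.pow_le_pow_right (by norm_num) hM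
          exact Nat.mul_le_mul (Nat.mul_le_mul hr hn) (Nat.mul_le_mul h2 h2)
      _ = _ := by ring
  have h1 := hM M₁ (by omega)
  have h2 := hM M₂ (by omega)
  have hone : 1 ≤ 2 ^ (2 * t) := Nat.one_le_two_pow
  unfold entryBound
  calc _ ≤ ((2 * t ^ 2 + t + 2) * 2 ^ (2 * t)) * 2 ^ (3 * t + 1) := by
        refine Nat.mul_le_mul ?_ (Nat.pow_le_pow_right (by norm_num) (by omega))
        calc _ ≤ t ^ 2 * 2 ^ (2 * t) + t ^ 2 * 2 ^ (2 * t) + (t + 2) * 1 := by omega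
          _ ≤ t ^ 2 * 2 ^ (2 * t) + t ^ 2 * 2 ^ (2 * t) + (t + 2) * 2 ^ (2 * t) := by gcongr
          _ = _ := by ring
    _ ≤ (2 ^ (2 * t ^ 2 + t + 2) * 2 ^ (2 * t)) * 2 ^ (3 * t + 1) := by
        gcongr
        exact Nat.lt_two_pow_self.le
    _ = _ := by
        rw [← pow_add, ← pow_add]
        congr 1
        ring

theorem evalPoint_le_two_pow (hrn : r ≤ n) {t : ℕ}
    (ht : n + encodingLength M₁ + encodingLength M₂ ≤ t) :
    evalPoint M₁ M₂ ≤ 2 ^ pointPoly.eval t := by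
  have h1 : digitBound M₁ M₂ ≤ 2 ^ ((2 * t ^ 2 + 6 * t + 3) * (6 * t + 4)) := by
    rw [pow_mul]
    refine (Nat.pow_le_pow_left (entryBound_le_two_pow hrn ht) _).trans
      (Nat.pow_le_pow_right Nat.one_le_two_pow (by omega))
  have h2 : 1 ≤ 2 ^ ((2 * t ^ 2 + 6 * t + 3) * (6 * t + 4)) := Nat.one_le_two_pow
  simp only [evalPoint, pointPoly, eval_add, eval_mul, eval_pow, eval_X, eval_ofNat, pow_add]
  omega

theorem cellBound_le_two_pow (hrn : r ≤ n) {t : ℕ}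
    (ht : n + maxAbs W + encodingLength M₁ + encodingLength M₂ ≤ t) :
    cellBound M₁ M₂ W ≤ 2 ^ (cellPoly d).eval t := by
  have h1 := loopBound_le (W := W) (t := t) (by omega)
  have h2 := evalPoint_le_two_pow (M₁ := M₁) (M₂ := M₂) (t := t) hrn (by omega)
  have h3 := Nat.pow_le_pow_left (weightBase_le (W := W) (t := t) (by omega)) d
  have h4 : n ≤ t := by omega
  simp only [cellPoly, eval_add, eval_mul, eval_pow, eval_X, eval_ofNat, eval_one]
  rw [pow_add, pow_mul]
  refine Nat.mul_le_mul ?_ ?_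
  · exact (by omega : loopBound W + 2 ≤ (loopPoly d).eval t + 2).trans Nat.lt_two_pow_self.le
  · refine (Nat.pow_le_pow_left h2 _).trans (Nat.pow_le_pow_right Nat.one_le_two_pow ?_)
    gcongr

theorem small_initialStore {b : ℕ} (hrn : r ≤ n) (hn : n ≤ 2 ^ b) {t : ℕ} (ht : t ≤ b)
    (h₁ : encodingLength M₁ ≤ t) (h₂ : encodingLength M₂ ≤ t) (hW : maxAbs W ≤ t) :
    (initialStore M₁ M₂ W).Small b := by
  have hM : ∀ M : Matrix (Fin r) (Fin n) ℤ, encodingLength M ≤ t →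
      ∀ k, (rowMajor M k).natAbs ≤ 2 ^ b := fun M hM k =>
    natAbs_rowMajor_le (fun i j => (natAbs_le_two_pow_encodingLength M i j).trans
      (Nat.pow_le_pow_right (by norm_num) (hM.trans ht))) k
  constructor
  · intro x
    rcases x with _ | _ | x
    · simpa [initialStore] using hn
    · simpa [initialStore] using hrn.trans hn
    · simp [initialStore]
  · intro a k
    rcases a with _ | _ | _ | a
    · exact hM M₁ h₁ k
    · exact hM M₂ h₂ k
    · exact natAbs_rowMajor_le (fun i j => (natAbs_le_maxAbs i j).trans
        ((hW.trans ht).trans Nat.lt_two_pow_self.le)) k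
    · simp [initialStore]

theorem rank_le (h : (vectorialMatroid M₁).eRank = (r : ℕ∞)) : r ≤ n := by
  have h1 := (vectorialMatroid M₁).eRank_le_encard_ground.trans
    (Set.encard_le_encard (Set.subset_univ _))
  rw [h, Set.encard_univ, ENat.card_eq_coe_fintype_card, Fintype.card_fin] at h1
  exact_mod_cast h1

/-- A polynomial bound for the number of elementary steps. -/
noncomputable def stepPoly (d : ℕ) (opt : Sense) : ℕ[X] :=
  (mainProgram d opt).time.comp (loopPoly d)

/-- A polynomial bound for the number of bits of all numbers that occur. -/
noncomputable def bitPoly (d : ℕ) (opt : Sense) : ℕ[X] :=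
  cellPoly d + X + C ((mainProgram d opt).maxLit + 1)

/-- A polynomial bound for the running time in the logarithmic cost measure. -/
noncomputable def logCostPoly (d : ℕ) (opt : Sense) : ℕ[X] :=
  stepPoly d opt * stepPoly d opt * (bitPoly d opt + 2)

theorem exec_mainProgram {opt : Sense} (h₁ : (vectorialMatroid M₁).eRank = (r : ℕ∞))
    (h₂ : (vectorialMatroid M₂).eRank = (r : ℕ∞)) (hne : (commonBaseVectors M₁ M₂).Nonempty)
    (f : (Fin d → ℝ) → ℝ) (ω : ℕ → Bool) :
    ∃ (s : Store) (c : ℕ × ℕ),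
      Exec (comparisonOracle f) ω (mainProgram d opt) (initialStore M₁ M₂ W) s c ∧
      c.1 ≤ (stepPoly d opt).eval (n + maxAbs W) ∧
      c.2 ≤ (logCostPoly d opt).eval
        (n + maxAbs W + encodingLength M₁ + encodingLength M₂) ∧
      (Revealing M₁ M₂ (weightCode W) (samplePoint n ω) →
        IsOptimal opt M₁ M₂ W f (output n s)) := by
  have hrn := rank_le h₁
  set t := n + maxAbs W + encodingLength M₁ + encodingLength M₂ with ht
  -- The three summands of `bitPoly` cover the computed numbers, the input, and the literals of the
  -- program; the final `+ 1` ensures `1 ≤ b`.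
  set b := (bitPoly d opt).eval t with hb
  have hb' : b = (cellPoly d).eval t + t + ((mainProgram d opt).maxLit + 1) := by
    simp [hb, bitPoly]
  have hcb : cellBound M₁ M₂ W ≤ 2 ^ b :=
    (cellBound_le_two_pow (t := t) hrn le_rfl).trans (Nat.pow_le_pow_right (by norm_num) (by omega))
  have hlit : (mainProgram d opt).maxLit ≤ 2 ^ b :=
    (by omega : (mainProgram d opt).maxLit ≤ b).trans Nat.lt_two_pow_self.le
  have hn : n ≤ 2 ^ b := (by omega : n ≤ b).trans Nat.lt_two_pow_self.le
  have htrans : ∀ u v w, prefers opt (comparisonOracle f) u v →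
      prefers opt (comparisonOracle f) v w → prefers opt (comparisonOracle f) u w := by
    intro u v w
    simp only [prefers_comparisonOracle]
    cases opt
    exacts [fun h h' => h.trans h', fun h h' => h'.trans h]
  have htotal : ∀ u v, prefers opt (comparisonOracle f) u v ∨
      prefers opt (comparisonOracle f) v u := by
    intro u v
    simp only [prefers_comparisonOracle]
    cases opt <;> exact le_total _ _
  obtain ⟨s, c, hexec, hc₁, hc₂, -, v, hbest, hset⟩ :=
    runs_mainProgram (ω := ω) (b := b) (by omega) hrn hcb htrans htotal
      (small_initialStore hrn hn (t := t) (by omega) (by omega) (by omega) (by omega)) hlit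
  -- Needed twice: at `n + maxAbs W` for the step bound, and at the larger `t` for the logarithmic
  -- cost, which is quadratic in the number of steps.
  have hstep : ∀ t', n + maxAbs W ≤ t' → c.1 ≤ (stepPoly d opt).eval t' := fun t' ht' => by
    rw [stepPoly, eval_comp]
    exact hc₁.trans (eval_mono _ (loopBound_le ht'))
  refine ⟨s, c, hexec, hstep _ le_rfl, ?_, fun hx => isOptimal_output h₁ h₂ hne hx hbest hset⟩
  have h1 := hstep t (by omega)
  refine le_trans hc₂ ?_
  simp only [logCostPoly, eval_mul, eval_add, eval_ofNat]
  gcongr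

end

end MatroidIntersection

theorem theorem4 (d : ℕ) (opt : MatroidIntersection.Sense) :
    ∃ (A : MatroidIntersection.Program d) (p q : Polynomial ℕ),
      ∀ (n r : ℕ) (M₁ M₂ : Matrix (Fin r) (Fin n) ℤ) (W : Matrix (Fin d) (Fin n) ℤ)
        (f : (Fin d → ℝ) → ℝ),
        (MatroidIntersection.vectorialMatroid M₁).eRank = (r : ℕ∞) →
        (MatroidIntersection.vectorialMatroid M₂).eRank = (r : ℕ∞) →
        (MatroidIntersection.commonBaseVectors M₁ M₂).Nonempty →
        (∀ ω : ℕ → Bool, ∃ (s : MatroidIntersection.Store) (c : ℕ × ℕ),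
          MatroidIntersection.Exec (MatroidIntersection.comparisonOracle f) ω A
            (MatroidIntersection.initialStore M₁ M₂ W) s c ∧
          c.1 ≤ p.eval (n + MatroidIntersection.maxAbs W) ∧
          c.2 ≤ q.eval (n + MatroidIntersection.maxAbs W +
            MatroidIntersection.encodingLength M₁ + MatroidIntersection.encodingLength M₂)) ∧
        (1 / 2 : ENNReal) ≤ MatroidIntersection.fairCoins
          {ω | ∃ (s : MatroidIntersection.Store) (c : ℕ × ℕ),
            MatroidIntersection.Exec (MatroidIntersection.comparisonOracle f) ω A
              (MatroidIntersection.initialStore M₁ M₂ W) s c ∧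
            MatroidIntersection.IsOptimal opt M₁ M₂ W f (MatroidIntersection.output n s)} := by
  refine ⟨MatroidIntersection.mainProgram d opt, MatroidIntersection.stepPoly d opt,
    MatroidIntersection.logCostPoly d opt,
    fun n r M₁ M₂ W f h₁ h₂ hne => ⟨fun ω => ?_, ?_⟩⟩
  · obtain ⟨s, c, hexec, hc₁, hc₂, -⟩ :=
      MatroidIntersection.exec_mainProgram (W := W) (opt := opt) h₁ h₂ hne f ω
    exact ⟨s, c, hexec, hc₁, hc₂⟩
  -- Every revealing outcome leads to an optimal output, so monotonicity transfers the probability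
  -- bound.
  · refine (MatroidIntersection.half_le_fairCoins_revealing M₁ M₂
      (MatroidIntersection.weightCode W)).trans (MeasureTheory.measure_mono fun ω hω => ?_)
    obtain ⟨s, c, hexec, -, -, hopt⟩ :=
      MatroidIntersection.exec_mainProgram (W := W) (opt := opt) h₁ h₂ hne f ω
    exact ⟨s, c, hexec, hopt hω⟩
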